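/- Let $\mathcal H$ be a complex Hilbert space and $s=+1$ (Bosons) or $s=-1$ (Fermions). Let $\Gamma_s(\mathcal H)=\bigoplus_{N\ge 0}\mathcal H_N$ be the Bose resp. Fermi Fock space, where $\mathcal H_N\subset\mathcal H^{\otimes N}$ is the subspace of symmetric resp. antisymmetric vectors, and let $\Gamma_s(A)$ denote the operator on Fock space acting on $\mathcal H_N$ as $A^{\otimes N}$. Let $\sigma\ge 0$ be a trace class operator on $\mathcal H$ and, in the Bose case, assume $\|\sigma\|<1$. Let $F$ be a positive operator valued measure on a measurable space $X$ with values in the bounded operators on $\mathcal H$ and $F(X)\le 1$, and write $F[g]=\int F(dx)\,g(x)$ for bounded measurable $g$. Then $\Gamma_s(\sigma)$ is bounded and trace class, $\rho=\Gamma_s(\sigma)/\operatorname{tr}\Gamma_s(\sigma)$ is a density operator (the gauge-invariant quasi-free state), and $1-s\sigma$ is invertible, so that $\widehat\sigma=\sigma(1-s\sigma)^{-1}$ is defined. Measure $F$ on every particle in the state $\rho$, where a particle gives no click with the effect $1-F(X)$. That is, on the $N$-particle space the record in $(X\cup\{\text{no click}\})^N$ is distributed according to $F^+(dx_1)\otimes\cdots\otimes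 F^+(dx_N)$, where $F^+$ is $F$ completed by the effect $1-F(X)$ of the outcome "no click". This defines a unique point process (the full counting statistics of the second quantized observable), namely the law of the empirical measure $\xi=\sum_k\delta_{x_k}$ of the clicks. For every measurable $f:X\to\mathbb R$, writing $\xi[f]=\int f\,d\xi$, its characteristic function $C(f)=\langle e^{i\xi[f]}\rangle$ satisfies $$C(f)=\operatorname{tr}\bigl(\rho\,\Gamma_s(F[e^{if}]+1-F(X))\bigr)=\det\bigl(1-s\,\widehat\sigma\,F[e^{if}-1]\bigr)^{-s},$$ where $\Gamma_s(F[e^{if}]+1-F(X))$ is bounded, its product with $\rho$ and the operator $\widehat\sigma F[e^{if}-1]$ are trace class, $\det$ is the Fredholm determinant, and the determinant is nonzero in the Bose case. If $F(X)=1$, the middle expression is $\operatorname{tr}\bigl(\rho\,\Gamma_s(F[e^{if}])\bigr)$. -/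

import Mathlib

namespace QuasiFree

open scoped TensorProduct InnerProductSpace ENNReal
open Filter Topology MeasureTheory

attribute [local instance 2000] InnerProductSpace.toInner

noncomputable section
universe u v

section
variable {H : Type u} [NormedAddCommGroup H] [InnerProductSpace ℂ H] {N : ℕ}

/-- Splitting off the last tensor factor: `H^{⊗(N+1)} ≃ H^{⊗N} ⊗ H` (algebraic). -/
def algSplit (H : Type u) [NormedAddCommGroup H] [InnerProductSpace ℂ H] (N : ℕ) :
    PiTensorProduct ℂ (fun _ : Fin (N + 1) => H) ≃ₗ[ℂ]
      (PiTensorProduct ℂ (fun _ : Fin N => H)) ⊗[ℂ] H :=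
  (PiTensorProduct.reindex ℂ (fun _ : Fin (N + 1) => H) finSumFinEquiv.symm).trans
    ((PiTensorProduct.tmulEquiv ℂ H (ι := Fin N) (ι₂ := Fin 1)).symm.trans
      (LinearEquiv.lTensor _ (PiTensorProduct.subsingletonEquiv (0 : Fin 1))))

theorem algSplit_tprod (x : Fin (N + 1) → H) :
    algSplit H N (PiTensorProduct.tprod ℂ x) =
      (PiTensorProduct.tprod ℂ fun i => x i.castSucc) ⊗ₜ[ℂ] x (Fin.last N) := by
  have h1 : PiTensorProduct.reindex ℂ (fun _ : Fin (N + 1) => H) finSumFinEquiv.symm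
      (PiTensorProduct.tprod ℂ x) = PiTensorProduct.tprod ℂ (fun i : Fin N ⊕ Fin 1 => x (finSumFinEquiv i)) :=
    PiTensorProduct.reindex_tprod (R := ℂ) (s := fun _ : Fin (N + 1) => H) finSumFinEquiv.symm x
  have h2 := PiTensorProduct.tmulEquiv_symm_apply ℂ H (ι := Fin N) (ι₂ := Fin 1) (fun i : Fin N ⊕ Fin 1 => x (finSumFinEquiv i))
  unfold algSplit
  rw [LinearEquiv.trans_apply, LinearEquiv.trans_apply, h1, h2, LinearEquiv.lTensor_tmul,
    PiTensorProduct.subsingletonEquiv_apply_tprod]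
  rfl

theorem exists_pullback_core {V : Type*} [NormedAddCommGroup V] [InnerProductSpace ℂ V]
    {W : Type*} [AddCommGroup W] [Module ℂ W] (e : W →ₗ[ℂ] V) (he : Function.Injective e) :
    ∃ c : InnerProductSpace.Core ℂ W, ∀ x y, c.inner x y = ⟪e x, e y⟫_ℂ :=
  ⟨{ inner := fun a b => ⟪e a, e b⟫_ℂ
     conj_inner_symm := fun a b => inner_conj_symm _ _
     re_inner_nonneg := fun a => inner_self_nonneg
     add_left := fun a b c => by rw [map_add, inner_add_left]
     smul_left := fun a b r => by rw [map_smul, inner_smul_left]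
     definite := fun a h => he (by rw [map_zero]; exact inner_self_eq_zero.1 h) },
    fun x y => rfl⟩

theorem exists_tensor_core {V : Type*} [AddCommGroup V] [Module ℂ V]
    (c : InnerProductSpace.Core ℂ V) (H : Type*) [NormedAddCommGroup H] [InnerProductSpace ℂ H] :
    ∃ c' : InnerProductSpace.Core ℂ (V ⊗[ℂ] H), ∀ a b h k,
      c'.inner (a ⊗ₜ h) (b ⊗ₜ k) = c.inner a b * ⟪h, k⟫_ℂ := by
  let i1 : NormedAddCommGroup V := c.toNormedAddCommGroup
  let i2 : InnerProductSpace ℂ V := InnerProductSpace.ofCore c.toCore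
  obtain ⟨c', hc'⟩ := exists_pullback_core (V := V ⊗[ℂ] H) (W := V ⊗[ℂ] H) LinearMap.id
    Function.injective_id
  refine ⟨c', fun a b h k => ?_⟩
  exact (hc' _ _).trans (TensorProduct.inner_tmul ℂ a b h k)

/-- The algebraic tensor power carries an inner product with
`⟪x₁ ⊗ ⋯ ⊗ x_N, y₁ ⊗ ⋯ ⊗ y_N⟫ = ∏ ⟪x_i, y_i⟫`. -/
theorem exists_core (H : Type u) [NormedAddCommGroup H] [InnerProductSpace ℂ H] (N : ℕ) :
    ∃ c : InnerProductSpace.Core ℂ (PiTensorProduct ℂ (fun _ : Fin N => H)),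
      ∀ x y : Fin N → H, c.inner (PiTensorProduct.tprod ℂ x) (PiTensorProduct.tprod ℂ y) =
        ∏ i, ⟪x i, y i⟫_ℂ := by
  induction N with
  | zero =>
    obtain ⟨c, hc⟩ := exists_pullback_core
      (PiTensorProduct.isEmptyEquiv (R := ℂ) (s := fun _ : Fin 0 => H) (Fin 0)).toLinearMap
      (LinearEquiv.injective _)
    refine ⟨c, fun x y => ?_⟩
    rw [hc]
    simp [PiTensorProduct.isEmptyEquiv_apply_tprod]
  | succ N ih =>
    obtain ⟨c, hc⟩ := ih
    obtain ⟨c', hc'⟩ := exists_tensor_core c H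
    let i1 : NormedAddCommGroup ((PiTensorProduct ℂ (fun _ : Fin N => H)) ⊗[ℂ] H) :=
      c'.toNormedAddCommGroup
    let i2 : InnerProductSpace ℂ ((PiTensorProduct ℂ (fun _ : Fin N => H)) ⊗[ℂ] H) :=
      InnerProductSpace.ofCore c'.toCore
    obtain ⟨d, hd⟩ := exists_pullback_core (algSplit H N).toLinearMap (algSplit H N).injective
    refine ⟨d, fun x y => ?_⟩
    rw [Fin.prod_univ_castSucc, ← hc, ← hc', ← algSplit_tprod, ← algSplit_tprod]
    exact hd _ _

variable (H N) in
/-- The algebraic tensor power of `H`, to be given the inner product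
`⟪x₁ ⊗ ⋯ ⊗ x_N, y₁ ⊗ ⋯ ⊗ y_N⟫ = ∏ ⟪x_i, y_i⟫`. -/
def TensorPow : Type u := PiTensorProduct ℂ (fun _ : Fin N => H)

instance : NormedAddCommGroup (TensorPow H N) :=
  @InnerProductSpace.Core.toNormedAddCommGroup ℂ (PiTensorProduct ℂ (fun _ : Fin N => H)) _ _ _
    (Classical.choose (exists_core H N))
/-- The inner product on the algebraic tensor power. -/
@[reducible]
def auxIPS : @InnerProductSpace ℂ (PiTensorProduct ℂ (fun _ : Fin N => H)) _
    (@InnerProductSpace.Core.toNormedAddCommGroup ℂ (PiTensorProduct ℂ (fun _ : Fin N => H)) _ _ _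
    (Classical.choose (exists_core H N))).toSeminormedAddCommGroup :=
  @InnerProductSpace.ofCore ℂ (PiTensorProduct ℂ (fun _ : Fin N => H)) _ _ _
    (Classical.choose (exists_core H N)).toCore

instance : InnerProductSpace ℂ (TensorPow H N) where
  toModule := (auxIPS (H := H) (N := N)).toModule
  norm_smul_le := (auxIPS (H := H) (N := N)).norm_smul_le
  inner := (auxIPS (H := H) (N := N)).inner
  norm_sq_eq_re_inner := (auxIPS (H := H) (N := N)).norm_sq_eq_re_inner
  conj_inner_symm := (auxIPS (H := H) (N := N)).conj_inner_symm
  add_left := (auxIPS (H := H) (N := N)).add_left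
  smul_left := (auxIPS (H := H) (N := N)).smul_left

/-- The algebraic product tensors `x₁ ⊗ ⋯ ⊗ x_N`. -/
def tprod : MultilinearMap ℂ (fun _ : Fin N => H) (TensorPow H N) :=
  PiTensorProduct.tprod ℂ

theorem span_tprod : Submodule.span ℂ (Set.range (tprod : _ → TensorPow H N)) = ⊤ :=
  PiTensorProduct.span_tprod_eq_top

def algLift {M : Type*} [AddCommGroup M] [Module ℂ M] (f : MultilinearMap ℂ (fun _ : Fin N => H) M) :
    TensorPow H N →ₗ[ℂ] M := PiTensorProduct.lift f

theorem algLift_tprod {M : Type*} [AddCommGroup M] [Module ℂ M]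
    (f : MultilinearMap ℂ (fun _ : Fin N => H) M) (x : Fin N → H) : algLift f (tprod x) = f x :=
  PiTensorProduct.lift.tprod x

/-- `T₁ ⊗ ⋯ ⊗ T_N` on the algebraic tensor power. -/
def algMap (T : Fin N → H →L[ℂ] H) : TensorPow H N →ₗ[ℂ] TensorPow H N :=
  PiTensorProduct.map (fun i => (T i : H →ₗ[ℂ] H))

theorem algMap_tprod (T : Fin N → H →L[ℂ] H) (x : Fin N → H) :
    algMap T (tprod x) = tprod (fun i => T i (x i)) :=
  PiTensorProduct.map_tprod _ _

/-- Permutation of the tensor factors, on the algebraic tensor power. -/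
def algPerm (π : Equiv.Perm (Fin N)) : TensorPow H N →ₗ[ℂ] TensorPow H N :=
  (PiTensorProduct.reindex ℂ (fun _ : Fin N => H) π).toLinearMap

theorem algPerm_tprod (π : Equiv.Perm (Fin N)) (x : Fin N → H) :
    algPerm π (tprod x) = tprod (fun i => x (π.symm i)) :=
  PiTensorProduct.reindex_tprod (R := ℂ) (s := fun _ : Fin N => H) π x

theorem inner_tprod (x y : Fin N → H) :
    ⟪(tprod x : TensorPow H N), tprod y⟫_ℂ = ∏ i, ⟪x i, y i⟫_ℂ :=
  Classical.choose_spec (exists_core H N) x y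

theorem tprod_induction {p : TensorPow H N → Prop} (h0 : p 0) (ht : ∀ x, p (tprod x))
    (ha : ∀ a b, p a → p b → p (a + b)) (hs : ∀ (c : ℂ) a, p a → p (c • a)) (a : TensorPow H N) :
    p a := by
  have : a ∈ Submodule.span ℂ (Set.range (tprod : _ → TensorPow H N)) := by
    rw [span_tprod]; trivial
  induction this using Submodule.span_induction with
  | mem x hx => obtain ⟨y, rfl⟩ := hx; exact ht y
  | zero => exact h0
  | add x y _ _ hx hy => exact ha x y hx hy
  | smul c x _ hx => exact hs c x hx

theorem inner_map_map_of_tprod {V : Type*} [NormedAddCommGroup V] [InnerProductSpace ℂ V]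
    (f : TensorPow H N →ₗ[ℂ] V)
    (hf : ∀ x y : Fin N → H, ⟪f (tprod x), f (tprod y)⟫_ℂ = ⟪(tprod x : TensorPow H N), tprod y⟫_ℂ)
    (a b : TensorPow H N) : ⟪f a, f b⟫_ℂ = ⟪a, b⟫_ℂ := by
  induction a using tprod_induction with
  | h0 => simp
  | ha a a' h h' => rw [map_add, inner_add_left, inner_add_left, h, h']
  | hs c a h => rw [map_smul, inner_smul_left, inner_smul_left, h]
  | ht x =>
    induction b using tprod_induction with
    | h0 => simp
    | ha a a' h h' => rw [map_add, inner_add_right, inner_add_right, h, h']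
    | hs c a h => rw [map_smul, inner_smul_right, inner_smul_right, h]
    | ht y => exact hf x y

/-- `algSplit`, between inner product spaces. -/
def split (H : Type u) [NormedAddCommGroup H] [InnerProductSpace ℂ H] (N : ℕ) :
    TensorPow H (N + 1) →ₗ[ℂ] (TensorPow H N) ⊗[ℂ] H :=
  (algSplit H N).toLinearMap

theorem split_tprod (x : Fin (N + 1) → H) :
    split H N (tprod x) = (tprod fun i => x i.castSucc) ⊗ₜ[ℂ] x (Fin.last N) :=
  algSplit_tprod x

theorem norm_split (a : TensorPow H (N + 1)) : ‖split H N a‖ = ‖a‖ := by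
  have := inner_map_map_of_tprod (split H N) (fun x y => by
    rw [split_tprod, split_tprod, TensorProduct.inner_tmul, inner_tprod, inner_tprod,
      Fin.prod_univ_castSucc]) a a
  rw [norm_eq_sqrt_re_inner (𝕜 := ℂ), this, ← norm_eq_sqrt_re_inner (𝕜 := ℂ)]

theorem algMap_bound (T : Fin N → H →L[ℂ] H) : ∃ C, ∀ a, ‖algMap T a‖ ≤ C * ‖a‖ := by
  induction N with
  | zero =>
    refine ⟨1, fun a => ?_⟩
    have : algMap T = LinearMap.id := by
      apply LinearMap.ext
      intro a
      induction a using tprod_induction with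
      | h0 => simp
      | ha a a' h h' => rw [map_add, h, h', map_add]
      | hs c a h => rw [map_smul, h, map_smul]
      | ht x => rw [algMap_tprod]; exact congrArg _ (Subsingleton.elim _ _)
    rw [this]; simp
  | succ N ih =>
    obtain ⟨C, hC⟩ := ih (fun i => T i.castSucc)
    let S : TensorPow H N →L[ℂ] TensorPow H N := (algMap fun i => T i.castSucc).mkContinuous C hC
    refine ⟨‖TensorProduct.mapL S (T (Fin.last N))‖, fun a => ?_⟩
    have key : split H N (algMap T a) = TensorProduct.mapL S (T (Fin.last N)) (split H N a) := by
      induction a using tprod_induction with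
      | h0 => simp
      | ha a a' h h' => rw [map_add, map_add, h, h', map_add, map_add]
      | hs c a h => rw [map_smul, map_smul, h, map_smul, map_smul]
      | ht x =>
        rw [algMap_tprod, split_tprod, split_tprod, TensorProduct.mapL_tmul]
        congr 1
        exact (algMap_tprod _ _).symm
    rw [← norm_split, key, ← norm_split a]
    exact ContinuousLinearMap.le_opNorm _ _

theorem inner_algPerm (π : Equiv.Perm (Fin N)) (a b : TensorPow H N) :
    ⟪algPerm π a, algPerm π b⟫_ℂ = ⟪a, b⟫_ℂ :=
  inner_map_map_of_tprod _ (fun x y => by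
    rw [algPerm_tprod, algPerm_tprod, inner_tprod, inner_tprod]
    exact Equiv.prod_comp π.symm fun i => ⟪x i, y i⟫_ℂ) a b

theorem norm_algPerm (π : Equiv.Perm (Fin N)) (a : TensorPow H N) : ‖algPerm π a‖ = ‖a‖ := by
  rw [norm_eq_sqrt_re_inner (𝕜 := ℂ), inner_algPerm, ← norm_eq_sqrt_re_inner (𝕜 := ℂ)]

variable (H N) in
/-- The Hilbert space `H^{⊗N}` (`N`-fold Hilbert space tensor power). -/
abbrev Tensor : Type u := UniformSpace.Completion (TensorPow H N)

/-- The product vector `x₁ ⊗ ⋯ ⊗ x_N` in `H^{⊗N}`. -/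
def prodVec (x : Fin N → H) : Tensor H N := ((tprod x : TensorPow H N) : Tensor H N)

/-- Continuous extension to `H^{⊗N}` of a bounded operator on the algebraic tensor power. -/
def opExtend (f : TensorPow H N →ₗ[ℂ] TensorPow H N) : Tensor H N →L[ℂ] Tensor H N :=
  ((UniformSpace.Completion.toComplL (𝕜 := ℂ) (E := TensorPow H N) :
    TensorPow H N →ₗ[ℂ] Tensor H N) ∘ₗ f).extendOfNorm
    (UniformSpace.Completion.toComplL (𝕜 := ℂ) (E := TensorPow H N) :
    TensorPow H N →ₗ[ℂ] Tensor H N)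

theorem opExtend_coe (f : TensorPow H N →ₗ[ℂ] TensorPow H N) (hf : ∃ C, ∀ a, ‖f a‖ ≤ C * ‖a‖)
    (a : TensorPow H N) : opExtend f (a : Tensor H N) = ((f a : TensorPow H N) : Tensor H N) := by
  refine LinearMap.extendOfNorm_eq (f := (UniformSpace.Completion.toComplL (𝕜 := ℂ) (E := TensorPow H N) :
    TensorPow H N →ₗ[ℂ] Tensor H N) ∘ₗ f) UniformSpace.Completion.denseRange_coe ?_ a
  obtain ⟨C, hC⟩ := hf
  exact ⟨C, fun x => by simpa using hC x⟩

theorem prodVec_ext {V : Type*} [NormedAddCommGroup V] [NormedSpace ℂ V] {f g : Tensor H N →L[ℂ] V}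
   (h : ∀ x, f (prodVec x) = g (prodVec x)) : f = g := by
  ext a
  induction a using UniformSpace.Completion.induction_on with
  | hp => exact isClosed_eq f.continuous g.continuous
  | ih a =>
    induction a using tprod_induction with
    | h0 => rw [UniformSpace.Completion.coe_zero, map_zero, map_zero]
    | ht x => exact h x
    | ha a b h h' => rw [UniformSpace.Completion.coe_add, map_add, h, h', map_add]
    | hs c a h => rw [UniformSpace.Completion.coe_smul, map_smul, h, map_smul]

/-- The bounded operator `T₁ ⊗ ⋯ ⊗ T_N` on `H^{⊗N}`. -/
def tensorOp (T : Fin N → H →L[ℂ] H) : Tensor H N →L[ℂ] Tensor H N := opExtend (algMap T)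

theorem tensorOp_prodVec (T : Fin N → H →L[ℂ] H) (x : Fin N → H) :
    tensorOp T (prodVec x) = prodVec (fun i => T i (x i)) := by
  rw [prodVec, tensorOp, opExtend_coe _ (algMap_bound T), algMap_tprod]; rfl

/-- The unitary on `H^{⊗N}` that permutes the tensor factors. -/
def permOp (π : Equiv.Perm (Fin N)) : Tensor H N →L[ℂ] Tensor H N := opExtend (algPerm π)

theorem permOp_prodVec (π : Equiv.Perm (Fin N)) (x : Fin N → H) :
    permOp π (prodVec x) = prodVec (fun i => x (π.symm i)) := by
  rw [prodVec, permOp, opExtend_coe _ ⟨1, fun a => by rw [norm_algPerm, one_mul]⟩, algPerm_tprod]; rfl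

theorem inner_prodVec (x y : Fin N → H) : ⟪prodVec x, prodVec y⟫_ℂ = ∏ i, ⟪x i, y i⟫_ℂ := by
  rw [prodVec, prodVec, UniformSpace.Completion.inner_coe, inner_tprod]

/-- The character of the permutation group belonging to the statistics: trivial for Bosons
(`s = 1`), the signature for Fermions (`s = -1`). -/
def statSign (s : ℤˣ) (π : Equiv.Perm (Fin N)) : ℤˣ := if s = 1 then 1 else Equiv.Perm.sign π


/-- The `N`-particle space: the symmetric (`s = 1`) or antisymmetric (`s = -1`) vectors of
`H^{⊗N}`. -/
def Sector (H : Type u) [NormedAddCommGroup H] [InnerProductSpace ℂ H] (s : ℤˣ) (N : ℕ) :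
    Submodule ℂ (Tensor H N) :=
  ⨅ π : Equiv.Perm (Fin N),
    LinearMap.eqLocus (permOp π).toLinearMap
      ((((statSign s π : ℤˣ) : ℤ) : ℂ) • LinearMap.id)

theorem mem_Sector {s : ℤˣ} {ψ : Tensor H N} :
    ψ ∈ Sector H s N ↔ ∀ π, permOp π ψ = (((statSign s π : ℤˣ) : ℤ) : ℂ) • ψ := by
  simp [Sector, Submodule.mem_iInf, LinearMap.mem_eqLocus]

instance (s : ℤˣ) : CompleteSpace (Sector H s N) := by
  have : (Sector H s N : Set (Tensor H N)) =
      ⋂ π, {ψ | permOp π ψ = (((statSign s π : ℤˣ) : ℤ) : ℂ) • ψ} := by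
    ext ψ; simp [mem_Sector]
  have hc : IsClosed (Sector H s N : Set (Tensor H N)) := by
    rw [this]
    exact isClosed_iInter fun π => isClosed_eq (permOp π).continuous (by fun_prop)
  exact hc.completeSpace_coe

theorem tensorOp_mem_Sector (s : ℤˣ) (A : H →L[ℂ] H) (ψ : Sector H s N) :
    tensorOp (fun _ => A) (ψ : Tensor H N) ∈ Sector H s N := by
  rw [mem_Sector]
  intro π
  have h : permOp π ∘L tensorOp (fun _ : Fin N => A) = tensorOp (fun _ => A) ∘L permOp π :=
    prodVec_ext fun x => by
      simp only [ContinuousLinearMap.comp_apply, permOp_prodVec, tensorOp_prodVec]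
  have h2 := congrArg (fun f => f (ψ : Tensor H N)) h
  simp only [ContinuousLinearMap.comp_apply] at h2
  rw [h2, mem_Sector.1 ψ.2 π, map_smul]

/-- The restriction of `A^{⊗N}` to the `N`-particle space. -/
def sectorPow (s : ℤˣ) (A : H →L[ℂ] H) (N : ℕ) : Sector H s N →L[ℂ] Sector H s N :=
  ((tensorOp fun _ => A) ∘L (Sector H s N).subtypeL).codRestrict (Sector H s N)
    (tensorOp_mem_Sector s A)

/-- `P_s T P_s` as an operator on the `N`-particle space, `P_s` being the projection onto it. -/
def sectorCompress (s : ℤˣ) (T : Tensor H N →L[ℂ] Tensor H N) :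
    Sector H s N →L[ℂ] Sector H s N :=
  (Sector H s N).orthogonalProjectionOnto ∘L T ∘L (Sector H s N).subtypeL

/-- The Bose (`s = 1`) or Fermi (`s = -1`) Fock space over `H`: the Hilbert space direct sum of the
`N`-particle spaces, `N = 0, 1, 2, …`. -/
abbrev Fock (H : Type u) [NormedAddCommGroup H] [InnerProductSpace ℂ H] (s : ℤˣ) : Type u :=
  lp (fun N : ℕ => Sector H s N) 2

/-- The direct sum of the `N`-particle operators `A^{⊗N}` is a bounded operator on Fock space. -/
def FockBounded (s : ℤˣ) (A : H →L[ℂ] H) : Prop :=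
  BddAbove (Set.range fun N : ℕ => ‖sectorPow s A N‖)

open Classical in
/-- The second quantization `Γ_s(A)`: it acts on the `N`-particle space as `A^{⊗N}`. (It is set to
`0` when that prescription is not bounded.) -/
def Gamma (s : ℤˣ) (A : H →L[ℂ] H) : Fock H s →L[ℂ] Fock H s :=
  if h : FockBounded s A then
    lp.mapCLM 2 (fun N => sectorPow s A N) (K := ⨆ N, ‖sectorPow s A N‖)
      (Real.iSup_nonneg fun N => norm_nonneg (sectorPow s A N)) (fun N => le_ciSup h N)
  else 0

theorem Gamma_apply {s : ℤˣ} {A : H →L[ℂ] H} (h : FockBounded s A) (ψ : Fock H s) (N : ℕ) :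
    Gamma s A ψ N = sectorPow s A N (ψ N) := by
  rw [Gamma, dif_pos h]; rfl

/-- The operator on Fock space that acts as `P_s (T₁ ⊗ ⋯ ⊗ T_N) P_s` on the `N`-particle space and
as `0` on all the other ones. -/
def fockTensorOp (s : ℤˣ) (T : Fin N → H →L[ℂ] H) : Fock H s →L[ℂ] Fock H s :=
  lp.singleContinuousLinearMap ℂ (fun N : ℕ => Sector H s N) 2 N ∘L
    sectorCompress s (tensorOp T) ∘L lp.evalCLM ℂ (fun N : ℕ => Sector H s N) 2 N
end

section
variable {E : Type*} [NormedAddCommGroup E] [InnerProductSpace ℂ E] [CompleteSpace E]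

variable (E) in
/-- Index set of a fixed orthonormal basis of `E`. -/
def onbIndex : Set E := Classical.choose (exists_hilbertBasis ℂ E)

variable (E) in
/-- A fixed orthonormal basis of `E`. -/
def onb : HilbertBasis (onbIndex E) ℂ E :=
  Classical.choose (Classical.choose_spec (exists_hilbertBasis ℂ E))

/-- The trace `∑ ⟪e_i, T e_i⟫` (for `T` trace class, independent of the orthonormal basis). -/
def trace (T : E →L[ℂ] E) : ℂ := ∑' i, ⟪onb E i, T (onb E i)⟫_ℂ

/-- Trace class: `|T| = √(T* T)` has finite trace (this is independent of the orthonormal basis). -/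
def IsTraceClass (T : E →L[ℂ] E) : Prop :=
  Summable fun i => (⟪onb E i, CFC.abs T (onb E i)⟫_ℂ).re

open Classical in
/-- The Fredholm determinant `det T` of an operator `T` for which `T - 1` is trace class: the limit,
along the finite subsets `S` of an orthonormal basis, of the determinants of the finite sections
`(⟪e_i, T e_j⟫)_{i, j ∈ S}` (independent of the basis). -/
def fredholmDet (T : E →L[ℂ] E) : ℂ :=
  limUnder atTop fun S : Finset (onbIndex E) =>
    Matrix.det (Matrix.of fun i j : S => ⟪onb E i, T (onb E j)⟫_ℂ)
end

section
/-- An observable with outcomes in `X`: a positive operator valued measure `F` with `F(X) ≤ 1`,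
countably additive in the strong operator topology. Only the values on measurable sets matter. -/
structure POVM (X : Type v) [MeasurableSpace X]
    (H : Type u) [NormedAddCommGroup H] [InnerProductSpace ℂ H] [CompleteSpace H] where
  toFun : Set X → H →L[ℂ] H
  nonneg : ∀ B, MeasurableSet B → 0 ≤ toFun B
  univ_le_one : toFun Set.univ ≤ 1
  hasSum : ∀ B : ℕ → Set X, (∀ n, MeasurableSet (B n)) →
    Pairwise (Function.onFun Disjoint B) →
    ∀ ψ : H, HasSum (fun n => toFun (B n) ψ) (toFun (⋃ n, B n) ψ)

variable {X : Type v} [MeasurableSpace X]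
  {H : Type u} [NormedAddCommGroup H] [InnerProductSpace ℂ H] [CompleteSpace H]

instance : CoeFun (POVM X H) (fun _ => Set X → H →L[ℂ] H) := ⟨POVM.toFun⟩

theorem POVM.empty (F : POVM X H) : F ∅ = 0 := by
  ext ψ
  have h := F.hasSum (fun _ => ∅) (fun _ => MeasurableSet.empty)
    (fun _ _ _ => disjoint_bot_left) ψ
  have h2 := h.summable
  rw [summable_const_iff] at h2
  simpa using h2

open scoped ComplexOrder in
theorem POVM.inner_eq (F : POVM X H) {B : Set X} (hB : MeasurableSet B) (ψ : H) :
    0 ≤ (⟪ψ, F B ψ⟫_ℂ).re ∧ ⟪ψ, F B ψ⟫_ℂ = ((⟪ψ, F B ψ⟫_ℂ).re : ℂ) := by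
  have h := (ContinuousLinearMap.nonneg_iff_isPositive _).1 (F.nonneg B hB)
  have h0 : (0 : ℂ) ≤ ⟪ψ, F B ψ⟫_ℂ := h.inner_nonneg_right ψ
  rw [Complex.le_def] at h0
  exact ⟨h0.1, Complex.ext (by simp) (by simpa using h0.2.symm)⟩

/-- The measure `B ↦ ⟨ψ, F(B) ψ⟩`. -/
def POVM.measure (F : POVM X H) (ψ : H) : Measure X :=
  Measure.ofMeasurable (fun B _ => ENNReal.ofReal (⟪ψ, F B ψ⟫_ℂ).re)
    (by simp [F.empty])
    (fun B hB hd => by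
      have h := F.hasSum B hB hd ψ
      have h2 := (Complex.hasSum_re (h.mapL (innerSL ℂ ψ)))
      simp only [innerSL_apply_apply] at h2
      rw [← h2.tsum_eq]
      exact ENNReal.ofReal_tsum_of_nonneg (fun n => (F.inner_eq (hB n) ψ).1) h2.summable)

theorem POVM.measure_apply (F : POVM X H) (ψ : H) {B : Set X} (hB : MeasurableSet B) :
    F.measure ψ B = ENNReal.ofReal (⟪ψ, F B ψ⟫_ℂ).re :=
  Measure.ofMeasurable_apply B hB

instance (F : POVM X H) (ψ : H) : IsFiniteMeasure (F.measure ψ) :=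
  ⟨by rw [F.measure_apply ψ MeasurableSet.univ]; exact ENNReal.ofReal_lt_top⟩

theorem POVM.measure_real (F : POVM X H) (ψ : H) {B : Set X} (hB : MeasurableSet B) :
    (((F.measure ψ).real B : ℝ) : ℂ) = ⟪ψ, F B ψ⟫_ℂ := by
  rw [Measure.real, F.measure_apply ψ hB, ENNReal.toReal_ofReal (F.inner_eq hB ψ).1,
    ← (F.inner_eq hB ψ).2]

/-- A sequence of operators whose quadratic forms converge has a weak limit. -/
theorem exists_weak_limit (T : ℕ → H →L[ℂ] H) (q : H → ℂ)
    (h : ∀ ψ, Tendsto (fun n => ⟪ψ, T n ψ⟫_ℂ) atTop (𝓝 (q ψ))) :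
    ∃ S : H →L[ℂ] H, ∀ ψ, ⟪ψ, S ψ⟫_ℂ = q ψ := by
  have hc : ∀ φ ψ, ∃ z, Tendsto (fun n => ⟪φ, T n ψ⟫_ℂ) atTop (𝓝 z) := by
    intro φ ψ
    have e : ∀ n, ⟪φ, T n ψ⟫_ℂ = (⟪φ + ψ, T n (φ + ψ)⟫_ℂ - ⟪φ - ψ, T n (φ - ψ)⟫_ℂ
        - Complex.I * ⟪φ + Complex.I • ψ, T n (φ + Complex.I • ψ)⟫_ℂ
        + Complex.I * ⟪φ - Complex.I • ψ, T n (φ - Complex.I • ψ)⟫_ℂ) / 4 := by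
      intro n
      simp only [map_add, map_sub, inner_add_left, inner_add_right, map_smul, inner_smul_left,
        inner_smul_right, Complex.conj_I, inner_sub_left, inner_sub_right]
      ring_nf
      simp only [Complex.I_sq]
      ring
    simp only [e]
    exact ⟨_, ((((h _).sub (h _)).sub ((h _).const_mul _)).add ((h _).const_mul _)).div_const _⟩
  choose L hL using hc
  obtain ⟨K, hK⟩ : ∃ K, ∀ n, ‖T n‖ ≤ K := by
    refine banach_steinhaus fun ψ => ?_
    obtain ⟨C, hC⟩ := banach_steinhaus (g := fun n => innerSL ℂ (T n ψ)) (fun φ => by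
      obtain ⟨C, hC⟩ := ((hL φ ψ).norm).bddAbove_range
      refine ⟨C, fun n => ?_⟩
      rw [innerSL_apply_apply, norm_inner_symm]
      exact hC ⟨n, rfl⟩)
    exact ⟨C, fun n => by simpa using hC n⟩
  have hB : ∀ φ ψ, ‖L φ ψ‖ ≤ K * ‖φ‖ * ‖ψ‖ := fun φ ψ => by
    refine le_of_tendsto (hL φ ψ).norm (Eventually.of_forall fun n => ?_)
    calc ‖⟪φ, T n ψ⟫_ℂ‖ ≤ ‖φ‖ * ‖T n ψ‖ := norm_inner_le_norm _ _
      _ ≤ ‖φ‖ * (K * ‖ψ‖) := by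
        gcongr; exact (T n).le_of_opNorm_le (hK n) ψ
      _ = _ := by ring
  let B : H →ₗ⋆[ℂ] H →ₗ[ℂ] ℂ := LinearMap.mk₂'ₛₗ (starRingEnd ℂ) (RingHom.id ℂ) L
    (fun a b c => tendsto_nhds_unique (hL _ _) (by
      simpa only [inner_add_left] using (hL a c).add (hL b c)))
    (fun r a b => tendsto_nhds_unique (hL _ _) (by
      simpa only [inner_smul_left, smul_eq_mul] using (hL a b).const_mul _))
    (fun a b c => tendsto_nhds_unique (hL _ _) (by
      simpa only [map_add, inner_add_right] using (hL a b).add (hL a c)))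
    (fun r a b => tendsto_nhds_unique (hL _ _) (by
      simpa only [map_smul, inner_smul_right, smul_eq_mul, RingHom.id_apply] using (hL a b).const_mul _))
  let S := InnerProductSpace.continuousLinearMapOfBilin (B.mkContinuous₂ K hB)
  refine ⟨ContinuousLinearMap.adjoint S, fun ψ => ?_⟩
  rw [ContinuousLinearMap.adjoint_inner_right,
    InnerProductSpace.continuousLinearMapOfBilin_apply]
  exact tendsto_nhds_unique (hL ψ ψ) (h ψ)

theorem POVM.exists_integral_simple (F : POVM X H) (g : SimpleFunc X ℂ) :
    ∃ T : H →L[ℂ] H, ∀ ψ, ⟪ψ, T ψ⟫_ℂ = ∫ x, g x ∂F.measure ψ := by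
  induction g using SimpleFunc.induction with
  | @const c s hs =>
    refine ⟨c • F s, fun ψ => ?_⟩
    classical
    have e : s.piecewise (Function.const X c) (Function.const X (0 : ℂ)) =
        s.indicator (Function.const X c) := Set.piecewise_eq_indicator
    rw [SimpleFunc.coe_piecewise, SimpleFunc.coe_const, SimpleFunc.coe_const, e,
      integral_indicator hs]
    simp only [Function.const_apply, integral_const, smul_apply,
      inner_smul_right, measureReal_restrict_apply_univ, Complex.real_smul]
    rw [F.measure_real ψ hs, mul_comm]
  | add hd hf hg =>
    obtain ⟨T, hT⟩ := hf
    obtain ⟨S, hS⟩ := hg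
    refine ⟨T + S, fun ψ => ?_⟩
    simp only [SimpleFunc.coe_add, Pi.add_apply]
    rw [add_apply, inner_add_right, hT, hS, ← integral_add]
    · exact SimpleFunc.integrable_of_isFiniteMeasure _
    · exact SimpleFunc.integrable_of_isFiniteMeasure _

theorem POVM.exists_integral (F : POVM X H) {g : X → ℂ} (hg : Measurable g) {C : ℝ}
    (hC : ∀ x, ‖g x‖ ≤ C) :
    ∃ T : H →L[ℂ] H, ∀ ψ, ⟪ψ, T ψ⟫_ℂ = ∫ x, g x ∂F.measure ψ := by
  have hs := hg.stronglyMeasurable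
  choose T hT using fun n => F.exists_integral_simple (hs.approxBounded C n)
  refine exists_weak_limit T _ fun ψ => ?_
  simp only [hT]
  refine tendsto_integral_of_dominated_convergence (fun _ => |C|)
    (fun n => (SimpleFunc.measurable _).aestronglyMeasurable) (integrable_const _)
    (fun n => Eventually.of_forall fun x => ?_) (Eventually.of_forall fun x => ?_)
  · by_cases h : 0 ≤ C
    · exact (hs.norm_approxBounded_le h n x).trans (le_abs_self C)
    · exact absurd ((norm_nonneg _).trans (hC x)) h
  · exact hs.tendsto_approxBounded_of_norm_le (hC x)

open Classical in
/-- The integral `F[g] = ∫ F(dx) g(x)` of a bounded measurable function: the operator with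
`⟪ψ, F[g] ψ⟫ = ∫ g(x) ⟪ψ, F(dx) ψ⟫` for all `ψ`. -/
def POVM.integral (F : POVM X H) (g : X → ℂ) : H →L[ℂ] H :=
  if h : ∃ T : H →L[ℂ] H, ∀ ψ, ⟪ψ, T ψ⟫_ℂ = ∫ x, g x ∂F.measure ψ then h.choose else 0

theorem POVM.inner_integral (F : POVM X H) {g : X → ℂ} (hg : Measurable g) {C : ℝ}
    (hC : ∀ x, ‖g x‖ ≤ C) (ψ : H) :
    ⟪ψ, F.integral g ψ⟫_ℂ = ∫ x, g x ∂F.measure ψ := by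
  have h := F.exists_integral hg hC
  rw [POVM.integral, dif_pos h]
  exact h.choose_spec ψ


/-- The gauge invariant quasi-free state `Γ_s(σ) / tr Γ_s(σ)`. -/
def quasiFree (s : ℤˣ) (σ : H →L[ℂ] H) : Fock H s →L[ℂ] Fock H s :=
  (trace (Gamma s σ))⁻¹ • Gamma s σ

/-- `σ̂ = σ / (1 - s σ)`. -/
def hatOp (s : ℤˣ) (σ : H →L[ℂ] H) : H →L[ℂ] H :=
  σ * Ring.inverse (1 - (((s : ℤ) : ℂ)) • σ)

/-- The effects of the one-particle measurement of `F`, with outcomes in `X` together with one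
extra outcome `Sum.inr ()` for a particle that is not registered, which has the effect `1 - F(X)`. -/
def POVM.effect (F : POVM X H) (B : Set (X ⊕ Unit)) : H →L[ℂ] H :=
  F (Sum.inl ⁻¹' B) + B.indicator (fun _ => 1 - F Set.univ) (Sum.inr ())

/-- `P` is the law of the record obtained by measuring `F` on every particle in the state `ρ`: with
`N` particles the record is a point of `(X ∪ {no click})^N`, and its law is given by
`F(dx₁) ⊗ ⋯ ⊗ F(dx_N)` on the `N`-particle space. -/
def IsRecordLaw {s : ℤˣ} (F : POVM X H) (ρ : Fock H s →L[ℂ] Fock H s)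
    (P : Measure (Σ N : ℕ, Fin N → X ⊕ Unit)) : Prop :=
  IsProbabilityMeasure P ∧
    ∀ (N : ℕ) (B : Fin N → Set (X ⊕ Unit)), (∀ k, MeasurableSet (B k)) →
      ((P.real (Sigma.mk N '' Set.univ.pi B) : ℝ) : ℂ) =
        trace (ρ ∘L fockTensorOp s fun k => F.effect (B k))

/-- The empirical measure `ξ = ∑ δ_{x_k}` of the clicks in a record. -/
def clickMeasure (r : Σ N : ℕ, Fin N → X ⊕ Unit) : Measure X :=
  ∑ k, Sum.elim (fun x => Measure.dirac x) (fun _ => 0) (r.2 k)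

/-- `Q` is the full counting statistics, in the state `ρ`, of the second quantization of `F`: the
point process (law of the empirical measure of the clicks) got by measuring `F` on every particle. -/
def IsCountingStatistics {s : ℤˣ} (F : POVM X H) (ρ : Fock H s →L[ℂ] Fock H s)
    (Q : Measure (Measure X)) : Prop :=
  ∃ P, IsRecordLaw F ρ P ∧ Q = P.map clickMeasure
end
end
end QuasiFree

namespace QuasiFree
open scoped TensorProduct InnerProductSpace ENNReal
open Filter Topology MeasureTheory
attribute [local instance 2000] InnerProductSpace.toInner
noncomputable section

/-! ### Immanants of the statistics and their traces -/

section Immanant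
open Finset

/-! Everything is computed in an orthonormal eigenbasis `e` of `σ` with eigenvalues `l`
(`exists_eigenbasis`). On the `N`-particle space, `σ^{⊗N}` is a sum over all index tuples of length
`N`: the product of the eigenvalues times the rank one operator of the (anti)symmetrized product of
basis vectors. These vectors are neither normalized nor independent, but the series over tuples of
all lengths converges in nuclear norm. So `Γ_s(σ)` is nuclear (`gamma_rep`), and traces of it
against bounded operators are sums over tuples.

Let `M` be a contraction. The tuples of length `N` with entries in a finite set `I` contribute to
`tr Γ_s(σ) Γ_s(M)` the number `symTrace s A N`, for the finite matrix `A = (l_a ⟪e_a, M e_b⟫)`. For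
Fermions these numbers are sums of principal minors and add up to `det (1 + A)`. For Bosons,
Newton's identities show that the symmetric and the signed antisymmetric generating series are
reciprocal, so the sum is `det (1 - A)⁻¹`. The factorization `1 - sσM = (1 - sσ)(1 - s σ̂ (M - 1))`
then separates the normalization (`M = 1`) from the wanted determinant.

Two limits remain as `I` exhausts the basis. The traces are dominated by the case `M = 1`, whose
convergence is `IsEigenbasis.summable_weight`. The determinants are expanded in principal minors,
dominated by means of `norm_det_le_of_orthonormal`. The Fredholm determinant is defined in a
different basis; `det (1 + UV) = det (1 + VU)` carries it over to `e` (`det_section_eq`).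

For the point process, the matrix elements of an observable in finitely many vectors have a joint
density that is pointwise a Gram matrix (`POVM.exists_density`). Hence, on a finite combination of
product vectors, `F⁺ ⊗ ⋯ ⊗ F⁺` has a density which is a squared norm, and so is a genuine measure
(`POVM.exists_tensor_measure`), without any topology on the outcome space. The record law is the
mixture of these measures over tuples, and it is determined by its values on boxes
(`measure_eq_of_boxes`). Since `e^{iξ[f]}` is a product over the particles, with factor `1` for no
click, its mean is the trace against `Γ_s(M)` with `M = F[e^{if}] + 1 - F(X)`. The Gram densities
also give `‖M‖ ≤ 1`. -/

/-- The value of `statSign` as a complex number. -/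
def statC (s : ℤˣ) {N : ℕ} (π : Equiv.Perm (Fin N)) : ℂ := ((statSign s π : ℤˣ) : ℤ)

theorem statSign_mul (s : ℤˣ) {N : ℕ} (π ρ : Equiv.Perm (Fin N)) :
    statSign s (π * ρ) = statSign s π * statSign s ρ := by
  unfold statSign; split_ifs <;> simp

theorem statC_mul (s : ℤˣ) {N : ℕ} (π ρ : Equiv.Perm (Fin N)) :
    statC s (π * ρ) = statC s π * statC s ρ := by
  simp [statC, statSign_mul]

theorem statC_mul_self (s : ℤˣ) {N : ℕ} (π : Equiv.Perm (Fin N)) :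
    statC s π * statC s π = 1 := by
  unfold statC
  rcases Int.units_eq_one_or (statSign s π) with h | h <;> simp [h]

theorem statC_inv (s : ℤˣ) {N : ℕ} (π : Equiv.Perm (Fin N)) : statC s π⁻¹ = statC s π := by
  simp [statC, statSign]

theorem conj_statC (s : ℤˣ) {N : ℕ} (π : Equiv.Perm (Fin N)) :
    (starRingEnd ℂ) (statC s π) = statC s π := by
  simp [statC]

/-- `decomposeFin` factors a permutation into the swap of `0` with `p` and a permutation fixing `0`;
a genuine transposition has character `s` in both statistics. -/
theorem statSign_decomposeFin (s : ℤˣ) {N : ℕ} (p : Fin (N + 1)) (e : Equiv.Perm (Fin N)) :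
    statSign s (Equiv.Perm.decomposeFin.symm (p, e)) = (if p = 0 then 1 else s) * statSign s e := by
  rcases Int.units_eq_one_or s with rfl | rfl
  · simp [statSign]
  · have : ((-1 : ℤˣ) = 1) = False := by simp
    simp [statSign]

/-- The permanent (`s = 1`) or determinant (`s = -1`) of a square matrix. -/
def imm (s : ℤˣ) {N : ℕ} (A : Matrix (Fin N) (Fin N) ℂ) : ℂ :=
  ∑ π : Equiv.Perm (Fin N), statC s π * ∏ k, A k (π k)

theorem imm_neg_one {N : ℕ} (A : Matrix (Fin N) (Fin N) ℂ) : imm (-1) A = A.det := by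
  rw [← Matrix.det_transpose, Matrix.det_apply', imm]
  have : ((-1 : ℤˣ) = 1) = False := by simp
  simp [statC, statSign, Matrix.transpose_apply]

variable {n : Type*} [Fintype n]

/-- `∑ imm s (A i_k i_l)` over all index tuples `i` of length `N`. -/
def immTrace (s : ℤˣ) (A : Matrix n n ℂ) (N : ℕ) : ℂ :=
  ∑ i : Fin N → n, imm s (A.submatrix i i)

/-- The partial trace over all but the first slot of the immanants of length `N + 1`. -/
def immPartial (s : ℤˣ) (A : Matrix n n ℂ) (N : ℕ) : Matrix n n ℂ := Matrix.of fun a b =>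
  ∑ i : Fin N → n, imm s (A.submatrix (Fin.cons a i : Fin (N + 1) → n) (Fin.cons b i))

theorem immTrace_zero (s : ℤˣ) (A : Matrix n n ℂ) : immTrace s A 0 = 1 := by
  simp [immTrace, imm, statC, statSign]

theorem immTrace_succ (s : ℤˣ) (A : Matrix n n ℂ) (N : ℕ) :
    immTrace s A (N + 1) = (immPartial s A N).trace := by
  simp only [Matrix.trace, Matrix.diag, immPartial, Matrix.of_apply, immTrace]
  rw [← (Fin.consEquiv (fun _ : Fin (N + 1) => n)).sum_comp, Fintype.sum_prod_type]
  rfl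

/-- It does not matter which slot carries the free column index: the swap of `0` and `j` moves it to
slot `0`, and `statC` is invariant under conjugation. -/
theorem sum_imm_update (s : ℤˣ) (A : Matrix n n ℂ) (N : ℕ) (a b : n) (j : Fin (N + 1)) :
    ∑ i : Fin (N + 1) → n, A a (i j) * imm s (A.submatrix i (Function.update i j b)) =
      (A * immPartial s A N) a b := by
  have h0 : ∀ i : Fin (N + 1) → n,
      A a ((i ∘ Equiv.swap 0 j) j) * imm s (A.submatrix (i ∘ Equiv.swap 0 j)
        (Function.update (i ∘ Equiv.swap 0 j) j b)) =
      A a (i 0) * imm s (A.submatrix i (Function.update i 0 b)) := by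
    intro i
    have e1 : Function.update (i ∘ Equiv.swap 0 j) j b =
        Function.update i 0 b ∘ Equiv.swap 0 j := by
      ext k
      by_cases hk : k = j
      · subst hk; simp
      · have : Equiv.swap 0 j k ≠ 0 := by
          intro h
          apply hk
          exact (Equiv.swap 0 j).injective (h.trans (Equiv.swap_apply_right 0 j).symm)
        simp [Function.update_of_ne hk, Function.update_of_ne this]
    rw [e1]
    congr 1
    · simp
    · unfold imm
      refine Fintype.sum_equiv (MulAut.conj (Equiv.swap 0 j)).toEquiv _ _ fun π => ?_
      have : statC s (Equiv.swap 0 j * π * (Equiv.swap 0 j)⁻¹) = statC s π := by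
        rw [statC_mul, statC_mul, statC_inv, mul_right_comm, statC_mul_self, one_mul]
      simp only [MulEquiv.toEquiv_eq_coe, EquivLike.coe_coe, MulAut.conj_apply]
      rw [this, ← Equiv.prod_comp (Equiv.swap 0 j)]
      simp [Matrix.submatrix_apply]
  rw [← Equiv.sum_comp ((Equiv.swap 0 j).arrowCongr (Equiv.refl n))]
  have h1 : ∀ i : Fin (N + 1) → n, ((Equiv.swap 0 j).arrowCongr (Equiv.refl n)) i =
      i ∘ Equiv.swap 0 j := by
    intro i; ext k; simp [Equiv.arrowCongr]
  simp only [h1, h0]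
  rw [← (Fin.consEquiv (fun _ : Fin (N + 1) => n)).sum_comp, Fintype.sum_prod_type,
    Matrix.mul_apply]
  refine Finset.sum_congr rfl fun c _ => ?_
  simp only [immPartial, Matrix.of_apply, Finset.mul_sum]
  refine Finset.sum_congr rfl fun i _ => ?_
  simp [Fin.consEquiv]

/-- Expansion along the image of the distinguished slot. If it is fixed, the factor `A a b` splits
off. If it goes to slot `j`, it contributes `A a (i j)`, the column index of slot `j` becomes `b`,
and the swap costs a sign `s`. -/
theorem immPartial_apply (s : ℤˣ) (A : Matrix n n ℂ) (N : ℕ) (a b : n) :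
    immPartial s A N a b = immTrace s A N * A a b +
      ((s : ℤ) : ℂ) * ∑ j : Fin N, ∑ i : Fin N → n,
        A a (i j) * imm s (A.submatrix i (Function.update i j b)) := by
  have h : ∀ i : Fin N → n,
      imm s (A.submatrix (Fin.cons a i : Fin (N + 1) → n) (Fin.cons b i)) =
      imm s (A.submatrix i i) * A a b +
      ((s : ℤ) : ℂ) * ∑ j : Fin N, A a (i j) * imm s (A.submatrix i (Function.update i j b)) := by
    intro i
    conv_lhs => unfold imm
    rw [← Equiv.Perm.decomposeFin.symm.sum_comp, Fintype.sum_prod_type, Fin.sum_univ_succ]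
    congr 1
    · rw [imm, Finset.sum_mul]
      refine Finset.sum_congr rfl fun e _ => ?_
      simp only [statC, statSign_decomposeFin, Fin.prod_univ_succ]
      simp only [Matrix.submatrix_apply, Equiv.Perm.decomposeFin_symm_apply_zero,
        Equiv.Perm.decomposeFin_symm_apply_succ, Equiv.swap_self, Equiv.refl_apply, Fin.cons_zero,
        Fin.cons_succ, if_true, one_mul]
      ring
    · rw [Finset.mul_sum]
      refine Finset.sum_congr rfl fun j _ => ?_
      rw [imm, Finset.mul_sum, Finset.mul_sum]
      refine Finset.sum_congr rfl fun e _ => ?_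
      simp only [statC, statSign_decomposeFin, Fin.prod_univ_succ]
      simp only [Matrix.submatrix_apply, Equiv.Perm.decomposeFin_symm_apply_zero,
        Equiv.Perm.decomposeFin_symm_apply_succ, Fin.cons_zero,
        Fin.cons_succ, Fin.succ_ne_zero, if_false]
      have hk : ∀ k : Fin N, (Fin.cons b i : Fin (N + 1) → n)
          (Equiv.swap 0 j.succ (e k).succ) = Function.update i j b (e k) := by
        intro k
        by_cases hk : e k = j
        · rw [hk]; simp
        · rw [Equiv.swap_apply_of_ne_of_ne (Fin.succ_ne_zero _)
            (fun h => hk (Fin.succ_injective _ h)), Fin.cons_succ, Function.update_of_ne hk]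
      simp only [hk]
      push_cast
      ring
  simp only [immPartial, Matrix.of_apply, h, Finset.sum_add_distrib, ← Finset.sum_mul,
    ← Finset.mul_sum, immTrace]
  rw [Finset.sum_comm]

theorem immPartial_zero (s : ℤˣ) (A : Matrix n n ℂ) : immPartial s A 0 = A := by
  ext a b
  simp [immPartial_apply, immTrace_zero]

/-- After summation over tuples the `N + 1` choices of `j` all contribute the same matrix, so the
expansion becomes a recursion in `N`. -/
theorem immPartial_succ (s : ℤˣ) (A : Matrix n n ℂ) (N : ℕ) :
    immPartial s A (N + 1) = immTrace s A (N + 1) • A +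
      (((s : ℤ) : ℂ) * (N + 1)) • (A * immPartial s A N) := by
  ext a b
  simp only [immPartial_apply s A (N + 1) a b, sum_imm_update, Matrix.add_apply, Matrix.smul_apply,
    smul_eq_mul, Finset.sum_const, Finset.card_univ, Fintype.card_fin, nsmul_eq_mul]
  push_cast
  ring

variable [DecidableEq n]

/-- `immTrace` divided by `N!`: the trace of `A^{⊗N}` on the symmetric or antisymmetric tensors. -/
def symTrace {n : Type*} [Fintype n] (s : ℤˣ) (A : Matrix n n ℂ) (N : ℕ) : ℂ := immTrace s A N / N.factorial

theorem symTrace_zero {n : Type*} [Fintype n] (s : ℤˣ) (A : Matrix n n ℂ) : symTrace s A 0 = 1 := by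
  simp [symTrace, immTrace_zero]

theorem immPartial_eq_sum (s : ℤˣ) (A : Matrix n n ℂ) (N : ℕ) :
    immPartial s A N = (N.factorial : ℂ) • ∑ k ∈ range (N + 1),
      (symTrace s A (N - k) * ((s : ℤ) : ℂ) ^ k) • A ^ (k + 1) := by
  induction N with
  | zero => simp [immPartial_zero, symTrace_zero]
  | succ N ih =>
    rw [immPartial_succ, ih, Finset.sum_range_succ' _ (N + 1), smul_add, add_comm]
    have hf : ((N + 1).factorial : ℂ) ≠ 0 := by exact_mod_cast Nat.factorial_ne_zero _
    congr 1
    · rw [Matrix.mul_smul, Finset.mul_sum, smul_smul, Finset.smul_sum, Finset.smul_sum]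
      refine Finset.sum_congr rfl fun k _ => ?_
      rw [Matrix.mul_smul, smul_smul, smul_smul, ← pow_succ', Nat.add_sub_add_right,
        Nat.factorial_succ]
      push_cast
      congr 1
      ring
    · simp only [symTrace, Nat.sub_zero, pow_zero, mul_one, zero_add, pow_one, smul_smul]
      rw [mul_div_cancel₀ _ hf]

/-- Newton's identities. -/
theorem symTrace_newton (s : ℤˣ) (A : Matrix n n ℂ) (N : ℕ) :
    (N + 1 : ℂ) * symTrace s A (N + 1) = ∑ k ∈ range (N + 1),
      symTrace s A (N - k) * (((s : ℤ) : ℂ) ^ k * (A ^ (k + 1)).trace) := by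
  have hf : (N.factorial : ℂ) ≠ 0 := by exact_mod_cast Nat.factorial_ne_zero _
  have hN : (N + 1 : ℂ) ≠ 0 := by exact_mod_cast Nat.succ_ne_zero N
  -- Tracing the one remaining slot turns the powers of `A` in the solved recursion into power sums.
  rw [symTrace, immTrace_succ, immPartial_eq_sum, Matrix.trace_smul, Matrix.trace_sum,
    Nat.factorial_succ]
  simp only [Matrix.trace_smul, smul_eq_mul]
  push_cast
  field_simp

/-- The generating functions of complete homogeneous and elementary symmetric polynomials are
reciprocal. -/
theorem sum_symTrace_mul_symTrace (A : Matrix n n ℂ) (N : ℕ) :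
    ∑ p ∈ antidiagonal N, symTrace 1 A p.1 * ((-1) ^ p.2 * symTrace (-1) A p.2) =
      if N = 0 then 1 else 0 := by
  -- With `q` the generating function of the power sums, Newton's identities say `h' = h q` and `e'
  -- = -e q`. Hence `(h e)' = 0`, and `h e` equals its constant term `1`.
  open PowerSeries in
  set h : PowerSeries ℂ := PowerSeries.mk fun N => symTrace 1 A N
  set e : PowerSeries ℂ := PowerSeries.mk fun N => (-1) ^ N * symTrace (-1) A N
  set q : PowerSeries ℂ := PowerSeries.mk fun k => (A ^ (k + 1)).trace
  have hh : PowerSeries.derivative ℂ h = h * q := by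
    ext N
    rw [PowerSeries.coeff_derivative, PowerSeries.coeff_mul,
      Finset.Nat.sum_antidiagonal_eq_sum_range_succ_mk]
    simp only [h, q, PowerSeries.coeff_mk]
    rw [mul_comm, symTrace_newton, ← Finset.sum_range_reflect]
    refine Finset.sum_congr rfl fun k hk => ?_
    have := Finset.mem_range.1 hk
    rw [show N - (N + 1 - 1 - k) = k by omega, show N + 1 - 1 - k = N - k by omega]
    simp
  have he : PowerSeries.derivative ℂ e = - (e * q) := by
    ext N
    rw [PowerSeries.coeff_derivative, map_neg, PowerSeries.coeff_mul,
      Finset.Nat.sum_antidiagonal_eq_sum_range_succ_mk]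
    simp only [e, q, PowerSeries.coeff_mk]
    rw [mul_assoc, mul_comm (symTrace _ _ _), symTrace_newton, ← Finset.sum_range_reflect,
      Finset.mul_sum, ← Finset.sum_neg_distrib]
    refine Finset.sum_congr rfl fun k hk => ?_
    have := Finset.mem_range.1 hk
    rw [show N - (N + 1 - 1 - k) = k by omega, show N + 1 - 1 - k = N - k by omega]
    have e1 : (-1 : ℂ) ^ (N + 1) * (-1) ^ (N - k) = - (-1) ^ k := by
      rw [← pow_add, show N + 1 + (N - k) = 2 * (N - k) + (k + 1) by omega, pow_add, pow_mul]
      simp [pow_succ]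
    simp only [Units.val_neg, Units.val_one, Int.cast_neg, Int.cast_one]
    calc _ = ((-1 : ℂ) ^ (N + 1) * (-1) ^ (N - k)) * (symTrace (-1) A k * (A ^ (N - k + 1)).trace) := by ring
      _ = _ := by rw [e1]; ring
  have hd : PowerSeries.derivative ℂ (h * e) = 0 := by
    rw [Derivation.leibniz, hh, he]
    simp only [smul_eq_mul]
    ring
  have hc : PowerSeries.coeff N (h * e) = if N = 0 then 1 else 0 := by
    cases N with
    | zero => simp [h, e, PowerSeries.coeff_mul, symTrace_zero]
    | succ N =>
      have := congrArg (PowerSeries.coeff N) hd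
      rw [PowerSeries.coeff_derivative, map_zero] at this
      have hN : (N + 1 : ℂ) ≠ 0 := by exact_mod_cast Nat.succ_ne_zero N
      simpa [hN] using this
  rw [← hc, PowerSeries.coeff_mul]
  simp [h, e]

/-- A tuple with a repeated index gives two equal rows. Each `N`-element set `T` is the image of
`N!` injective tuples, all giving the minor on `T` after relabelling. -/
theorem sum_det_submatrix (A : Matrix n n ℂ) (N : ℕ) :
    symTrace (-1) A N = ∑ T ∈ powersetCard N (univ : Finset n),
      (A.submatrix (fun x : T => (x : n)) (fun x : T => (x : n))).det := by
  have hf : (N.factorial : ℂ) ≠ 0 := by exact_mod_cast Nat.factorial_ne_zero _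
  rw [symTrace, div_eq_iff hf, immTrace]
  simp only [imm_neg_one]
  have h1 : ∑ i : Fin N → n, (A.submatrix i i).det =
      ∑ i ∈ (univ : Finset (Fin N → n)).filter Function.Injective, (A.submatrix i i).det := by
    symm
    refine Finset.sum_subset (Finset.filter_subset _ _) fun i _ hi => ?_
    rw [Finset.mem_filter] at hi
    have : ¬ Function.Injective i := fun h => hi ⟨Finset.mem_univ _, h⟩
    rw [Function.Injective] at this
    push Not at this
    obtain ⟨a, b, hab, hne⟩ := this
    exact Matrix.det_zero_of_row_eq hne (by ext k; simp [hab])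
  rw [h1, ← Finset.sum_fiberwise_of_maps_to (t := powersetCard N (univ : Finset n))
    (g := fun i => Finset.univ.image i), Finset.sum_mul]
  · refine Finset.sum_congr rfl fun T hT => ?_
    rw [Finset.mem_powersetCard] at hT
    have hval : ∀ i ∈ ((univ : Finset (Fin N → n)).filter Function.Injective).filter
        (fun i => Finset.univ.image i = T), (A.submatrix i i).det =
        (A.submatrix (fun x : T => (x : n)) (fun x : T => (x : n))).det := by
      intro i hi
      rw [Finset.mem_filter, Finset.mem_filter] at hi
      obtain ⟨⟨-, hinj⟩, him⟩ := hi
      have hmem : ∀ k, i k ∈ T := fun k => by rw [← him]; exact Finset.mem_image_of_mem _ (Finset.mem_univ _)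
      let g : Fin N → T := fun k => ⟨i k, hmem k⟩
      have hg : Function.Bijective g := by
        rw [Fintype.bijective_iff_injective_and_card]
        refine ⟨fun a b h => hinj (congrArg Subtype.val h), by simp [hT.2]⟩
      have := Matrix.det_submatrix_equiv_self (Equiv.ofBijective g hg)
        (A.submatrix (fun x : T => (x : n)) (fun x : T => (x : n)))
      rw [← this]
      rfl
    rw [Finset.sum_congr rfl hval, Finset.sum_const, nsmul_eq_mul, mul_comm]
    congr 1
    norm_cast
    have hc : Fintype.card (Fin N ≃ T) = N.factorial := by
      have e : Fin N ≃ T := Fintype.equivOfCardEq (by simp [hT.2])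
      rw [Fintype.card_equiv e, Fintype.card_fin]
    rw [← hc]
    symm
    refine Finset.card_bij (fun (g : Fin N ≃ T) _ => fun k => (g k : n)) ?_ ?_ ?_
    · intro g _
      rw [Finset.mem_filter, Finset.mem_filter]
      refine ⟨⟨Finset.mem_univ _, fun a b h => g.injective (Subtype.ext h)⟩, ?_⟩
      ext x
      simp only [Finset.mem_image, Finset.mem_univ, true_and]
      exact ⟨fun ⟨k, hk⟩ => hk ▸ (g k).2, fun hx => ⟨g.symm ⟨x, hx⟩, by simp⟩⟩
    · intro g _ g' _ h
      ext k
      exact congrFun h k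
    · intro i hi
      rw [Finset.mem_filter, Finset.mem_filter] at hi
      obtain ⟨⟨-, hinj⟩, him⟩ := hi
      have hmem : ∀ k, i k ∈ T := fun k => by rw [← him]; exact Finset.mem_image_of_mem _ (Finset.mem_univ _)
      let g : Fin N → T := fun k => ⟨i k, hmem k⟩
      have hg : Function.Bijective g := by
        rw [Fintype.bijective_iff_injective_and_card]
        refine ⟨fun a b h => hinj (congrArg Subtype.val h), by simp [hT.2]⟩
      exact ⟨Equiv.ofBijective g hg, Finset.mem_univ _, rfl⟩
  · intro i hi
    rw [Finset.mem_filter] at hi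
    rw [Finset.mem_powersetCard]
    exact ⟨Finset.subset_univ _, by rw [Finset.card_image_of_injective _ hi.2]; simp⟩

/-- The expansion of `det (1 + A)` in principal minors. -/
theorem det_one_add_eq_sum_minors (A : Matrix n n ℂ) :
    (1 + A).det = ∑ T : Finset n,
      (A.submatrix (fun x : T => (x : n)) (fun x : T => (x : n))).det := by
  have h := fun k => Matrix.coeff_det_one_add_X_smul_eq_sum_minors A k
  set p : Polynomial ℂ := (1 + (Polynomial.X : Polynomial ℂ) • A.map Polynomial.C).det with hp
  have hd : p.natDegree < Fintype.card n + 1 := by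
    have := Polynomial.natDegree_det_X_add_C_le A 1
    rw [Matrix.map_one _ (map_zero _) (map_one _), add_comm] at this
    exact Nat.lt_succ_of_le this
  have he : p.eval 1 = (1 + A).det := by
    rw [hp, ← Polynomial.coe_evalRingHom, RingHom.map_det]
    congr 1
    ext a b
    by_cases hab : a = b <;> simp [hab]
  rw [← he, Polynomial.eval_eq_sum_range' hd]
  simp only [one_pow, mul_one, h]
  rw [← Finset.powerset_univ, Finset.sum_powerset, Finset.card_univ]

end Immanant
end
end QuasiFree

namespace QuasiFree
open scoped TensorProduct InnerProductSpace ENNReal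
open Filter Topology MeasureTheory
attribute [local instance 2000] InnerProductSpace.toInner
noncomputable section

/-! ### ### Growth of `symTrace` and summation over the particle number -/

section Bounds
open Finset

/-- The solution of `(N + 1) b (N + 1) = ∑ j ≤ N, b j * p * r ^ (N - j)`, `b 0 = 1`. -/
def newtonBound (p r : ℝ) (N : ℕ) : ℝ := ∏ k ∈ range N, (p + r * k) / (k + 1)

theorem newtonBound_nonneg {p r : ℝ} (hp : 0 ≤ p) (hr : 0 ≤ r) (N : ℕ) : 0 ≤ newtonBound p r N :=
  Finset.prod_nonneg fun k _ => by positivity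

theorem newtonBound_succ (p r : ℝ) (N : ℕ) :
    (N + 1) * newtonBound p r (N + 1) = (p + r * N) * newtonBound p r N := by
  have : (N + 1 : ℝ) ≠ 0 := by positivity
  rw [newtonBound, Finset.prod_range_succ, ← newtonBound]
  field_simp

theorem summable_newtonBound {p r : ℝ} (hp : 0 ≤ p) (hr : 0 ≤ r) (hr1 : r < 1) :
    Summable (newtonBound p r) := by
  -- The ratio test is run with a `q` strictly between `r` and `1`; from `K` on, `p + r N ≤ q (N +
  -- 1)`.
  obtain ⟨q, hq, hq1⟩ := exists_between hr1
  obtain ⟨K, hK⟩ := exists_nat_ge ((p - q) / (q - r))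
  refine summable_of_ratio_norm_eventually_le (r := q) hq1 ?_
  filter_upwards [eventually_ge_atTop K] with N hN
  have h0 := newtonBound_nonneg hp hr N
  have h1 := newtonBound_nonneg hp hr (N + 1)
  rw [Real.norm_of_nonneg h0, Real.norm_of_nonneg h1]
  have hN' : (p - q) / (q - r) ≤ N := hK.trans (by exact_mod_cast hN)
  rw [div_le_iff₀ (by linarith)] at hN'
  have h2 := newtonBound_succ p r N
  have h3 : (N + 1) * newtonBound p r (N + 1) ≤ (N + 1) * (q * newtonBound p r N) := by
    rw [h2]
    have : p + r * N ≤ (N + 1) * q := by nlinarith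
    calc _ ≤ ((N + 1) * q) * newtonBound p r N := by gcongr
      _ = _ := by ring
  exact le_of_mul_le_mul_left h3 (by positivity)

/-- Comparison for Newton's identities when the power sums are at most `p r ^ k`: `newtonBound` is
the case of equality. -/
theorem le_newtonBound {p r : ℝ} (hp : 0 ≤ p) (hr : 0 ≤ r) (a : ℕ → ℝ) (h0 : a 0 ≤ 1)
    (ha : ∀ N : ℕ, (N + 1) * a (N + 1) ≤ ∑ k ∈ range (N + 1), a (N - k) * (p * r ^ k)) (N : ℕ) :
    a N ≤ newtonBound p r N := by
  -- The convolution is carried through the induction as well: passing to `N + 1` multiplies it by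
  -- `r` and adds the term `k = 0`.
  have key : ∀ N : ℕ, a N ≤ newtonBound p r N ∧
      ∑ k ∈ range (N + 1), a (N - k) * (p * r ^ k) ≤ (N + 1) * newtonBound p r (N + 1) := by
    intro N
    induction N with
    | zero =>
      refine ⟨by simpa [newtonBound] using h0, ?_⟩
      simp [newtonBound]
      nlinarith
    | succ N ih =>
      have h1 : a (N + 1) ≤ newtonBound p r (N + 1) := by
        have := (ha N).trans ih.2
        exact le_of_mul_le_mul_left this (by positivity)
      refine ⟨h1, ?_⟩
      have e : ∑ k ∈ range (N + 1), a (N + 1 - (k + 1)) * (p * r ^ (k + 1)) =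
          r * ∑ k ∈ range (N + 1), a (N - k) * (p * r ^ k) := by
        rw [Finset.mul_sum]
        refine Finset.sum_congr rfl fun k _ => ?_
        rw [Nat.add_sub_add_right]; ring
      have h2 := newtonBound_succ p r (N + 1)
      push_cast at h2 ⊢
      rw [Finset.sum_range_succ', e, h2]
      calc _ ≤ r * ((N + 1) * newtonBound p r (N + 1)) + newtonBound p r (N + 1) * (p * r ^ 0) := by
            gcongr
            · exact ih.2
            · simpa using h1
        _ = _ := by ring
  exact (key N).1

variable {n : Type*} [Fintype n] [DecidableEq n]

theorem norm_symTrace_le {p r : ℝ} (hp : 0 ≤ p) (hr : 0 ≤ r) (s : ℤˣ) (A : Matrix n n ℂ)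
    (hA : ∀ k, ‖(A ^ (k + 1)).trace‖ ≤ p * r ^ k) (N : ℕ) :
    ‖symTrace s A N‖ ≤ newtonBound p r N := by
  refine le_newtonBound hp hr (fun N => ‖symTrace s A N‖) (by simp [symTrace_zero]) (fun N => ?_) N
  have h := congrArg norm (symTrace_newton s A N)
  have e : ‖(N + 1 : ℂ)‖ = N + 1 := by
    rw [← Nat.cast_add_one, Complex.norm_natCast]; push_cast; rfl
  rw [norm_mul, e] at h
  rw [h]
  refine (norm_sum_le _ _).trans (Finset.sum_le_sum fun k _ => ?_)
  rw [norm_mul, norm_mul, norm_pow]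
  have e2 : ‖((s : ℤ) : ℂ)‖ = 1 := by
    rcases Int.units_eq_one_or s with rfl | rfl <;> simp
  rw [e2, one_pow, one_mul]
  gcongr
  exact hA k

/-- Sorting the principal minors of `A` by size; beyond the dimension there are none, so the series
is finite. -/
theorem hasSum_symTrace_neg_one (A : Matrix n n ℂ) :
    HasSum (fun N => symTrace (-1) A N) (1 + A).det := by
  rw [det_one_add_eq_sum_minors, ← Finset.powerset_univ, Finset.sum_powerset]
  simp only [← sum_det_submatrix]
  refine hasSum_sum_of_ne_finset_zero fun N hN => ?_
  rw [sum_det_submatrix, Finset.powersetCard_eq_empty.2, Finset.sum_empty]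
  simpa [Nat.lt_succ_iff] using hN

theorem symTrace_neg {n : Type*} [Fintype n] (s : ℤˣ) (A : Matrix n n ℂ) (N : ℕ) :
    symTrace s (-A) N = (-1) ^ N * symTrace s A N := by
  have h : ∀ i : Fin N → n, imm s ((-A).submatrix i i) = (-1) ^ N * imm s (A.submatrix i i) := by
    intro i
    rw [imm, imm, Finset.mul_sum]
    refine Finset.sum_congr rfl fun π _ => ?_
    simp only [Matrix.submatrix_apply, Matrix.neg_apply, Finset.prod_neg, Finset.card_univ,
      Fintype.card_fin]
    ring
  simp only [symTrace, immTrace, h, ← Finset.mul_sum]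
  ring

/-- The Cauchy product with the finite series of `det (1 - A)`, in which all coefficients of
positive order cancel. -/
theorem tsum_symTrace_one_mul_det (A : Matrix n n ℂ) (hA : Summable fun N => ‖symTrace 1 A N‖) :
    (∑' N, symTrace 1 A N) * (1 - A).det = 1 := by
  have h := hasSum_symTrace_neg_one (-A)
  simp only [symTrace_neg, ← sub_eq_add_neg] at h
  have hs : Summable fun N => ‖(-1) ^ N * symTrace (-1) A N‖ := h.summable.norm
  rw [← h.tsum_eq, tsum_mul_tsum_eq_tsum_sum_antidiagonal_of_summable_norm hA hs]
  simp only [sum_symTrace_mul_symTrace]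
  simp

/-- Only upper bounds for the trace and for the eigenvalues enter, so the estimate is uniform over
the finite sections of `σ`. -/
theorem symTrace_diagonal_one_bound {p r : ℝ} (l : n → ℝ) (hl : ∀ i, 0 ≤ l i) (hlr : ∀ i, l i ≤ r)
    (hr : 0 ≤ r) (hp : ∑ i, l i ≤ p) (s : ℤˣ) (N : ℕ) :
    ‖symTrace s (Matrix.diagonal fun i => (l i : ℂ)) N‖ ≤ newtonBound p r N := by
  have hp0 : 0 ≤ p := (Finset.sum_nonneg fun i _ => hl i).trans hp
  refine norm_symTrace_le hp0 hr s _ (fun k => ?_) N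
  rw [Matrix.diagonal_pow, Matrix.trace_diagonal]
  refine (norm_sum_le _ _).trans ?_
  calc ∑ i, ‖((fun i => (l i : ℂ)) ^ (k + 1)) i‖ ≤ ∑ i, l i * r ^ k := by
        refine Finset.sum_le_sum fun i _ => ?_
        rw [Pi.pow_apply, norm_pow, Complex.norm_real, Real.norm_of_nonneg (hl i), pow_succ']
        exact mul_le_mul_of_nonneg_left (pow_le_pow_left₀ (hl i) (hlr i) k) (hl i)
    _ ≤ p * r ^ k := by rw [← Finset.sum_mul]; gcongr

end Bounds

/-! ### Determinants of compressions of operators -/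

section Det
variable {E : Type*} [NormedAddCommGroup E] [InnerProductSpace ℂ E]

/-- An eigenvector `v` of the compression gives `x = ∑ v_j e_j` with `⟪x, K x⟫ = μ ‖x‖²`, so every
eigenvalue has modulus at most `‖K‖`, and the determinant is their product. This geometric bound
dominates the expansions in minors. -/
theorem norm_det_le_of_orthonormal {m : Type*} [Fintype m] [DecidableEq m] {e : m → E}
    (he : Orthonormal ℂ e) (K : E →L[ℂ] E) :
    ‖(Matrix.of fun i j => ⟪e i, K (e j)⟫_ℂ).det‖ ≤ ‖K‖ ^ Fintype.card m := by
  set A : Matrix m m ℂ := Matrix.of fun i j => ⟪e i, K (e j)⟫_ℂ with hA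
  have hroot : ∀ μ ∈ A.charpoly.roots, ‖μ‖ ≤ ‖K‖ := by
    intro μ hμ
    have hμ := Polynomial.isRoot_of_mem_roots hμ
    rw [Polynomial.IsRoot, Matrix.eval_charpoly] at hμ
    obtain ⟨v, hv, hAv⟩ := Matrix.exists_mulVec_eq_zero_iff.2 hμ
    set x : E := ∑ j, v j • e j with hx
    have hxx : ⟪x, x⟫_ℂ = ∑ i, (starRingEnd ℂ) (v i) * v i := he.inner_sum v v Finset.univ
    have hKx : ∀ i, ⟪e i, K x⟫_ℂ = μ * v i := by
      intro i
      have := congrFun hAv i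
      rw [Matrix.sub_mulVec, Pi.sub_apply, Pi.zero_apply, sub_eq_zero] at this
      simp only [Matrix.scalar_apply, Matrix.mulVec_diagonal] at this
      rw [this, hx, map_sum, inner_sum, Matrix.mulVec, dotProduct]
      refine Finset.sum_congr rfl fun j _ => ?_
      rw [map_smul, inner_smul_right, hA, Matrix.of_apply, mul_comm]
    have hxK : ⟪x, K x⟫_ℂ = μ * ⟪x, x⟫_ℂ := by
      conv_lhs => rw [hx, sum_inner]
      rw [hxx, Finset.mul_sum]
      refine Finset.sum_congr rfl fun i _ => ?_
      rw [inner_smul_left, ← hx, hKx]; ring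
    have hx0 : x ≠ 0 := by
      intro h0
      apply hv
      have := Fintype.linearIndependent_iff.1 he.linearIndependent v (hx ▸ h0)
      exact funext this
    have hpos : 0 < ‖x‖ ^ 2 := by positivity
    have h1 : ‖⟪x, K x⟫_ℂ‖ ≤ ‖K‖ * ‖x‖ ^ 2 := by
      calc _ ≤ ‖x‖ * ‖K x‖ := norm_inner_le_norm _ _
        _ ≤ ‖x‖ * (‖K‖ * ‖x‖) := by gcongr; exact K.le_opNorm x
        _ = _ := by ring
    rw [hxK, norm_mul, inner_self_eq_norm_sq_to_K, norm_pow, RCLike.norm_ofReal, abs_norm] at h1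
    exact le_of_mul_le_mul_right h1 hpos
  rw [Matrix.det_eq_prod_roots_charpoly]
  have h2 : ‖A.charpoly.roots.prod‖ = (A.charpoly.roots.map fun z => ‖z‖).prod :=
    map_multiset_prod (normHom : ℂ →*₀ ℝ) _
  have h3 : (A.charpoly.roots.map fun z => ‖z‖).prod ≤ ‖K‖ ^ A.charpoly.roots.card :=
    Multiset.prod_map_le_pow_card (f := (normHom : ℂ →*₀ ℝ)) (fun x _ => norm_nonneg x) hroot
  have h4 : A.charpoly.roots.card = Fintype.card m := by
    rw [← A.charpoly_natDegree_eq_dim]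
    exact Polynomial.splits_iff_card_roots.1 (IsAlgClosed.splits _)
  rw [h2, ← h4]
  exact h3

end Det
end
end QuasiFree

namespace QuasiFree
open scoped TensorProduct InnerProductSpace ENNReal
open Filter Topology MeasureTheory
attribute [local instance 2000] InnerProductSpace.toInner
noncomputable section

/-! ### Nuclear representations and the trace -/

section Nuclear
variable {E : Type*} [NormedAddCommGroup E] [InnerProductSpace ℂ E]

/-- Cauchy–Schwarz, followed by Bessel's inequality for each factor. -/
theorem sum_norm_inner_mul_norm_inner_le {ι : Type*} {b : ι → E} (hb : Orthonormal ℂ b) (x y : E)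
    (S : Finset ι) : ∑ i ∈ S, ‖⟪x, b i⟫_ℂ‖ * ‖⟪b i, y⟫_ℂ‖ ≤ ‖x‖ * ‖y‖ := by
  refine (Real.sum_mul_le_sqrt_mul_sqrt _ _ _).trans ?_
  have h1 := hb.sum_inner_products_le x (s := S)
  have h2 := hb.sum_inner_products_le y (s := S)
  simp only [norm_inner_symm x]
  gcongr
  · exact Real.sqrt_le_iff.2 ⟨norm_nonneg _, h1⟩
  · exact Real.sqrt_le_iff.2 ⟨norm_nonneg _, h2⟩

theorem isUnit_add_of_nonneg [CompleteSpace E] {P : E →L[ℂ] E} (hP : 0 ≤ P) {δ : ℝ} (hδ : 0 < δ) :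
    IsUnit (P + (δ : ℂ) • 1) := by
  have h1 : IsStrictlyPositive (algebraMap ℝ (E →L[ℂ] E) δ) :=
    IsStrictlyPositive.iff_of_unital.2 ⟨algebraMap_nonneg _ hδ.le,
      (isUnit_iff_ne_zero.2 hδ.ne').map _⟩
  have h2 : algebraMap ℝ (E →L[ℂ] E) δ = (δ : ℂ) • 1 := by
    rw [Algebra.algebraMap_eq_smul_one]; rfl
  rw [← h2]
  exact CStarAlgebra.isUnit_of_le _ (le_add_of_nonneg_left hP) h1

/-- `A = ∑ |u_k⟩⟨v_k|` with `∑ ‖u_k‖ ‖v_k‖ < ∞`. -/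
structure IsNuclearRep {κ : Type*} (A : E →L[ℂ] E) (u v : κ → E) : Prop where
  summable : Summable fun k => ‖u k‖ * ‖v k‖
  hasSum : ∀ x y, HasSum (fun k => ⟪x, u k⟫_ℂ * ⟪v k, y⟫_ℂ) ⟪x, A y⟫_ℂ

namespace IsNuclearRep
variable {κ : Type*} {A : E →L[ℂ] E} {u v : κ → E}

theorem smul (h : IsNuclearRep A u v) (c : ℂ) : IsNuclearRep (c • A) (fun k => c • u k) v where
  summable := by simpa only [norm_smul, mul_assoc] using h.summable.mul_left ‖c‖
  hasSum x y := by
    simpa only [inner_smul_right, mul_assoc, smul_apply] using (h.hasSum x y).mul_left c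

theorem norm_le (h : IsNuclearRep A u v) : ‖A‖ ≤ ∑' k, ‖u k‖ * ‖v k‖ := by
  refine A.opNorm_le_bound (tsum_nonneg fun k => by positivity) fun y => ?_
  have hb : ∀ x, ‖⟪x, A y⟫_ℂ‖ ≤ ‖x‖ * ((∑' k, ‖u k‖ * ‖v k‖) * ‖y‖) := by
    intro x
    have hs := (h.summable.mul_right ‖y‖).mul_left ‖x‖
    rw [← (h.hasSum x y).tsum_eq, ← tsum_mul_right, ← tsum_mul_left]
    refine tsum_of_norm_bounded hs.hasSum fun k => ?_
    rw [norm_mul]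
    calc _ ≤ (‖x‖ * ‖u k‖) * (‖v k‖ * ‖y‖) := by
          gcongr <;> exact norm_inner_le_norm _ _
      _ = _ := by ring
  by_cases h0 : ‖A y‖ = 0
  · rw [h0]; exact mul_nonneg (tsum_nonneg fun k => by positivity) (norm_nonneg _)
  · have := hb (A y)
    rw [inner_self_eq_norm_sq_to_K, norm_pow, RCLike.norm_ofReal, abs_norm, sq] at this
    exact le_of_mul_le_mul_left this (lt_of_le_of_ne (norm_nonneg _) (Ne.symm h0))

theorem summable_prod {ι : Type*} {b : ι → E} (hb : Orthonormal ℂ b)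
    (h : Summable fun k => ‖u k‖ * ‖v k‖) :
    Summable fun p : κ × ι => ⟪v p.1, b p.2⟫_ℂ * ⟪b p.2, u p.1⟫_ℂ := by
  refine Summable.of_norm ?_
  rw [summable_prod_of_nonneg (fun p => norm_nonneg _)]
  have hk : ∀ k, Summable fun i => ‖⟪v k, b i⟫_ℂ * ⟪b i, u k⟫_ℂ‖ := fun k =>
    summable_of_sum_le (fun i => norm_nonneg _) fun S => by
      simpa only [norm_mul] using
        sum_norm_inner_mul_norm_inner_le hb (v k) (u k) S
  refine ⟨hk, Summable.of_nonneg_of_le (fun k => tsum_nonneg fun i => norm_nonneg _) (fun k => ?_) h⟩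
  refine (hk k).tsum_le_of_sum_le fun S => ?_
  rw [mul_comm ‖u k‖]
  simpa only [norm_mul] using sum_norm_inner_mul_norm_inner_le hb (v k) (u k) S

theorem sum_norm_inner_le (h : IsNuclearRep A u v) {ι : Type*} {b : ι → E} (hb : Orthonormal ℂ b)
    (S : Finset ι) : ∑ i ∈ S, ‖⟪b i, A (b i)⟫_ℂ‖ ≤ ∑' k, ‖u k‖ * ‖v k‖ := by
  have h1 : ∀ i, Summable fun k => ‖⟪v k, b i⟫_ℂ‖ * ‖⟪b i, u k⟫_ℂ‖ := fun i => by
    have := ((h.hasSum (b i) (b i)).summable).norm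
    simpa only [norm_mul, mul_comm] using this
  calc ∑ i ∈ S, ‖⟪b i, A (b i)⟫_ℂ‖ ≤ ∑ i ∈ S, ∑' k, ‖⟪v k, b i⟫_ℂ‖ * ‖⟪b i, u k⟫_ℂ‖ := by
        refine Finset.sum_le_sum fun i _ => ?_
        rw [← (h.hasSum (b i) (b i)).tsum_eq]
        refine tsum_of_norm_bounded (h1 i).hasSum fun k => ?_
        rw [norm_mul, mul_comm]
    _ = ∑' k, ∑ i ∈ S, ‖⟪v k, b i⟫_ℂ‖ * ‖⟪b i, u k⟫_ℂ‖ :=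
        (Summable.tsum_finsetSum fun i _ => h1 i).symm
    _ ≤ _ := by
        refine Summable.tsum_le_tsum (fun k => ?_) (summable_sum fun i _ => h1 i) h.summable
        rw [mul_comm]
        exact sum_norm_inner_mul_norm_inner_le hb _ _ S

/-- Parseval for each `k`, then an interchange of absolutely convergent sums. The value does not
depend on `b`, which frees the trace from the fixed basis `onb`. -/
theorem hasSum_inner_basis (h : IsNuclearRep A u v) {ι : Type*} (b : HilbertBasis ι ℂ E) :
    HasSum (fun i => ⟪b i, A (b i)⟫_ℂ) (∑' k, ⟪v k, u k⟫_ℂ) := by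
  have hs := summable_prod b.orthonormal h.summable
  have h1 : HasSum (fun p : κ × ι => ⟪v p.1, b p.2⟫_ℂ * ⟪b p.2, u p.1⟫_ℂ) (∑' k, ⟪v k, u k⟫_ℂ) := by
    have := hs.hasSum.prod_fiberwise fun k => b.hasSum_inner_mul_inner (v k) (u k)
    rw [this.tsum_eq]
    exact hs.hasSum
  have h2 := (Equiv.prodComm ι κ).hasSum_iff.2 h1
  refine h2.prod_fiberwise fun i => ?_
  have := h.hasSum (b i) (b i)
  simpa [mul_comm, Function.comp_def] using this

variable [CompleteSpace E]

theorem mul_left (h : IsNuclearRep A u v) (B : E →L[ℂ] E) :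
    IsNuclearRep (B * A) (fun k => B (u k)) v where
  summable := by
    refine Summable.of_nonneg_of_le (fun k => by positivity) (fun k => ?_)
      (h.summable.mul_left ‖B‖)
    rw [← mul_assoc]
    gcongr
    exact B.le_opNorm _
  hasSum x y := by
    have := h.hasSum (ContinuousLinearMap.adjoint B x) y
    simpa only [ContinuousLinearMap.adjoint_inner_left, mul_apply_eq_comp] using this

theorem mul_right (h : IsNuclearRep A u v) (B : E →L[ℂ] E) :
    IsNuclearRep (A * B) u (fun k => ContinuousLinearMap.adjoint B (v k)) where
  summable := by
    refine Summable.of_nonneg_of_le (fun k => by positivity) (fun k => ?_)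
      (h.summable.mul_left ‖ContinuousLinearMap.adjoint B‖)
    rw [mul_left_comm]
    gcongr
    exact ContinuousLinearMap.le_opNorm _ _
  hasSum x y := by
    have := h.hasSum x (B y)
    simpa only [ContinuousLinearMap.adjoint_inner_left, mul_apply_eq_comp] using this

/-- The partial sums have finite rank and converge in operator norm. -/
theorem isCompactOperator (h : IsNuclearRep A u v) : IsCompactOperator A := by
  let R : κ → E →L[ℂ] E := fun k => (innerSL ℂ (v k)).smulRight (u k)
  have hR : ∀ k, ‖R k‖ = ‖v k‖ * ‖u k‖ := fun k => by
    rw [ContinuousLinearMap.norm_smulRight_apply, innerSL_apply_norm]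
  have hs : Summable R := by
    refine Summable.of_norm ?_
    simpa only [hR, mul_comm] using h.summable
  have hA : HasSum R A := by
    convert hs.hasSum
    ext y
    refine ext_inner_left ℂ fun x => ?_
    have h1 := (hs.hasSum.mapL (ContinuousLinearMap.apply ℂ E y)).mapL (innerSL ℂ x)
    refine (h.hasSum x y).unique ?_
    rw [innerSL_apply_apply] at h1
    have e : (fun k => ⟪x, u k⟫_ℂ * ⟪v k, y⟫_ℂ) =
        fun k => innerSL ℂ x (ContinuousLinearMap.apply ℂ E y (R k)) := by
      ext k
      simp [R, mul_comm]
    rw [e]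
    exact h1
  refine isCompactOperator_of_tendsto hA (Eventually.of_forall fun S => ?_)
  have : ∀ S : Finset κ, IsCompactOperator (∑ k ∈ S, R k : E →L[ℂ] E) := by
    classical
    intro S
    induction S using Finset.induction_on with
    | empty => simpa using isCompactOperator_zero
    | insert a S ha ih =>
      rw [Finset.sum_insert ha]
      refine IsCompactOperator.add ?_ ih
      have h1 : IsCompactOperator (innerSL ℂ (v a)) :=
        isCompactOperator_of_locallyCompactSpace_dom (innerSL ℂ (v a))
      exact h1.clm_comp ((ContinuousLinearMap.id ℂ ℂ).smulRight (u a))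
  exact this S

theorem trace_eq (h : IsNuclearRep A u v) : trace A = ∑' k, ⟪v k, u k⟫_ℂ :=
  (h.hasSum_inner_basis (onb E)).tsum_eq

/-- A substitute for polar decomposition. With `P = |A|` and `C = (P + δ)⁻¹`, the operator `B = (A
C)*` is a contraction, and the diagonal entries of `P` exceed those of `B A` in modulus by at most
`δ`. The diagonal of `B A` is controlled by its nuclear representation. -/
theorem isTraceClass (h : IsNuclearRep A u v) : IsTraceClass A := by
  set P := CFC.abs A with hP
  have hP0 : 0 ≤ P := CFC.abs_nonneg A
  have hPpos := (ContinuousLinearMap.nonneg_iff_isPositive _).1 hP0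
  have hPP : P * P = star A * A := CFC.abs_mul_abs A
  set b := onb E
  have hnn : ∀ x, 0 ≤ (⟪x, P x⟫_ℂ).re := fun x => hPpos.re_inner_nonneg_right x
  refine summable_of_sum_le (c := ∑' k, ‖u k‖ * ‖v k‖) (fun i => hnn _) fun S => ?_
  refine le_of_forall_pos_le_add fun ε hε => ?_
  -- The error `δ` occurs once for each element of `S`, so the total stays below `ε`.
  set δ : ℝ := ε / (S.card + 1)
  have hδ : 0 < δ := by positivity
  obtain ⟨C, hC⟩ := (isUnit_add_of_nonneg hP0 hδ).exists_right_inv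
  have hC' : ∀ x, P (C x) + (δ : ℂ) • C x = x := fun x => by
    simpa using congrArg (fun T : E →L[ℂ] E => T x) hC
  have hA : ∀ z, ‖A z‖ = ‖P z‖ := fun z => by
    have h1 := congrArg (fun T : E →L[ℂ] E => ⟪z, T z⟫_ℂ) hPP
    have hsa : star P = P := hPpos.isSelfAdjoint
    rw [ContinuousLinearMap.star_eq_adjoint] at hsa
    simp only [mul_apply_eq_comp, ContinuousLinearMap.star_eq_adjoint,
      ContinuousLinearMap.adjoint_inner_right] at h1
    rw [← ContinuousLinearMap.adjoint_inner_left, hsa, inner_self_eq_norm_sq_to_K,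
      inner_self_eq_norm_sq_to_K] at h1
    have h2 : ‖P z‖ ^ 2 = ‖A z‖ ^ 2 := by exact_mod_cast h1
    exact ((sq_eq_sq₀ (norm_nonneg _) (norm_nonneg _)).1 h2).symm
  -- In `‖P C x + δ C x‖²` the cross term is nonnegative because `P` is positive.
  have hPC : ∀ x, ‖P (C x)‖ ≤ ‖x‖ := fun x => by
    have h1 : ‖x‖ ^ 2 = ‖P (C x)‖ ^ 2 + 2 * (δ * (⟪P (C x), C x⟫_ℂ).re) + (δ * ‖C x‖) ^ 2 := by
      conv_lhs => rw [← hC' x, @norm_add_sq ℂ]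
      rw [inner_smul_right, norm_smul]
      simp [abs_of_pos hδ]
    have h2 : 0 ≤ (⟪P (C x), C x⟫_ℂ).re := hPpos.re_inner_nonneg_left _
    have h3 : ‖P (C x)‖ ^ 2 ≤ ‖x‖ ^ 2 := by rw [h1]; nlinarith [mul_nonneg hδ.le h2, sq_nonneg (δ * ‖C x‖)]
    exact (sq_le_sq₀ (norm_nonneg _) (norm_nonneg _)).1 h3
  set B := ContinuousLinearMap.adjoint (A * C) with hB
  have hB1 : ‖B‖ ≤ 1 := by
    rw [hB, LinearIsometryEquiv.norm_map]
    refine ContinuousLinearMap.opNorm_le_bound _ zero_le_one fun x => ?_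
    rw [one_mul, mul_apply_eq_comp, hA]
    exact hPC x
  have hrep := h.mul_left B
  have key : ∀ i, (⟪b i, P (b i)⟫_ℂ).re ≤ ‖⟪b i, (B * A) (b i)⟫_ℂ‖ + δ := by
    intro i
    have hn : ‖b i‖ = 1 := b.orthonormal.1 i
    have e1 : ⟪b i, P (b i)⟫_ℂ = ⟪A (b i), A (C (b i))⟫_ℂ + δ * ⟪b i, P (C (b i))⟫_ℂ := by
      conv_lhs => rw [← hC' (b i), map_add, map_smul, inner_add_right, inner_smul_right, hC' (b i)]
      congr 1
      have := congrArg (fun T : E →L[ℂ] E => ⟪b i, T (C (b i))⟫_ℂ) hPP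
      simpa [ContinuousLinearMap.star_eq_adjoint,
        ContinuousLinearMap.adjoint_inner_right] using this
    have e2 : ⟪b i, (B * A) (b i)⟫_ℂ = ⟪A (C (b i)), A (b i)⟫_ℂ := by
      simp [hB, ContinuousLinearMap.adjoint_inner_right]
    rw [e1, Complex.add_re, e2, norm_inner_symm]
    refine add_le_add (Complex.re_le_norm _) ?_
    refine (Complex.re_le_norm _).trans ?_
    rw [norm_mul, Complex.norm_real, Real.norm_of_nonneg hδ.le]
    have : ‖⟪b i, P (C (b i))⟫_ℂ‖ ≤ 1 := by
      refine (norm_inner_le_norm _ _).trans ?_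
      rw [hn, one_mul, ← hn]
      exact hPC _
    nlinarith
  calc ∑ i ∈ S, (⟪b i, P (b i)⟫_ℂ).re ≤ ∑ i ∈ S, (‖⟪b i, (B * A) (b i)⟫_ℂ‖ + δ) :=
        Finset.sum_le_sum fun i _ => key i
    _ = ∑ i ∈ S, ‖⟪b i, (B * A) (b i)⟫_ℂ‖ + S.card * δ := by
        rw [Finset.sum_add_distrib, Finset.sum_const, nsmul_eq_mul]
    _ ≤ ∑' k, ‖u k‖ * ‖v k‖ + ε := by
        refine add_le_add ((hrep.sum_norm_inner_le b.orthonormal S).trans ?_) ?_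
        · refine Summable.tsum_le_tsum (fun k => ?_) hrep.summable h.summable
          gcongr
          exact (B.le_of_opNorm_le hB1 _).trans (one_mul _).le
        · rw [mul_div_assoc', div_le_iff₀ (by positivity)]
          nlinarith

end IsNuclearRep

variable [CompleteSpace E]

/-- Parseval's identity is inserted between the two factors of `A = √A √A`. -/
theorem IsTraceClass.exists_rep {A : E →L[ℂ] E} (hA : IsTraceClass A) (hA0 : 0 ≤ A) :
    ∃ u : onbIndex E → E, IsNuclearRep A u u := by
  set S := CFC.sqrt A
  have hS0 : 0 ≤ S := CFC.sqrt_nonneg A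
  have hSS : S * S = A := CFC.sqrt_mul_sqrt_self A
  have hSa : ∀ x y, ⟪x, S y⟫_ℂ = ⟪S x, y⟫_ℂ := fun x y =>
    (((ContinuousLinearMap.nonneg_iff_isPositive _).1 hS0).isSymmetric x y).symm
  have hxy : ∀ x y, ⟪x, A y⟫_ℂ = ⟪S x, S y⟫_ℂ := fun x y => by
    rw [← hSS, mul_apply_eq_comp, hSa]
  refine ⟨fun i => S (onb E i), ?_, fun x y => ?_⟩
  · rw [IsTraceClass, CFC.abs_of_nonneg A] at hA
    refine hA.congr fun i => ?_
    rw [hxy, inner_self_eq_norm_sq_to_K, ← sq]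
    norm_cast
  · have := (onb E).hasSum_inner_mul_inner (S x) (S y)
    simpa only [hSa, hxy] using this

/-- A positive trace class operator has an orthonormal basis of eigenvectors, with summable
eigenvalues. -/
theorem exists_eigenbasis.{w} {E : Type w} [NormedAddCommGroup E] [InnerProductSpace ℂ E]
    [CompleteSpace E] {A : E →L[ℂ] E} (hA : IsTraceClass A) (hA0 : 0 ≤ A) :
    ∃ (ι : Type w) (e : HilbertBasis ι ℂ E) (l : ι → ℝ), (∀ i, A (e i) = (l i : ℂ) • e i) ∧
      (∀ i, 0 ≤ l i) ∧ (∀ i, l i ≤ ‖A‖) ∧ Summable l := by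
  obtain ⟨u, hu⟩ := hA.exists_rep hA0
  have hpos := (ContinuousLinearMap.nonneg_iff_isPositive _).1 hA0
  have hsym : (A : E →ₗ[ℂ] E).IsSymmetric := hpos.isSymmetric
  have hbot := ContinuousLinearMap.orthogonalComplement_iSup_eigenspaces_eq_bot
    hu.isCompactOperator hsym
  have hcl : ∀ μ : ℂ, IsClosed (Module.End.eigenspace (A : Module.End ℂ E) μ : Set E) := fun μ => by
    have : (Module.End.eigenspace (A : Module.End ℂ E) μ : Set E) = {x | A x = μ • x} := by
      ext x; simp
    rw [this]
    exact isClosed_eq A.continuous (continuous_const_smul μ)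
  have : ∀ μ : ℂ, CompleteSpace (Module.End.eigenspace (A : Module.End ℂ E) μ) :=
    fun μ => (hcl μ).completeSpace_coe
  -- Orthonormal bases of all eigenspaces are collected, including the kernel; by the spectral
  -- theorem for compact symmetric operators nothing is orthogonal to all of them.
  let ι := Σ μ : ℂ, onbIndex (Module.End.eigenspace (A : Module.End ℂ E) μ)
  let b : ι → E := fun a => (onb (Module.End.eigenspace (A : Module.End ℂ E) a.1) a.2 : E)
  have hb : Orthonormal ℂ b :=
    hsym.orthogonalFamily_eigenspaces.orthonormal_sigma_orthonormal
      fun μ => (onb (Module.End.eigenspace (A : Module.End ℂ E) μ)).orthonormal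
  have hspan : (Submodule.span ℂ (Set.range b))ᗮ = ⊥ := by
    rw [← le_bot_iff, ← hbot, ← Submodule.orthogonal_closure]
    refine Submodule.orthogonal_le (iSup_le fun μ x hx => ?_)
    have h1 := (onb (Module.End.eigenspace (A : Module.End ℂ E) μ)).hasSum_repr ⟨x, hx⟩
    have h2 := h1.mapL (Module.End.eigenspace (A : Module.End ℂ E) μ).subtypeL
    refine mem_closure_of_tendsto h2 (Eventually.of_forall fun S => ?_)
    refine Submodule.sum_mem _ fun i _ => ?_
    rw [map_smul]
    exact Submodule.smul_mem _ _ (Submodule.subset_span ⟨⟨μ, i⟩, rfl⟩)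
  let e := HilbertBasis.mkOfOrthogonalEqBot hb hspan
  have he : ∀ i, e i = b i := fun i => by
    simp only [e, HilbertBasis.coe_mkOfOrthogonalEqBot]
  have hAe : ∀ i, A (e i) = i.1 • e i := fun i => by
    rw [he]; exact Module.End.mem_eigenspace_iff.1 (onb (Module.End.eigenspace (A : Module.End ℂ E) i.1) i.2).2
  have hn : ∀ i, ‖e i‖ = 1 := fun i => e.orthonormal.1 i
  have hin : ∀ i, ⟪e i, A (e i)⟫_ℂ = i.1 := fun i => by
    rw [hAe, inner_smul_right, inner_self_eq_norm_sq_to_K, hn]; simp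
  have hre : ∀ i : ι, (i.1 : ℂ) = ((i.1.re : ℝ) : ℂ) := fun i => by
    have := hpos.inner_nonneg_right (e i)
    rw [hin] at this
    exact Complex.eq_re_of_ofReal_le this
  refine ⟨ι, e, fun i => i.1.re, fun i => by rw [hAe, ← hre], fun i => ?_, fun i => ?_, ?_⟩
  · change 0 ≤ i.1.re
    rw [← hin i]; exact hpos.re_inner_nonneg_right (e i)
  · change i.1.re ≤ _
    rw [← hin i]
    refine (Complex.re_le_norm _).trans ((norm_inner_le_norm _ _).trans ?_)
    rw [hn, one_mul]
    simpa [hn] using A.le_opNorm (e i)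
  · have := Complex.hasSum_re (hu.hasSum_inner_basis e)
    simp only [hin] at this
    exact this.summable
end Nuclear
end
end QuasiFree

namespace QuasiFree
open scoped TensorProduct InnerProductSpace ENNReal
open Filter Topology MeasureTheory
attribute [local instance 2000] InnerProductSpace.toInner
noncomputable section

/-! ### Operators on tensor powers -/

section TensorPowers
universe w
variable {H : Type w} [NormedAddCommGroup H] [InnerProductSpace ℂ H] {N : ℕ}

theorem norm_prodVec (x : Fin N → H) : ‖prodVec x‖ = ∏ i, ‖x i‖ := by
  have h : ‖prodVec x‖ ^ 2 = (∏ i, ‖x i‖) ^ 2 := by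
    have h1 := inner_prodVec x x
    simp only [inner_self_eq_norm_sq_to_K] at h1
    rw [Finset.prod_pow] at h1
    exact_mod_cast h1
  exact (sq_eq_sq₀ (norm_nonneg _) (Finset.prod_nonneg fun _ _ => norm_nonneg _)).1 h

/-- The map `x ↦ prodVec (update x k y)`, linear in `y`. -/
def prodVecSlot (x : Fin N → H) (k : Fin N) : H →L[ℂ] Tensor H N :=
  LinearMap.mkContinuous
    ((UniformSpace.Completion.toComplL (𝕜 := ℂ) (E := TensorPow H N) :
      TensorPow H N →ₗ[ℂ] Tensor H N) ∘ₗ (tprod (H := H) (N := N)).toLinearMap x k)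
    (∏ i ∈ Finset.univ.erase k, ‖x i‖) fun y => by
      change ‖prodVec (Function.update x k y)‖ ≤ _
      rw [norm_prodVec, ← Finset.prod_erase_mul _ _ (Finset.mem_univ k), Function.update_self]
      refine le_of_eq ?_
      congr 1
      refine Finset.prod_congr rfl fun i hi => ?_
      rw [Function.update_of_ne (Finset.ne_of_mem_erase hi)]

theorem prodVecSlot_apply (x : Fin N → H) (k : Fin N) (y : H) :
    prodVecSlot x k y = prodVec (Function.update x k y) := rfl

theorem prodVec_smul (c : Fin N → ℂ) (x : Fin N → H) :
    prodVec (fun k => c k • x k) = (∏ k, c k) • prodVec x := by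
  rw [prodVec, MultilinearMap.map_smul_univ, UniformSpace.Completion.coe_smul]
  rfl

theorem tensorOp_one : tensorOp (fun _ : Fin N => (1 : H →L[ℂ] H)) = 1 :=
  prodVec_ext fun x => by rw [tensorOp_prodVec]; rfl

theorem permOp_mul (π ρ : Equiv.Perm (Fin N)) :
    (permOp (π * ρ) : Tensor H N →L[ℂ] Tensor H N) = permOp π * permOp ρ :=
  prodVec_ext fun x => by
    rw [mul_apply_eq_comp, permOp_prodVec, permOp_prodVec, permOp_prodVec]; rfl

/-- Product vectors are total; this is used once in each argument. -/
theorem inner_eq_of_prodVec {A B : Tensor H N →L[ℂ] Tensor H N}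
    (h : ∀ x y : Fin N → H, ⟪A (prodVec x), prodVec y⟫_ℂ = ⟪prodVec x, B (prodVec y)⟫_ℂ)
    (a b : Tensor H N) : ⟪A a, b⟫_ℂ = ⟪a, B b⟫_ℂ := by
  have h1 : ∀ (x : Fin N → H) (b : Tensor H N), ⟪A (prodVec x), b⟫_ℂ = ⟪prodVec x, B b⟫_ℂ := by
    intro x b
    have : innerSL ℂ (A (prodVec x)) = (innerSL ℂ (prodVec x)) ∘L B :=
      prodVec_ext fun y => by simpa using h x y
    simpa using congrArg (fun f => f b) this
  have h2 : (innerSL ℂ b) ∘L A = innerSL ℂ (B b) := prodVec_ext fun x => by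
    have := congrArg (starRingEnd ℂ) (h1 x b)
    simpa only [inner_conj_symm, ContinuousLinearMap.comp_apply, innerSL_apply_apply] using this
  have := congrArg (fun f => starRingEnd ℂ (f a)) h2
  simpa only [inner_conj_symm, ContinuousLinearMap.comp_apply, innerSL_apply_apply] using this

theorem inner_permOp_left (π : Equiv.Perm (Fin N)) (a b : Tensor H N) :
    ⟪permOp π a, b⟫_ℂ = ⟪a, permOp π⁻¹ b⟫_ℂ :=
  inner_eq_of_prodVec (fun x y => by
    rw [permOp_prodVec, permOp_prodVec, inner_prodVec, inner_prodVec, ← Equiv.prod_comp π]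
    simp [Equiv.Perm.inv_def]) a b

/-- One factor is split off at a time. Unlike the constant of `algMap_bound`, the constant `1` is
uniform in `N`, which is what makes `Γ_s` of a contraction bounded. -/
theorem norm_algMap_le (T : Fin N → H →L[ℂ] H) (hT : ∀ k, ‖T k‖ ≤ 1) (a : TensorPow H N) :
    ‖algMap T a‖ ≤ ‖a‖ := by
  induction N with
  | zero =>
    have : algMap T = LinearMap.id := by
      apply LinearMap.ext
      intro a
      induction a using tprod_induction with
      | h0 => simp
      | ha a a' h h' => rw [map_add, h, h', map_add]
      | hs c a h => rw [map_smul, h, map_smul]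
      | ht x => rw [algMap_tprod]; exact congrArg _ (Subsingleton.elim _ _)
    rw [this]; simp
  | succ N ih =>
    let S : TensorPow H N →L[ℂ] TensorPow H N :=
      (algMap fun i => T i.castSucc).mkContinuous 1 fun a => by
        rw [one_mul]; exact ih _ (fun k => hT _) a
    have hS : ‖S‖ ≤ 1 := LinearMap.mkContinuous_norm_le _ zero_le_one _
    have key : split H N (algMap T a) = TensorProduct.mapL S (T (Fin.last N)) (split H N a) := by
      induction a using tprod_induction with
      | h0 => simp
      | ha a a' h h' => rw [map_add, map_add, h, h', map_add, map_add]
      | hs c a h => rw [map_smul, map_smul, h, map_smul, map_smul]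
      | ht x =>
        rw [algMap_tprod, split_tprod, split_tprod, TensorProduct.mapL_tmul]
        congr 1
        exact (algMap_tprod _ _).symm
    have hn : ‖TensorProduct.mapL S (T (Fin.last N))‖ ≤ 1 :=
      (TensorProduct.norm_mapL_le _ _).trans
        (mul_le_one₀ hS (norm_nonneg _) (hT _))
    rw [← norm_split, key, ← norm_split a]
    simpa using ContinuousLinearMap.le_of_opNorm_le _ hn (split H N a)

theorem norm_tensorOp_le_one (T : Fin N → H →L[ℂ] H) (hT : ∀ k, ‖T k‖ ≤ 1) : ‖tensorOp T‖ ≤ 1 := by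
  refine ContinuousLinearMap.opNorm_le_bound _ zero_le_one fun a => ?_
  rw [one_mul]
  induction a using UniformSpace.Completion.induction_on with
  | hp => exact isClosed_le (by fun_prop) (by fun_prop)
  | ih a =>
    rw [tensorOp, opExtend_coe _ (algMap_bound T), UniformSpace.Completion.norm_coe,
      UniformSpace.Completion.norm_coe]
    exact norm_algMap_le T hT a

/-- The symmetrizer or antisymmetrizer. -/
def symOp (H : Type w) [NormedAddCommGroup H] [InnerProductSpace ℂ H] (s : ℤˣ) (N : ℕ) :
    Tensor H N →L[ℂ] Tensor H N :=
  (N.factorial : ℂ)⁻¹ • ∑ π : Equiv.Perm (Fin N), statC s π • permOp π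

theorem symOp_apply (s : ℤˣ) (ψ : Tensor H N) :
    symOp H s N ψ = (N.factorial : ℂ)⁻¹ • ∑ π : Equiv.Perm (Fin N), statC s π • permOp π ψ := by
  simp [symOp]

theorem permOp_of_mem_Sector {s : ℤˣ} {ψ : Tensor H N} (h : ψ ∈ Sector H s N)
    (π : Equiv.Perm (Fin N)) : permOp π ψ = statC s π • ψ := mem_Sector.1 h π

theorem symOp_mem (s : ℤˣ) (ψ : Tensor H N) : symOp H s N ψ ∈ Sector H s N := by
  rw [mem_Sector]
  intro π
  change _ = statC s π • symOp H s N ψ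
  rw [symOp_apply, map_smul, map_sum, smul_comm (statC s π)]
  congr 1
  rw [Finset.smul_sum]
  refine Fintype.sum_equiv (Equiv.mulLeft π) _
    (fun ρ => statC s π • statC s ρ • permOp ρ ψ) fun ρ => ?_
  rw [Equiv.coe_mulLeft, statC_mul, map_smul, permOp_mul, mul_apply_eq_comp, smul_smul,
    ← mul_assoc, statC_mul_self, one_mul]

/-- Each permutation, moved over to `φ`, returns its character, which cancels the one in the sum;
the `N!` terms are then equal. -/
theorem inner_symOp_of_mem {s : ℤˣ} {φ : Tensor H N} (h : φ ∈ Sector H s N) (ψ : Tensor H N) :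
    ⟪φ, symOp H s N ψ⟫_ℂ = ⟪φ, ψ⟫_ℂ := by
  have hf : (N.factorial : ℂ) ≠ 0 := by exact_mod_cast Nat.factorial_ne_zero _
  have h1 : ∀ π : Equiv.Perm (Fin N), ⟪φ, statC s π • permOp π ψ⟫_ℂ = ⟪φ, ψ⟫_ℂ := by
    intro π
    have := inner_permOp_left π⁻¹ φ ψ
    rw [inv_inv] at this
    rw [inner_smul_right, ← this, permOp_of_mem_Sector h, inner_smul_left, conj_statC, statC_inv,
      ← mul_assoc, statC_mul_self, one_mul]
  rw [symOp_apply, inner_smul_right, inner_sum]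
  simp only [h1, Finset.sum_const, Finset.card_univ, Fintype.card_perm, Fintype.card_fin,
    nsmul_eq_mul]
  rw [inv_mul_cancel_left₀ hf]

/-- The projection of a product vector to the `N`-particle space. -/
def symVec (s : ℤˣ) (x : Fin N → H) : Sector H s N := ⟨symOp H s N (prodVec x), symOp_mem s _⟩

theorem inner_symVec_right {s : ℤˣ} (φ : Sector H s N) (x : Fin N → H) :
    ⟪φ, symVec s x⟫_ℂ = ⟪(φ : Tensor H N), prodVec x⟫_ℂ :=
  inner_symOp_of_mem φ.2 _

theorem inner_symVec_left {s : ℤˣ} (φ : Sector H s N) (x : Fin N → H) :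
    ⟪symVec s x, φ⟫_ℂ = ⟪prodVec x, (φ : Tensor H N)⟫_ℂ := by
  rw [← inner_conj_symm, inner_symVec_right, inner_conj_symm]

theorem coe_symVec (s : ℤˣ) (x : Fin N → H) : (symVec s x : Tensor H N) =
    (N.factorial : ℂ)⁻¹ • ∑ π : Equiv.Perm (Fin N), statC s π • prodVec fun k => x (π k) := by
  change symOp H s N (prodVec x) = _
  rw [symOp_apply]
  congr 1
  refine Fintype.sum_equiv (Equiv.inv _) _ _ fun π => ?_
  rw [Equiv.inv_apply, statC_inv, permOp_prodVec]
  rfl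

theorem coe_sectorPow (s : ℤˣ) (A : H →L[ℂ] H) (ψ : Sector H s N) :
    (sectorPow s A N ψ : Tensor H N) = tensorOp (fun _ => A) (ψ : Tensor H N) := rfl

/-- Since `A^{⊗N}` preserves the sector, one of the two symmetrizations can be dropped; the
permutation sum of the other is the immanant. -/
theorem inner_symVec_sectorPow (s : ℤˣ) (A : H →L[ℂ] H) (x y : Fin N → H) :
    ⟪symVec s x, sectorPow s A N (symVec s y)⟫_ℂ =
      imm s (Matrix.of fun k l => ⟪x k, A (y l)⟫_ℂ) / N.factorial := by
  rw [inner_symVec_left, coe_sectorPow, coe_symVec, map_smul, map_sum, inner_smul_right,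
    inner_sum, imm, div_eq_inv_mul]
  congr 1
  refine Finset.sum_congr rfl fun π _ => ?_
  rw [map_smul, inner_smul_right, tensorOp_prodVec, inner_prodVec]
  rfl

theorem norm_sectorPow_le_one (s : ℤˣ) {A : H →L[ℂ] H} (hA : ‖A‖ ≤ 1) (N : ℕ) :
    ‖sectorPow s A N‖ ≤ 1 := by
  refine ContinuousLinearMap.opNorm_le_bound _ zero_le_one fun ψ => ?_
  exact ContinuousLinearMap.le_of_opNorm_le _ (norm_tensorOp_le_one _ fun _ => hA) (ψ : Tensor H N)

theorem fockBounded_of_norm_le_one (s : ℤˣ) {A : H →L[ℂ] H} (hA : ‖A‖ ≤ 1) : FockBounded s A :=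
  ⟨1, by rintro _ ⟨N, rfl⟩; exact norm_sectorPow_le_one s hA N⟩

section Basis
variable {ι : Type*} (e : HilbertBasis ι ℂ H)

theorem orthonormal_prodVec : Orthonormal ℂ fun i : Fin N → ι => prodVec fun k => e (i k) := by
  classical
  rw [orthonormal_iff_ite]
  intro i j
  rw [inner_prodVec]
  have h := orthonormal_iff_ite.1 e.orthonormal
  simp only [h]
  by_cases hij : i = j
  · subst hij; simp
  · obtain ⟨k, hk⟩ := Function.ne_iff.1 hij
    rw [if_neg hij]
    exact Finset.prod_eq_zero (Finset.mem_univ k) (if_neg hk)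

theorem span_prodVec_orthogonal :
    (Submodule.span ℂ (Set.range fun i : Fin N → ι => prodVec fun k => e (i k)))ᗮ = ⊥ := by
  rw [Submodule.eq_bot_iff]
  intro ψ hψ
  rw [Submodule.mem_orthogonal'] at hψ
  -- `S` is the set of slots whose entries are arbitrary. Slots are freed one at a time, by
  -- linearity and continuity in the slot and density of the span of the basis.
  have key : ∀ S : Finset (Fin N), ∀ x : Fin N → H, (∀ k ∉ S, x k ∈ Set.range e) →
      ⟪ψ, prodVec x⟫_ℂ = 0 := by
    intro S
    induction S using Finset.induction_on with
    | empty =>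
      intro x hx
      choose i hi using fun k => hx k (Finset.notMem_empty k)
      have : x = fun k => e (i k) := funext fun k => (hi k).symm
      rw [this]
      exact hψ _ (Submodule.subset_span ⟨i, rfl⟩)
    | insert a S ha ih =>
      intro x hx
      have h0 : innerSL ℂ ψ ∘L prodVecSlot x a = 0 := by
        refine ContinuousLinearMap.ext_on (s := Set.range e) ?_ ?_
        · have := e.dense_span
          rwa [← Submodule.dense_iff_topologicalClosure_eq_top] at this
        · rintro _ ⟨i, rfl⟩
          simp only [ContinuousLinearMap.comp_apply, innerSL_apply_apply, prodVecSlot_apply,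
            zero_apply]
          refine ih _ fun k hk => ?_
          by_cases hka : k = a
          · subst hka; simp
          · rw [Function.update_of_ne hka]
            exact hx k fun h => (Finset.mem_insert.1 h).elim hka hk
      have := congrArg (fun f => f (x a)) h0
      simpa [prodVecSlot_apply] using this
  have h2 : innerSL ℂ ψ = 0 := prodVec_ext fun x => by
    simpa using key Finset.univ x (by simp)
  have h3 := congrArg (fun f => f ψ) h2
  simpa using h3

/-- The orthonormal basis of product vectors. -/
def prodBasis (N : ℕ) : HilbertBasis (Fin N → ι) ℂ (Tensor H N) :=
  HilbertBasis.mkOfOrthogonalEqBot (orthonormal_prodVec e) (span_prodVec_orthogonal e)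

theorem prodBasis_apply (i : Fin N → ι) : prodBasis e N i = prodVec fun k => e (i k) := by
  rw [prodBasis, HilbertBasis.coe_mkOfOrthogonalEqBot]

variable {σ : H →L[ℂ] H} {l : ι → ℝ}

theorem inner_tensorOp_left (hσ : ∀ x y, ⟪σ x, y⟫_ℂ = ⟪x, σ y⟫_ℂ) (a b : Tensor H N) :
    ⟪tensorOp (fun _ => σ) a, b⟫_ℂ = ⟪a, tensorOp (fun _ => σ) b⟫_ℂ :=
  inner_eq_of_prodVec (fun x y => by
    rw [tensorOp_prodVec, tensorOp_prodVec, inner_prodVec, inner_prodVec]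
    simp only [hσ]) a b

/-- Parseval in the product basis of the full tensor power, which diagonalizes `σ^{⊗N}`. Against
sector vectors a product vector may be replaced by its symmetrization, so no basis of the sector is
needed. -/
theorem hasSum_sectorPow (s : ℤˣ) (hσ : ∀ x y, ⟪σ x, y⟫_ℂ = ⟪x, σ y⟫_ℂ)
    (hl : ∀ i, σ (e i) = (l i : ℂ) • e i) (φ ψ : Sector H s N) :
    HasSum (fun i : Fin N → ι => ((∏ k, l (i k) : ℝ) : ℂ) *
      (⟪φ, symVec s fun k => e (i k)⟫_ℂ * ⟪symVec s fun k => e (i k), ψ⟫_ℂ))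
      ⟪φ, sectorPow s σ N ψ⟫_ℂ := by
  have h := (prodBasis e N).hasSum_inner_mul_inner (φ : Tensor H N) (sectorPow s σ N ψ)
  have e1 : ∀ i : Fin N → ι, tensorOp (fun _ => σ) (prodVec fun k => e (i k)) =
      ((∏ k, l (i k) : ℝ) : ℂ) • prodVec fun k => e (i k) := fun i => by
    rw [tensorOp_prodVec]
    simp only [hl]
    rw [prodVec_smul, Complex.ofReal_prod]
  have e2 : ∀ i : Fin N → ι, ((∏ k, l (i k) : ℝ) : ℂ) *
      (⟪φ, symVec s fun k => e (i k)⟫_ℂ * ⟪symVec s fun k => e (i k), ψ⟫_ℂ) =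
      ⟪(φ : Tensor H N), prodBasis e N i⟫_ℂ * ⟪prodBasis e N i, sectorPow s σ N ψ⟫_ℂ := fun i => by
    rw [inner_symVec_left, inner_symVec_right, prodBasis_apply, coe_sectorPow,
      ← inner_tensorOp_left hσ, e1, inner_smul_left, Complex.conj_ofReal]
    ring
  simp only [e2]
  exact h

end Basis
end TensorPowers
end
end QuasiFree

namespace QuasiFree
open scoped TensorProduct InnerProductSpace ENNReal
open Filter Topology MeasureTheory
attribute [local instance 2000] InnerProductSpace.toInner
noncomputable section

/-! ### Sums over index tuples of all lengths -/

section Tuples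
variable {ι : Type*}

/-- The inclusion of the index tuples with entries in `I`. -/
def tupleIncl (I : Finset ι) (k : Σ N : ℕ, Fin N → I) : Σ N : ℕ, Fin N → ι := ⟨k.1, fun j => k.2 j⟩

theorem tupleIncl_injective (I : Finset ι) : Function.Injective (tupleIncl I) := by
  rintro ⟨N, i⟩ ⟨M, j⟩ h
  obtain rfl : N = M := congrArg Sigma.fst h
  have h2 : (fun a => (i a : ι)) = fun a => (j a : ι) := by simpa [tupleIncl] using h
  congr 1
  ext a
  exact congrFun h2 a

theorem mem_range_tupleIncl {I : Finset ι} {k : Σ N : ℕ, Fin N → ι} :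
    k ∈ Set.range (tupleIncl I) ↔ ∀ j, k.2 j ∈ I :=
  ⟨by rintro ⟨k, rfl⟩ j; exact (k.2 j).2, fun h => ⟨⟨k.1, fun j => ⟨k.2 j, h j⟩⟩, rfl⟩⟩

/-- Every finite set of tuples lies among those of length below some `M` with entries in one finite
set `I`. -/
theorem summable_of_tuple_sum_le {f : (Σ N : ℕ, Fin N → ι) → ℝ} (hf : ∀ k, 0 ≤ f k) {C : ℝ}
    (h : ∀ (I : Finset ι) (M : ℕ),
      ∑ N ∈ Finset.range M, ∑ i : Fin N → I, f (tupleIncl I ⟨N, i⟩) ≤ C) : Summable f := by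
  classical
  refine summable_of_sum_le (c := C) hf fun F => ?_
  let I : Finset ι := F.biUnion fun k => Finset.univ.image k.2
  let M := F.sup Sigma.fst + 1
  refine le_trans ?_ (h I M)
  rw [(Finset.sum_sigma' (Finset.range M) (fun N => (Finset.univ : Finset (Fin N → I)))
    (fun N i => f (tupleIncl I ⟨N, i⟩))).trans
    (Finset.sum_map _ ⟨tupleIncl I, tupleIncl_injective I⟩ f).symm]
  refine Finset.sum_le_sum_of_subset_of_nonneg (fun k hk => ?_) fun _ _ _ => hf _
  have hI : ∀ j, k.2 j ∈ I := fun j =>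
    Finset.mem_biUnion.2 ⟨k, hk, Finset.mem_image_of_mem _ (Finset.mem_univ j)⟩
  refine Finset.mem_map.2 ⟨⟨k.1, fun j => ⟨k.2 j, hI j⟩⟩, ?_, rfl⟩
  rw [Finset.mem_sigma]
  exact ⟨Finset.mem_range.2 (Nat.lt_succ_of_le (Finset.le_sup (f := Sigma.fst) hk)),
    Finset.mem_univ _⟩

/-- A given tuple eventually has all its entries in `I`; dominated convergence does the rest. -/
theorem tendsto_tsum_tupleIncl {f : (Σ N : ℕ, Fin N → ι) → ℂ} (hf : Summable f) :
    Tendsto (fun I : Finset ι => ∑' k, f (tupleIncl I k)) atTop (𝓝 (∑' k, f k)) := by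
  classical
  have h1 : ∀ I : Finset ι, ∑' k, f (tupleIncl I k) =
      ∑' k, (Set.range (tupleIncl I)).indicator f k := fun I => by
    rw [← tsum_subtype, (Equiv.ofInjective _ (tupleIncl_injective I)).tsum_eq
      (fun k : Set.range (tupleIncl I) => f k) |>.symm]
    rfl
  simp only [h1]
  refine tendsto_tsum_of_dominated_convergence hf.norm (fun k => ?_)
    (Eventually.of_forall fun I k => norm_indicator_le_norm_self _ _)
  refine tendsto_const_nhds.congr' ?_
  filter_upwards [eventually_ge_atTop (Finset.univ.image k.2)] with I hI
  rw [Set.indicator_of_mem]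
  exact mem_range_tupleIncl.2 fun j => hI (Finset.mem_image_of_mem _ (Finset.mem_univ j))

theorem hasSum_tsum_tupleIncl {f : (Σ N : ℕ, Fin N → ι) → ℂ} (hf : Summable f) (I : Finset ι) :
    HasSum (fun N => ∑ i : Fin N → I, f (tupleIncl I ⟨N, i⟩)) (∑' k, f (tupleIncl I k)) := by
  have := (hf.comp_injective (tupleIncl_injective I)).hasSum
  exact this.sigma fun N => hasSum_fintype _

end Tuples

/-! ### Second quantization of a trace class operator -/

section Fock
universe w
variable {H : Type w} [NormedAddCommGroup H] [InnerProductSpace ℂ H] {ι : Type*}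

/-- An orthonormal basis of eigenvectors of a positive trace class operator. -/
structure IsEigenbasis (σ : H →L[ℂ] H) (e : HilbertBasis ι ℂ H) (l : ι → ℝ) : Prop where
  apply : ∀ i, σ (e i) = (l i : ℂ) • e i
  nonneg : ∀ i, 0 ≤ l i
  le_norm : ∀ i, l i ≤ ‖σ‖
  summable : Summable l
  symm : ∀ x y, ⟪σ x, y⟫_ℂ = ⟪x, σ y⟫_ℂ

/-- The product of the eigenvalues along a tuple. -/
def weight (l : ι → ℝ) (k : Σ N : ℕ, Fin N → ι) : ℝ := ∏ j, l (k.2 j)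

/-- The (anti)symmetrized product of basis vectors. -/
def tupleVec (s : ℤˣ) (e : HilbertBasis ι ℂ H) (k : Σ N : ℕ, Fin N → ι) : Sector H s k.1 :=
  symVec s fun j => e (k.2 j)

/-- The (anti)symmetrized product of basis vectors, in Fock space. -/
def fockVec (s : ℤˣ) (e : HilbertBasis ι ℂ H) (k : Σ N : ℕ, Fin N → ι) : Fock H s :=
  lp.single 2 k.1 (tupleVec s e k)

theorem inner_fockVec_right {s : ℤˣ} (e : HilbertBasis ι ℂ H) (x : Fock H s)
    (k : Σ N : ℕ, Fin N → ι) : ⟪x, fockVec s e k⟫_ℂ = ⟪x k.1, tupleVec s e k⟫_ℂ :=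
  lp.inner_single_right _ _ _

theorem inner_fockVec_left {s : ℤˣ} (e : HilbertBasis ι ℂ H) (x : Fock H s)
    (k : Σ N : ℕ, Fin N → ι) : ⟪fockVec s e k, x⟫_ℂ = ⟪tupleVec s e k, x k.1⟫_ℂ :=
  lp.inner_single_left _ _ _

theorem fockVec_self (s : ℤˣ) (e : HilbertBasis ι ℂ H) (k : Σ N : ℕ, Fin N → ι) :
    fockVec s e k k.1 = tupleVec s e k :=
  lp.single_apply_self 2 k.1 _

theorem norm_fockVec (s : ℤˣ) (e : HilbertBasis ι ℂ H) (k : Σ N : ℕ, Fin N → ι) :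
    ‖fockVec s e k‖ = ‖tupleVec s e k‖ :=
  lp.norm_single (by norm_num) _ _

/-- The bridge from Fock space to finite matrices: the eigenvalues in the weight multiply the rows
of the immanant. -/
theorem sum_weight_inner (s : ℤˣ) (e : HilbertBasis ι ℂ H) (l : ι → ℝ) (A : H →L[ℂ] H)
    (I : Finset ι) (N : ℕ) :
    ∑ i : Fin N → I, (weight l (tupleIncl I ⟨N, i⟩) : ℂ) *
      ⟪tupleVec s e (tupleIncl I ⟨N, i⟩), sectorPow s A N (tupleVec s e (tupleIncl I ⟨N, i⟩))⟫_ℂ =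
    symTrace s (Matrix.of fun a b : I => (l a : ℂ) * ⟪e a, A (e b)⟫_ℂ) N := by
  rw [symTrace, immTrace, Finset.sum_div]
  refine Finset.sum_congr rfl fun i _ => ?_
  have h := inner_symVec_sectorPow s A (fun j => e (i j)) (fun j => e (i j))
  refine (congrArg (fun z => (weight l (tupleIncl I ⟨N, i⟩) : ℂ) * z) h).trans ?_
  rw [← mul_div_assoc, imm, imm, Finset.mul_sum]
  congr 1
  refine Finset.sum_congr rfl fun π _ => ?_
  simp only [weight, tupleIncl, Matrix.submatrix_apply, Matrix.of_apply, Finset.prod_mul_distrib,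
    Complex.ofReal_prod]
  exact mul_left_comm _ _ _

theorem sectorPow_one (s : ℤˣ) (N : ℕ) : sectorPow s (1 : H →L[ℂ] H) N = 1 := by
  ext ψ
  rw [coe_sectorPow, tensorOp_one]; rfl

theorem sum_weight_norm_sq (s : ℤˣ) (e : HilbertBasis ι ℂ H) (l : ι → ℝ)
    (I : Finset ι) [DecidableEq I] (N : ℕ) :
    ((∑ i : Fin N → I, weight l (tupleIncl I ⟨N, i⟩) * ‖tupleVec s e (tupleIncl I ⟨N, i⟩)‖ ^ 2 : ℝ) : ℂ)
      = symTrace s (Matrix.diagonal fun a : I => (l a : ℂ)) N := by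
  classical
  have h := sum_weight_inner s e l 1 I N
  have e1 : (Matrix.of fun a b : I => (l a : ℂ) * ⟪e a, (1 : H →L[ℂ] H) (e b)⟫_ℂ) =
      Matrix.diagonal fun a : I => (l a : ℂ) := by
    ext a b
    have h1 := orthonormal_iff_ite.1 e.orthonormal a b
    rw [Matrix.of_apply, one_apply_eq_self, h1]
    by_cases hab : a = b
    · subst hab; simp
    · rw [Matrix.diagonal_apply_ne _ hab, if_neg fun h => hab (Subtype.ext h), mul_zero]
  rw [e1] at h
  rw [← h]
  push_cast
  refine Finset.sum_congr rfl fun i _ => ?_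
  rw [sectorPow_one]
  change _ = (weight l (tupleIncl I ⟨N, i⟩) : ℂ) *
    ⟪tupleVec s e (tupleIncl I ⟨N, i⟩), tupleVec s e (tupleIncl I ⟨N, i⟩)⟫_ℂ
  rw [inner_self_eq_norm_sq_to_K]
  rfl

variable {σ : H →L[ℂ] H} {e : HilbertBasis ι ℂ H} {l : ι → ℝ}

theorem IsEigenbasis.weight_nonneg (h : IsEigenbasis σ e l) (k : Σ N : ℕ, Fin N → ι) :
    0 ≤ weight l k := Finset.prod_nonneg fun _ _ => h.nonneg _

/-- Finite sections reduce to `symTrace` of a diagonal matrix. For Bosons `newtonBound` is a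
majorant, summable because `‖σ‖ < 1`. For Fermions all lengths together give `∏ (1 + l_i) ≤ exp (∑
l_i)`. -/
theorem IsEigenbasis.summable_weight (h : IsEigenbasis σ e l) {s : ℤˣ} (hs : s = 1 → ‖σ‖ < 1) :
    Summable fun k => weight l k * ‖tupleVec s e k‖ ^ 2 := by
  classical
  have hp : ∀ I : Finset ι, ∑ i : I, l i ≤ ∑' i, l i := fun I => by
    rw [Finset.sum_coe_sort I l]
    exact h.summable.sum_le_tsum I fun i _ => h.nonneg i
  have hp0 : 0 ≤ ∑' i, l i := tsum_nonneg h.nonneg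
  have hnn : ∀ k, 0 ≤ weight l k * ‖tupleVec s e k‖ ^ 2 := fun k =>
    mul_nonneg (h.weight_nonneg k) (sq_nonneg _)
  rcases Int.units_eq_one_or s with rfl | rfl
  · refine summable_of_tuple_sum_le hnn (C := ∑' N, newtonBound (∑' i, l i) ‖σ‖ N) fun I M => ?_
    have hs := summable_newtonBound hp0 (norm_nonneg σ) (hs rfl)
    refine le_trans (Finset.sum_le_sum fun N _ => ?_)
      (hs.sum_le_tsum _ fun N _ => newtonBound_nonneg hp0 (norm_nonneg σ) N)
    refine le_trans ?_ (symTrace_diagonal_one_bound (fun i : I => l i) (fun i => h.nonneg i)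
      (fun i => h.le_norm i) (norm_nonneg σ) (hp I) 1 N)
    rw [← sum_weight_norm_sq 1 e l I N, Complex.norm_real]
    exact le_abs_self _
  · refine summable_of_tuple_sum_le hnn (C := Real.exp (∑' i, l i)) fun I M => ?_
    have h1 := hasSum_symTrace_neg_one (Matrix.diagonal fun a : I => (l a : ℂ))
    simp only [← sum_weight_norm_sq (-1) e l I] at h1
    have h2 := Complex.hasSum_re h1
    simp only [Complex.ofReal_re] at h2
    refine (sum_le_hasSum _ (fun N _ => Finset.sum_nonneg fun i _ => hnn _) h2).trans ?_
    have e2 : (1 + Matrix.diagonal fun a : I => (l a : ℂ)) =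
        Matrix.diagonal fun a : I => ((1 + l a : ℝ) : ℂ) := by
      rw [← Matrix.diagonal_one, Matrix.diagonal_add]
      push_cast; rfl
    rw [e2, Matrix.det_diagonal, ← Complex.ofReal_prod, Complex.ofReal_re]
    calc ∏ i : I, (1 + l i) ≤ ∏ i : I, Real.exp (l i) := by
          refine Finset.prod_le_prod (fun i _ => by linarith [h.nonneg i]) fun i _ => ?_
          rw [add_comm]; exact Real.add_one_le_exp _
      _ = Real.exp (∑ i : I, l i) := (Real.exp_sum _ _).symm
      _ ≤ _ := Real.exp_le_exp.2 (hp I)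

/-- For Fermions `σ` need not be a contraction. Instead the operator norm in each sector is bounded
by a nuclear norm, which is part of one convergent sum over all tuples. -/
theorem IsEigenbasis.fockBounded (h : IsEigenbasis σ e l) {s : ℤˣ} (hs : s = 1 → ‖σ‖ < 1) :
    FockBounded s σ := by
  have hsum := h.summable_weight hs
  refine ⟨∑' k, weight l k * ‖tupleVec s e k‖ ^ 2, ?_⟩
  rintro _ ⟨N, rfl⟩
  have hinj : Function.Injective fun i : Fin N → ι => (⟨N, i⟩ : Σ N : ℕ, Fin N → ι) :=
    fun i j hij => eq_of_heq (Sigma.mk.inj hij).2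
  have hN := hsum.comp_injective hinj
  have hterm : ∀ i : Fin N → ι, ‖((∏ k, l (i k) : ℝ) : ℂ) • symVec s fun k => e (i k)‖ *
      ‖symVec s fun k => e (i k)‖ = weight l ⟨N, i⟩ * ‖tupleVec s e ⟨N, i⟩‖ ^ 2 := fun i => by
    have h0 : 0 ≤ ∏ k, l (i k) := h.weight_nonneg ⟨N, i⟩
    rw [norm_smul, Complex.norm_real, Real.norm_of_nonneg h0, mul_assoc, ← sq]
    rfl
  have hrep : IsNuclearRep (sectorPow s σ N)
      (fun i : Fin N → ι => ((∏ k, l (i k) : ℝ) : ℂ) • symVec s fun k => e (i k))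
      (fun i => symVec s fun k => e (i k)) :=
    ⟨(summable_congr hterm).2 hN, fun φ ψ => by
      refine (congrArg (fun f => HasSum f _) (funext fun i => ?_)).mpr
        (hasSum_sectorPow e s h.symm h.apply φ ψ)
      exact (congrArg (· * _) (inner_smul_right φ _ _)).trans (mul_assoc _ _ _)⟩
  refine hrep.norm_le.trans ?_
  simp only [hterm]
  exact tsum_comp_le_tsum_of_inj hsum
    (fun k => mul_nonneg (h.weight_nonneg k) (sq_nonneg _)) hinj

theorem IsEigenbasis.gamma_rep (h : IsEigenbasis σ e l) {s : ℤˣ} (hs : s = 1 → ‖σ‖ < 1) :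
    IsNuclearRep (Gamma s σ) (fun k => (weight l k : ℂ) • fockVec s e k) (fockVec s e) := by
  have hsum := h.summable_weight hs
  have hterm : ∀ k, ‖(weight l k : ℂ) • fockVec s e k‖ * ‖fockVec s e k‖ =
      weight l k * ‖tupleVec s e k‖ ^ 2 := fun k => by
    rw [norm_smul, Complex.norm_real, Real.norm_of_nonneg (h.weight_nonneg _), norm_fockVec, sq,
      mul_assoc]
  have hs1 : Summable fun k => ‖(weight l k : ℂ) • fockVec s e k‖ * ‖fockVec s e k‖ := by
    simpa only [hterm] using hsum
  refine ⟨hs1, fun x y => ?_⟩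
  have hS : Summable fun k => ⟪x, (weight l k : ℂ) • fockVec s e k⟫_ℂ * ⟪fockVec s e k, y⟫_ℂ := by
    refine Summable.of_norm_bounded ((hs1.mul_right ‖y‖).mul_left ‖x‖) fun k => ?_
    rw [norm_mul]
    calc _ ≤ (‖x‖ * ‖(weight l k : ℂ) • fockVec s e k‖) * (‖fockVec s e k‖ * ‖y‖) := by
          gcongr <;> exact norm_inner_le_norm _ _
      _ = _ := by ring
  -- Absolute convergence allows the sum over tuples to be evaluated sector by sector.
  refine HasSum.sigma_of_hasSum (lp.hasSum_inner x (Gamma s σ y)) (fun N => ?_) hS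
  rw [Gamma_apply (h.fockBounded hs)]
  have := hasSum_sectorPow e s h.symm h.apply (x N) (y N)
  simp only [inner_smul_right, inner_fockVec_left, inner_fockVec_right, mul_assoc]
  exact this

end Fock

/-! ### ### Nuclear series with nonnegative weights -/

section Positive
variable {E : Type*} [NormedAddCommGroup E] [InnerProductSpace ℂ E]
  {κ : Type*} {A : E →L[ℂ] E} {w : κ → ℝ} {v : κ → E}

theorem IsNuclearRep.nonneg [CompleteSpace E] (h : IsNuclearRep A (fun k => (w k : ℂ) • v k) v) (hw : ∀ k, 0 ≤ w k) :
    0 ≤ A := by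
  rw [ContinuousLinearMap.nonneg_iff_isPositive, ContinuousLinearMap.isPositive_iff_complex]
  intro x
  have h1 := h.hasSum x x
  have h2 : ∀ k, ⟪x, (w k : ℂ) • v k⟫_ℂ * ⟪v k, x⟫_ℂ = ((w k * ‖⟪v k, x⟫_ℂ‖ ^ 2 : ℝ) : ℂ) := by
    intro k
    rw [inner_smul_right, mul_assoc, ← inner_conj_symm, Complex.conj_mul']
    push_cast; rfl
  simp only [h2] at h1
  have h3 := (Complex.hasSum_re h1).nonneg fun k => by
    rw [Complex.ofReal_re]; exact mul_nonneg (hw k) (sq_nonneg _)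
  have h4 := (Complex.hasSum_im h1)
  simp only [Complex.ofReal_im] at h4
  have h5 := h4.unique hasSum_zero
  have h6 : ⟪A x, x⟫_ℂ = ⟪x, A x⟫_ℂ := by
    rw [← inner_conj_symm, Complex.conj_eq_iff_im]; exact h5
  rw [h6]
  exact ⟨Complex.ext (by simp) (by simpa using h5.symm), h3⟩

theorem IsNuclearRep.trace_eq_ofReal [CompleteSpace E] (h : IsNuclearRep A (fun k => (w k : ℂ) • v k) v) :
    trace A = ((∑' k, w k * ‖v k‖ ^ 2 : ℝ) : ℂ) := by
  rw [h.trace_eq, Complex.ofReal_tsum]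
  refine tsum_congr fun k => ?_
  rw [inner_smul_right, inner_self_eq_norm_sq_to_K]
  push_cast; rfl

end Positive
end
end QuasiFree

namespace QuasiFree
open scoped TensorProduct InnerProductSpace ENNReal
open Filter Topology MeasureTheory
attribute [local instance 2000] InnerProductSpace.toInner
noncomputable section

/-! ### The Fredholm determinant -/

section Fredholm
variable {E : Type*} [NormedAddCommGroup E] [InnerProductSpace ℂ E] {ι : Type*}

theorem isNuclearRep_of_eigenbasis {A : E →L[ℂ] E} (e : HilbertBasis ι ℂ E) {c : ι → ℂ}
    (hA : ∀ i, A (e i) = c i • e i) (hc : Summable fun i => ‖c i‖) :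
    IsNuclearRep A (fun i => c i • e i) e := by
  refine ⟨?_, fun x y => ?_⟩
  · simpa [norm_smul, e.orthonormal.1] using hc
  · have h := ((e.hasSum_repr y).mapL A).mapL (innerSL ℂ x)
    simp only [map_smul, hA, innerSL_apply_apply, smul_eq_mul, HilbertBasis.repr_apply_apply] at h
    simpa only [inner_smul_right, mul_comm, mul_left_comm] using h

/-- The principal minor on `T` of the operator `∑ c_i |e_i⟩⟨e_i| K`. -/
def opMinor (e : HilbertBasis ι ℂ E) (c : ι → ℂ) (K : E →L[ℂ] E) (T : Finset ι) : ℂ :=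
  letI := Classical.decEq ι
  (Matrix.of fun a b : T => c a * ⟪e a, K (e b)⟫_ℂ).det

variable (e : HilbertBasis ι ℂ E) {c : ι → ℂ}

theorem norm_opMinor_le (K : E →L[ℂ] E) {C : ℝ} (hK : ‖K‖ ≤ C) (T : Finset ι) :
    ‖opMinor e c K T‖ ≤ ∏ i ∈ T, (‖c i‖ * C) := by
  classical
  have h1 := Matrix.det_mul_column (fun a : T => c a) (Matrix.of fun a b : T => ⟪e a, K (e b)⟫_ℂ)
  have h2 : opMinor e c K T = (∏ a : T, c a) * (Matrix.of fun a b : T => ⟪e a, K (e b)⟫_ℂ).det := by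
    rw [← h1, opMinor]
    congr!
  have h3 := norm_det_le_of_orthonormal (e := fun a : T => e a)
    (e.orthonormal.comp _ Subtype.val_injective) K
  rw [h2, norm_mul, norm_prod, Finset.prod_mul_distrib, Finset.prod_const,
    Finset.prod_coe_sort T fun i => ‖c i‖]
  gcongr
  refine h3.trans ?_
  rw [Fintype.card_coe]
  gcongr

theorem summable_prod_bound (hc : Summable fun i => ‖c i‖) {C : ℝ} (hC : 0 ≤ C) :
    Summable fun T : Finset ι => ∏ i ∈ T, (‖c i‖ * C) :=
  summable_finsetProd_of_summable_nonneg (fun i => by positivity) (hc.mul_right C)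

theorem det_one_add_eq_sum_opMinor (K : E →L[ℂ] E) (I : Finset ι) [DecidableEq I] :
    (1 + Matrix.of fun a b : I => c a * ⟪e a, K (e b)⟫_ℂ).det =
      ∑ T ∈ I.powerset, opMinor e c K T := by
  classical
  rw [det_one_add_eq_sum_minors]
  symm
  refine Finset.sum_bij' (fun T _ => T.subtype (· ∈ I)) (fun T _ => T.map (Function.Embedding.subtype _))
    (fun _ _ => Finset.mem_univ _) (fun T _ => ?_) (fun T hT => ?_) (fun T _ => ?_) (fun T hT => ?_)
  · rw [Finset.mem_powerset]; exact Finset.map_subtype_subset T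
  · exact Finset.subtype_map_of_mem (Finset.mem_powerset.1 hT)
  · ext x; simp
  · have hT' := Finset.mem_powerset.1 hT
    let f : T ≃ T.subtype (· ∈ I) :=
      { toFun := fun x => ⟨⟨x, hT' x.2⟩, Finset.mem_subtype.2 x.2⟩
        invFun := fun x => ⟨x.1, Finset.mem_subtype.1 x.2⟩
        left_inv := fun _ => rfl
        right_inv := fun _ => rfl }
    have := Matrix.det_submatrix_equiv_self f
      ((Matrix.of fun a b : I => c a * ⟪e a, K (e b)⟫_ℂ).submatrix
        (fun x : T.subtype (· ∈ I) => (x : I)) (fun x : T.subtype (· ∈ I) => (x : I)))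
    rw [← this, opMinor]
    congr!

theorem summable_opMinor (hc : Summable fun i => ‖c i‖) (K : E →L[ℂ] E) :
    Summable (opMinor e c K) :=
  Summable.of_norm_bounded (summable_prod_bound hc (norm_nonneg K))
    fun T => norm_opMinor_le e K le_rfl T

open Classical in
theorem tendsto_det_one_add (hc : Summable fun i => ‖c i‖) (K : E →L[ℂ] E) :
    Tendsto (fun I : Finset ι => (1 + Matrix.of fun a b : I => c a * ⟪e a, K (e b)⟫_ℂ).det) atTop
      (𝓝 (∑' T, opMinor e c K T)) := by
  simp only [det_one_add_eq_sum_opMinor]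
  exact (summable_opMinor e hc K).hasSum.comp tendsto_finset_powerset_atTop_atTop

/-- The projection to the span of finitely many basis vectors. -/
def basisProj {ι' : Type*} (f : HilbertBasis ι' ℂ E) (S : Finset ι') : E →L[ℂ] E :=
  ∑ a ∈ S, (innerSL ℂ (f a)).smulRight (f a)

theorem basisProj_apply {ι' : Type*} (f : HilbertBasis ι' ℂ E) (S : Finset ι') (x : E) :
    basisProj f S x = ∑ a ∈ S, ⟪f a, x⟫_ℂ • f a := by
  simp [basisProj]

theorem norm_basisProj_le {ι' : Type*} (f : HilbertBasis ι' ℂ E) (S : Finset ι') :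
    ‖basisProj f S‖ ≤ 1 := by
  refine ContinuousLinearMap.opNorm_le_bound _ zero_le_one fun x => ?_
  rw [one_mul, basisProj_apply]
  have h := f.orthonormal.inner_sum (fun a => ⟪f a, x⟫_ℂ) (fun a => ⟪f a, x⟫_ℂ) S
  rw [inner_self_eq_norm_sq_to_K] at h
  have h1 : ‖∑ a ∈ S, ⟪f a, x⟫_ℂ • f a‖ ^ 2 = ∑ a ∈ S, ‖⟪f a, x⟫_ℂ‖ ^ 2 := by
    simp only [Complex.conj_mul'] at h
    have h' : ((‖∑ a ∈ S, ⟪f a, x⟫_ℂ • f a‖ ^ 2 : ℝ) : ℂ) =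
        ((∑ a ∈ S, ‖⟪f a, x⟫_ℂ‖ ^ 2 : ℝ) : ℂ) := by
      push_cast; exact h
    exact Complex.ofReal_injective h'
  have h2 := f.orthonormal.sum_inner_products_le x (s := S)
  rw [← h1] at h2
  exact (sq_le_sq₀ (norm_nonneg _) (norm_nonneg _)).1 h2

theorem tendsto_basisProj {ι' : Type*} (f : HilbertBasis ι' ℂ E) (x : E) :
    Tendsto (fun S => basisProj f S x) atTop (𝓝 x) := by
  have h := f.hasSum_repr x
  simp only [HilbertBasis.repr_apply_apply] at h
  refine Tendsto.congr (fun S => (basisProj_apply f S x).symm) h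

/-- Change of basis for the Fredholm determinant. The section in the basis `f` is the limit over `I`
of `1 + U V`, and its determinant equals that of `1 + V U`, an `I × I` matrix in the basis `e`;
there the section survives only as the projection to the right of `G`. -/
theorem det_section_eq {ι' : Type*} (f : HilbertBasis ι' ℂ E) (hc : Summable fun i => ‖c i‖)
    {D G : E →L[ℂ] E}
    (hD : ∀ x y, HasSum (fun i => c i * ⟪x, e i⟫_ℂ * ⟪e i, G y⟫_ℂ) ⟪x, D y⟫_ℂ)
    (S : Finset ι') [DecidableEq S] :
    (Matrix.of fun a b : S => ⟪f a, (1 + D) (f b)⟫_ℂ).det =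
      ∑' T, opMinor e c (G * basisProj f S) T := by
  classical
  let U : ∀ I : Finset ι, Matrix S I ℂ := fun I => Matrix.of fun a i => ⟪f a, e i⟫_ℂ
  let V : ∀ I : Finset ι, Matrix I S ℂ := fun I => Matrix.of fun i b => c i * ⟪e i, G (f b)⟫_ℂ
  have h1 : Tendsto (fun I => (1 + U I * V I).det) atTop
      (𝓝 (Matrix.of fun a b : S => ⟪f a, (1 + D) (f b)⟫_ℂ).det) := by
    have hcont : Continuous fun A : Matrix S S ℂ => A.det := continuous_id.matrix_det
    refine (hcont.tendsto _).comp ?_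
    refine tendsto_pi_nhds.2 fun a => tendsto_pi_nhds.2 fun b => ?_
    have e1 : ∀ I, (1 + U I * V I : Matrix S S ℂ) a b = (1 : Matrix S S ℂ) a b +
        ∑ i ∈ I, c i * ⟪f a, e i⟫_ℂ * ⟪e i, G (f b)⟫_ℂ := fun I => by
      rw [Matrix.add_apply, Matrix.mul_apply,
        ← Finset.sum_coe_sort I fun i => c i * ⟪f a, e i⟫_ℂ * ⟪e i, G (f b)⟫_ℂ]
      congr 1
      refine Finset.sum_congr rfl fun i _ => ?_
      simp only [U, V, Matrix.of_apply]
      ring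
    have e2 : (Matrix.of fun a b : S => ⟪f a, (1 + D) (f b)⟫_ℂ) a b =
        (1 : Matrix S S ℂ) a b + ⟪f a, D (f b)⟫_ℂ := by
      rw [Matrix.of_apply, add_apply, inner_add_right, one_apply_eq_self]
      congr 1
      rw [orthonormal_iff_ite.1 f.orthonormal a b, Matrix.one_apply]
      simp only [Subtype.ext_iff]
    rw [e2]
    refine Tendsto.congr (fun I => (e1 I).symm) ?_
    exact (show Tendsto _ _ _ from hD _ _).const_add _
  have h2 := tendsto_det_one_add e hc (G * basisProj f S)
  refine tendsto_nhds_unique h1 (h2.congr fun I => ?_)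
  rw [Matrix.det_one_add_mul_comm]
  congr 2
  ext i j
  simp only [U, V, Matrix.of_apply, Matrix.mul_apply, mul_apply_eq_comp, basisProj_apply, map_sum,
    map_smul, inner_sum, inner_smul_right, Finset.mul_sum]
  rw [← Finset.sum_coe_sort S]
  refine Finset.sum_congr rfl fun a _ => ?_
  ring

/-- The projections converge strongly to `1`, so each minor converges, being a polynomial in
finitely many matrix elements. Their norms are at most `1`, which makes the domination uniform in
`S`. -/
theorem fredholmDet_one_add [CompleteSpace E] (hc : Summable fun i => ‖c i‖) {D G : E →L[ℂ] E}
    (hD : ∀ x y, HasSum (fun i => c i * ⟪x, e i⟫_ℂ * ⟪e i, G y⟫_ℂ) ⟪x, D y⟫_ℂ) :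
    fredholmDet (1 + D) = ∑' T, opMinor e c G T := by
  classical
  refine Tendsto.limUnder_eq ?_
  have h : ∀ S : Finset (onbIndex E),
      Matrix.det (Matrix.of fun i j : S => ⟪onb E i, (1 + D) (onb E j)⟫_ℂ) =
      ∑' T, opMinor e c (G * basisProj (onb E) S) T := fun S => by
    rw [← det_section_eq e (onb E) hc hD S]
  refine Tendsto.congr (fun S => ((by convert h S) : _ = _).symm) ?_
  refine tendsto_tsum_of_dominated_convergence (summable_prod_bound hc (norm_nonneg G))
    (fun T => ?_) (Eventually.of_forall fun S T => norm_opMinor_le e _ ?_ T)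
  · unfold opMinor
    have hcont : Continuous fun A : Matrix T T ℂ => A.det := continuous_id.matrix_det
    refine (Tendsto.comp (hcont.tendsto _) (tendsto_pi_nhds.2 fun a => tendsto_pi_nhds.2 fun b =>
      ?_) : Tendsto _ _ _)
    simp only [Matrix.of_apply, mul_apply_eq_comp]
    refine Tendsto.const_mul _ ?_
    exact ((innerSL ℂ (e a)).continuous.comp G.continuous).tendsto _ |>.comp
      (tendsto_basisProj (onb E) (e b))
  · refine (norm_mul_le _ _).trans ?_
    exact mul_le_of_le_one_right (norm_nonneg _) (norm_basisProj_le _ _)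

end Fredholm
end
end QuasiFree

namespace QuasiFree
open scoped TensorProduct InnerProductSpace ENNReal
open Filter Topology MeasureTheory
attribute [local instance 2000] InnerProductSpace.toInner
noncomputable section

/-! ### Expectations in the quasi-free state -/

section State
universe w
variable {H : Type w} [NormedAddCommGroup H] [InnerProductSpace ℂ H] {ι : Type*}

/-- `tr (Γ_s(σ) Γ_s(M))`, expanded in the eigenbasis of `σ`. -/
def partSum (s : ℤˣ) (e : HilbertBasis ι ℂ H) (l : ι → ℝ) (M : H →L[ℂ] H) : ℂ :=
  ∑' k : Σ N : ℕ, Fin N → ι,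
    (weight l k : ℂ) * ⟪tupleVec s e k, sectorPow s M k.1 (tupleVec s e k)⟫_ℂ

theorem IsTraceClass.exists_isEigenbasis [CompleteSpace H] {σ : H →L[ℂ] H} (hσ : IsTraceClass σ)
    (h0 : 0 ≤ σ) : ∃ (ι : Type w) (e : HilbertBasis ι ℂ H) (l : ι → ℝ), IsEigenbasis σ e l := by
  obtain ⟨ι, e, l, h1, h2, h3, h4⟩ := exists_eigenbasis hσ h0
  exact ⟨ι, e, l, h1, h2, h3, h4,
    ((ContinuousLinearMap.nonneg_iff_isPositive _).1 h0).isSymmetric⟩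

variable {σ M : H →L[ℂ] H} {e : HilbertBasis ι ℂ H} {l : ι → ℝ} {s : ℤˣ}

theorem norm_weight_inner_le (h : IsEigenbasis σ e l) (hM : ‖M‖ ≤ 1) (k : Σ N : ℕ, Fin N → ι) :
    ‖(weight l k : ℂ) * ⟪tupleVec s e k, sectorPow s M k.1 (tupleVec s e k)⟫_ℂ‖ ≤
      weight l k * ‖tupleVec s e k‖ ^ 2 := by
  rw [norm_mul, Complex.norm_real, Real.norm_of_nonneg (h.weight_nonneg k), sq]
  refine mul_le_mul_of_nonneg_left ((norm_inner_le_norm _ _).trans ?_) (h.weight_nonneg k)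
  refine mul_le_mul_of_nonneg_left ?_ (norm_nonneg _)
  exact ((sectorPow s M k.1).le_of_opNorm_le (norm_sectorPow_le_one s hM _) _).trans (one_mul _).le

theorem summable_weight_inner (h : IsEigenbasis σ e l) (hs : s = 1 → ‖σ‖ < 1) (hM : ‖M‖ ≤ 1) :
    Summable fun k : Σ N : ℕ, Fin N → ι =>
      (weight l k : ℂ) * ⟪tupleVec s e k, sectorPow s M k.1 (tupleVec s e k)⟫_ℂ :=
  Summable.of_norm_bounded (h.summable_weight hs) fun k => norm_weight_inner_le h hM k

/-- `partSum` for the compression of `σ` to finitely many eigenvectors. -/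
def partSumFin (s : ℤˣ) (e : HilbertBasis ι ℂ H) (l : ι → ℝ) (M : H →L[ℂ] H) (I : Finset ι) : ℂ :=
  ∑' k, (weight l (tupleIncl I k) : ℂ) * ⟪tupleVec s e (tupleIncl I k),
    sectorPow s M (tupleIncl I k).1 (tupleVec s e (tupleIncl I k))⟫_ℂ

theorem tendsto_partSumFin (h : IsEigenbasis σ e l) (hs : s = 1 → ‖σ‖ < 1) (hM : ‖M‖ ≤ 1) :
    Tendsto (partSumFin s e l M) atTop (𝓝 (partSum s e l M)) :=
  tendsto_tsum_tupleIncl (summable_weight_inner h hs hM)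

theorem hasSum_partSumFin (h : IsEigenbasis σ e l) (hs : s = 1 → ‖σ‖ < 1) (hM : ‖M‖ ≤ 1)
    (I : Finset ι) : HasSum (symTrace s (Matrix.of fun a b : I => (l a : ℂ) * ⟪e a, M (e b)⟫_ℂ))
      (partSumFin s e l M I) := by
  have := hasSum_tsum_tupleIncl (summable_weight_inner h hs hM) I
  simp only [tupleIncl] at this
  refine (congrArg (fun f => HasSum f _) (funext fun N => ?_)).mp this
  exact sum_weight_inner s e l M I N

theorem partSumFin_neg_one [DecidableEq ι] (h : IsEigenbasis σ e l) (hM : ‖M‖ ≤ 1) (I : Finset ι) :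
    partSumFin (-1) e l M I =
      (1 + Matrix.of fun a b : I => (l a : ℂ) * ⟪e a, M (e b)⟫_ℂ).det :=
  (hasSum_partSumFin h (by simp) hM I).unique (hasSum_symTrace_neg_one _)

theorem partSumFin_one_mul [DecidableEq ι] (h : IsEigenbasis σ e l) (hs : ‖σ‖ < 1) (hM : ‖M‖ ≤ 1)
    (I : Finset ι) : partSumFin 1 e l M I *
      (1 - Matrix.of fun a b : I => (l a : ℂ) * ⟪e a, M (e b)⟫_ℂ).det = 1 := by
  have h1 := hasSum_partSumFin h (s := 1) (fun _ => hs) hM I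
  rw [← h1.tsum_eq]
  exact tsum_symTrace_one_mul_det _ h1.summable.norm

theorem IsEigenbasis.one_sub_pos (h : IsEigenbasis σ e l) (hs : s = 1 → ‖σ‖ < 1) (i : ι) :
    0 < 1 - ((s : ℤ) : ℝ) * l i := by
  rcases Int.units_eq_one_or s with rfl | rfl
  · have := (h.le_norm i).trans_lt (hs rfl)
    simpa using this
  · have := h.nonneg i
    simp
    linarith

theorem IsEigenbasis.one_sub_ne_zero (h : IsEigenbasis σ e l) (hs : s = 1 → ‖σ‖ < 1) (i : ι) :
    (1 - ((s : ℤ) : ℂ) * l i) ≠ 0 := by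
  have := (h.one_sub_pos hs i).ne'
  exact_mod_cast this

/-- The coefficients of the operator `-s σ / (1 - s σ)`. -/
def fredholmCoeff (s : ℤˣ) (l : ι → ℝ) (i : ι) : ℂ :=
  -((s : ℤ) : ℂ) * (l i / (1 - ((s : ℤ) : ℂ) * l i))

/-- The finite form of `1 - sσM = (1 - sσ)(1 - s σ̂ (M - 1))`, with the diagonal first factor pulled
out of the rows. -/
theorem det_one_sub_eq [DecidableEq ι] (h : IsEigenbasis σ e l) (hs : s = 1 → ‖σ‖ < 1)
    (M : H →L[ℂ] H) (I : Finset ι) :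
    (1 - ((s : ℤ) : ℂ) • Matrix.of fun a b : I => (l a : ℂ) * ⟪e a, M (e b)⟫_ℂ).det =
      (∏ a : I, (1 - ((s : ℤ) : ℂ) * l a)) *
        (1 + Matrix.of fun a b : I => fredholmCoeff s l a * ⟪e a, (M - 1) (e b)⟫_ℂ).det := by
  rw [← Matrix.det_mul_column]
  congr 1
  ext a b
  have hne := h.one_sub_ne_zero hs a
  have h1 : ⟪e a, e b⟫_ℂ = (1 : Matrix I I ℂ) a b := by
    rw [orthonormal_iff_ite.1 e.orthonormal a b, Matrix.one_apply]
    simp only [Subtype.ext_iff]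
  simp only [Matrix.sub_apply, Matrix.smul_apply, Matrix.of_apply, Matrix.add_apply, smul_eq_mul,
    sub_apply, inner_sub_right, one_apply_eq_self, h1, fredholmCoeff]
  field_simp
  by_cases hab : a = b
  · subst hab; simp; ring
  · simp [Matrix.one_apply_ne hab]

theorem partSumFin_relation [DecidableEq ι] (h : IsEigenbasis σ e l) (hs : s = 1 → ‖σ‖ < 1)
    (hM : ‖M‖ ≤ 1) (I : Finset ι) :
    (s = 1 → partSumFin s e l M I *
      (1 + Matrix.of fun a b : I => fredholmCoeff s l a * ⟪e a, (M - 1) (e b)⟫_ℂ).det =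
        partSumFin s e l 1 I) ∧
    (s = -1 → partSumFin s e l M I = partSumFin s e l 1 I *
      (1 + Matrix.of fun a b : I => fredholmCoeff s l a * ⟪e a, (M - 1) (e b)⟫_ℂ).det) := by
  have hM1 : ‖(1 : H →L[ℂ] H)‖ ≤ 1 := ContinuousLinearMap.norm_id_le
  have hd := det_one_sub_eq h hs M I
  have hd1 := det_one_sub_eq h hs 1 I
  have h0 : (1 + Matrix.of fun a b : I => fredholmCoeff s l a * ⟪e a, ((1 : H →L[ℂ] H) - 1) (e b)⟫_ℂ) =
      (1 : Matrix I I ℂ) := by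
    ext a b; simp
  rw [h0, Matrix.det_one, mul_one] at hd1
  have hπ : (∏ a : I, (1 - ((s : ℤ) : ℂ) * l a)) ≠ 0 :=
    Finset.prod_ne_zero_iff.2 fun a _ => h.one_sub_ne_zero hs a
  constructor
  · rintro rfl
    have hM' := partSumFin_one_mul h (hs rfl) hM I
    have h1' := partSumFin_one_mul h (hs rfl) hM1 I
    simp only [Units.val_one, Int.cast_one, one_smul] at hd hd1
    rw [hd] at hM'
    rw [hd1] at h1'
    simp only [Units.val_one, Int.cast_one] at hπ
    refine mul_right_cancel₀ hπ ?_
    rw [mul_assoc, mul_comm (Matrix.det _)]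
    exact hM'.trans h1'.symm
  · rintro rfl
    rw [partSumFin_neg_one h hM, partSumFin_neg_one h hM1]
    simp only [Units.val_neg, Units.val_one, Int.cast_neg, Int.cast_one, neg_smul, one_smul,
      sub_neg_eq_add] at hd hd1
    rw [hd, hd1]

theorem summable_fredholmCoeff (h : IsEigenbasis σ e l) (hs : s = 1 → ‖σ‖ < 1) :
    Summable fun i => ‖fredholmCoeff s l i‖ := by
  have h1 : ∀ i, ‖fredholmCoeff s l i‖ = l i / (1 - ((s : ℤ) : ℝ) * l i) := fun i => by
    have hpos := h.one_sub_pos hs i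
    have e1 : ‖((s : ℤ) : ℂ)‖ = 1 := by
      rcases Int.units_eq_one_or s with rfl | rfl <;> simp
    have e2 : (l i / (1 - ((s : ℤ) : ℂ) * l i) : ℂ) = ((l i / (1 - ((s : ℤ) : ℝ) * l i) : ℝ) : ℂ) := by
      push_cast; rfl
    rw [fredholmCoeff, norm_mul, norm_neg, e1, one_mul, e2, Complex.norm_real,
      Real.norm_of_nonneg (div_nonneg (h.nonneg i) hpos.le)]
  simp only [h1]
  -- A gap uniform in `i`, namely `1 - ‖σ‖` for Bosons and `1` for Fermions, reduces the claim to
  -- summability of the eigenvalues.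
  obtain ⟨δ, hδ, hb⟩ : ∃ δ > 0, ∀ i, δ ≤ 1 - ((s : ℤ) : ℝ) * l i := by
    rcases Int.units_eq_one_or s with rfl | rfl
    · refine ⟨1 - ‖σ‖, sub_pos.2 (hs rfl), fun i => ?_⟩
      have := h.le_norm i
      simp only [Units.val_one, Int.cast_one, one_mul]
      linarith
    · refine ⟨1, one_pos, fun i => ?_⟩
      have := h.nonneg i
      simp
      linarith
  refine Summable.of_nonneg_of_le (fun i => div_nonneg (h.nonneg i) (h.one_sub_pos hs i).le)
    (fun i => ?_) (h.summable.div_const δ)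
  exact div_le_div_of_nonneg_left (h.nonneg i) hδ (hb i)

/-- Limit of the relations for finite `I`. The Bose relation is kept as a product, so that the limit
does not presuppose a nonvanishing determinant. -/
theorem partSum_relation (h : IsEigenbasis σ e l) (hs : s = 1 → ‖σ‖ < 1) (hM : ‖M‖ ≤ 1) :
    (s = 1 → partSum s e l M * ∑' T, opMinor e (fredholmCoeff s l) (M - 1) T = partSum s e l 1) ∧
    (s = -1 → partSum s e l M =
      partSum s e l 1 * ∑' T, opMinor e (fredholmCoeff s l) (M - 1) T) := by
  classical
  have hM1 : ‖(1 : H →L[ℂ] H)‖ ≤ 1 := ContinuousLinearMap.norm_id_le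
  have hd := tendsto_det_one_add e (summable_fredholmCoeff h hs) (M - 1)
  have tM := tendsto_partSumFin h hs hM
  have t1 := tendsto_partSumFin h hs hM1
  constructor
  · intro h1
    refine tendsto_nhds_unique ((tM.mul hd).congr fun I => ?_) t1
    convert (partSumFin_relation h hs hM I).1 h1
  · intro h1
    refine tendsto_nhds_unique tM ((t1.mul hd).congr fun I => ?_)
    convert ((partSumFin_relation h hs hM I).2 h1).symm

/-- `tr Γ_s(σ)`, as a real number. -/
def partFun (s : ℤˣ) (e : HilbertBasis ι ℂ H) (l : ι → ℝ) : ℝ :=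
  ∑' k : Σ N : ℕ, Fin N → ι, weight l k * ‖tupleVec s e k‖ ^ 2

theorem partSum_one (s : ℤˣ) (e : HilbertBasis ι ℂ H) (l : ι → ℝ) :
    partSum s e l 1 = partFun s e l := by
  rw [partSum, partFun, Complex.ofReal_tsum]
  refine tsum_congr fun k => ?_
  rw [sectorPow_one, one_apply_eq_self, inner_self_eq_norm_sq_to_K]
  push_cast; rfl

theorem trace_gamma (h : IsEigenbasis σ e l) (hs : s = 1 → ‖σ‖ < 1) :
    trace (Gamma s σ) = partFun s e l := by
  rw [(h.gamma_rep hs).trace_eq_ofReal]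
  simp only [norm_fockVec, partFun]

/-- The vacuum, i.e. the empty tuple, contributes `1`. -/
theorem partFun_pos (h : IsEigenbasis σ e l) (hs : s = 1 → ‖σ‖ < 1) : 0 < partFun s e l := by
  have h1 := h.summable_weight hs
  refine h1.tsum_pos (fun k => mul_nonneg (h.weight_nonneg k) (sq_nonneg _)) ⟨0, Fin.elim0⟩ ?_
  have h2 : (symVec s (Fin.elim0 : Fin 0 → H) : Tensor H 0) = prodVec Fin.elim0 := by
    rw [coe_symVec]
    simp [statC, statSign]
  have h3 : ‖tupleVec s e (⟨0, Fin.elim0⟩ : Σ N : ℕ, Fin N → ι)‖ = 1 := by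
    change ‖symVec s fun j : Fin 0 => e (Fin.elim0 j)‖ = 1
    rw [Subsingleton.elim (fun j : Fin 0 => e (Fin.elim0 j)) Fin.elim0]
    change ‖(symVec s (Fin.elim0 : Fin 0 → H) : Tensor H 0)‖ = 1
    rw [h2, norm_prodVec]
    simp
  rw [h3]
  simp [weight]

theorem quasiFree_rep (h : IsEigenbasis σ e l) (hs : s = 1 → ‖σ‖ < 1) :
    IsNuclearRep (quasiFree s σ)
      (fun k => (((partFun s e l)⁻¹ * weight l k : ℝ) : ℂ) • fockVec s e k) (fockVec s e) := by
  have := (h.gamma_rep hs).smul (trace (Gamma s σ))⁻¹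
  rw [trace_gamma h hs] at this
  rw [quasiFree, trace_gamma h hs]
  simpa only [smul_smul, Complex.ofReal_mul, Complex.ofReal_inv] using this

theorem quasiFree_nonneg (h : IsEigenbasis σ e l) (hs : s = 1 → ‖σ‖ < 1) : 0 ≤ quasiFree s σ :=
  (quasiFree_rep h hs).nonneg fun k =>
    mul_nonneg (inv_nonneg.2 (partFun_pos h hs).le) (h.weight_nonneg k)

theorem trace_quasiFree (h : IsEigenbasis σ e l) (hs : s = 1 → ‖σ‖ < 1) :
    trace (quasiFree s σ) = 1 := by
  rw [(quasiFree_rep h hs).trace_eq_ofReal]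
  simp only [norm_fockVec, mul_assoc, tsum_mul_left]
  rw [← partFun, inv_mul_cancel₀ (partFun_pos h hs).ne', Complex.ofReal_one]

theorem trace_quasiFree_mul (h : IsEigenbasis σ e l) (hs : s = 1 → ‖σ‖ < 1)
    (B : Fock H s →L[ℂ] Fock H s) : trace (quasiFree s σ * B) =
      ((partFun s e l : ℝ) : ℂ)⁻¹ * ∑' k, (weight l k : ℂ) * ⟪fockVec s e k, B (fockVec s e k)⟫_ℂ := by
  rw [((quasiFree_rep h hs).mul_right B).trace_eq, ← tsum_mul_left]
  refine tsum_congr fun k => ?_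
  rw [ContinuousLinearMap.adjoint_inner_left, map_smul, inner_smul_right]
  push_cast
  ring

theorem trace_quasiFree_mul_gamma (h : IsEigenbasis σ e l) (hs : s = 1 → ‖σ‖ < 1) (hM : ‖M‖ ≤ 1) :
    trace (quasiFree s σ * Gamma s M) = ((partFun s e l : ℝ) : ℂ)⁻¹ * partSum s e l M := by
  rw [trace_quasiFree_mul h hs]
  congr 1
  refine tsum_congr fun k => ?_
  rw [inner_fockVec_left, Gamma_apply (fockBounded_of_norm_le_one s hM), fockVec_self]

theorem trace_quasiFree_fockTensorOp (h : IsEigenbasis σ e l) (hs : s = 1 → ‖σ‖ < 1) {N : ℕ}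
    (T : Fin N → H →L[ℂ] H) : trace (quasiFree s σ ∘L fockTensorOp s T) =
      ((partFun s e l : ℝ) : ℂ)⁻¹ * ∑' i : Fin N → ι, (weight l ⟨N, i⟩ : ℂ) *
        ⟪(tupleVec s e ⟨N, i⟩ : Tensor H N), tensorOp T (tupleVec s e ⟨N, i⟩ : Tensor H N)⟫_ℂ := by
  have hinj : Function.Injective fun i : Fin N → ι => (⟨N, i⟩ : Σ N : ℕ, Fin N → ι) :=
    fun i j hij => eq_of_heq (Sigma.mk.inj hij).2
  have hop : ∀ x : Fock H s, fockTensorOp s T x =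
      lp.single 2 N (sectorCompress s (tensorOp T) (x N)) := fun x => rfl
  refine (trace_quasiFree_mul h hs (fockTensorOp s T)).trans ?_
  congr 1
  rw [← hinj.tsum_eq (f := fun k => (weight l k : ℂ) *
    ⟪fockVec s e k, fockTensorOp s T (fockVec s e k)⟫_ℂ)]
  · refine tsum_congr fun i => ?_
    congr 1
    rw [hop, lp.inner_single_right]
    have h1 : fockVec s e ⟨N, i⟩ N = tupleVec s e ⟨N, i⟩ := fockVec_self s e ⟨N, i⟩
    rw [h1]
    exact Submodule.inner_orthogonalProjectionOnto_eq_of_mem_left _ _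
  -- Tuples of any other length than `N` contribute nothing.
  · intro k hk
    rw [Function.mem_support] at hk
    by_contra hN
    have hne : k.1 ≠ N := by
      rintro rfl
      exact hN ⟨k.2, rfl⟩
    have h1 : fockVec s e k N = 0 := lp.single_apply_ne 2 k.1 _ hne.symm
    exact hk (by rw [hop, h1, map_zero, lp.single_zero, inner_zero_right, mul_zero])

variable [CompleteSpace H]

/-- A Neumann series for Bosons; for Fermions `1 + σ ≥ 1`. -/
theorem isUnit_one_sub (h0 : 0 ≤ σ) (hs : s = 1 → ‖σ‖ < 1) : IsUnit (1 - ((s : ℤ) : ℂ) • σ) := by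
  rcases Int.units_eq_one_or s with rfl | rfl
  · simpa using isUnit_one_sub_of_norm_lt_one (hs rfl)
  · have := isUnit_add_of_nonneg h0 one_pos
    simpa [add_comm] using this

theorem hatOp_apply (h : IsEigenbasis σ e l) (h0 : 0 ≤ σ) (hs : s = 1 → ‖σ‖ < 1) (i : ι) :
    hatOp s σ (e i) = ((l i / (1 - ((s : ℤ) : ℂ) * l i) : ℂ)) • e i := by
  have hne := h.one_sub_ne_zero hs i
  have h1 : (1 - ((s : ℤ) : ℂ) • σ) (e i) = (1 - ((s : ℤ) : ℂ) * l i) • e i := by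
    rw [sub_apply, smul_apply, h.apply, smul_smul, sub_smul, one_apply_eq_self, one_smul]
  have h2 := congrArg (fun T : H →L[ℂ] H => T (e i))
    (Ring.inverse_mul_cancel _ (isUnit_one_sub (s := s) h0 hs))
  simp only [mul_apply_eq_comp, h1, map_smul, one_apply_eq_self] at h2
  have h3 : Ring.inverse (1 - ((s : ℤ) : ℂ) • σ) (e i) = (1 - ((s : ℤ) : ℂ) * l i)⁻¹ • e i := by
    rw [← h2, smul_smul, inv_mul_cancel₀ hne, one_smul]
    simp [h2]
  rw [hatOp, mul_apply_eq_comp, h3, map_smul, h.apply, smul_smul, div_eq_inv_mul]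

theorem fredholmOp_rep (h : IsEigenbasis σ e l) (h0 : 0 ≤ σ) (hs : s = 1 → ‖σ‖ < 1) (G : H →L[ℂ] H) :
    IsNuclearRep (-(((s : ℤ) : ℂ)) • (hatOp s σ * G)) (fun i => fredholmCoeff s l i • e i)
      (fun i => ContinuousLinearMap.adjoint G (e i)) := by
  have h1 := isNuclearRep_of_eigenbasis (A := -(((s : ℤ) : ℂ)) • hatOp s σ) e
    (c := fredholmCoeff s l) (fun i => by
      rw [smul_apply, hatOp_apply h h0 hs, smul_smul, fredholmCoeff]) (summable_fredholmCoeff h hs)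
  simpa only [smul_mul_assoc] using h1.mul_right G

theorem isTraceClass_hatOp_mul (h : IsEigenbasis σ e l) (h0 : 0 ≤ σ) (hs : s = 1 → ‖σ‖ < 1)
    (G : H →L[ℂ] H) : IsTraceClass (hatOp s σ * G) := by
  have h1 := (fredholmOp_rep h h0 hs G).smul (-((s : ℤ) : ℂ))
  rw [smul_smul] at h1
  have e1 : -((s : ℤ) : ℂ) * -((s : ℤ) : ℂ) = 1 := by
    rcases Int.units_eq_one_or s with rfl | rfl <;> simp
  rw [e1, one_smul] at h1
  exact h1.isTraceClass

theorem fredholmDet_eq (h : IsEigenbasis σ e l) (h0 : 0 ≤ σ) (hs : s = 1 → ‖σ‖ < 1) (G : H →L[ℂ] H) :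
    fredholmDet (1 - ((s : ℤ) : ℂ) • (hatOp s σ * G)) = ∑' T, opMinor e (fredholmCoeff s l) G T := by
  rw [sub_eq_add_neg, ← neg_smul]
  refine fredholmDet_one_add e (summable_fredholmCoeff h hs) fun x y => ?_
  have := (fredholmOp_rep h h0 hs G).hasSum x y
  simpa only [inner_smul_right, ContinuousLinearMap.adjoint_inner_left] using this

/-! ### The quasi-free state -/

theorem trace_eq_fredholmDet (h : IsEigenbasis σ e l) (h0 : 0 ≤ σ) (hs : s = 1 → ‖σ‖ < 1)
    (hM : ‖M‖ ≤ 1) :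
    (s = 1 → fredholmDet (1 - ((s : ℤ) : ℂ) • (hatOp s σ * (M - 1))) ≠ 0) ∧
    trace (quasiFree s σ * Gamma s M) =
      fredholmDet (1 - ((s : ℤ) : ℂ) • (hatOp s σ * (M - 1))) ^ (-(s : ℤ)) := by
  have hZ : ((partFun s e l : ℝ) : ℂ) ≠ 0 := by exact_mod_cast (partFun_pos h hs).ne'
  have hrel := partSum_relation h hs hM
  rw [partSum_one s e l] at hrel
  rw [trace_quasiFree_mul_gamma h hs hM, fredholmDet_eq h h0 hs]
  set d := ∑' T, opMinor e (fredholmCoeff s l) (M - 1) T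
  rcases Int.units_eq_one_or s with hs1 | hs1
  · have h1 := hrel.1 hs1
    -- The determinant cannot vanish, since its product with a trace is `tr Γ_s(σ)`, which is
    -- positive.
    have hd : d ≠ 0 := fun h2 => hZ (by rw [← h1, h2, mul_zero])
    refine ⟨fun _ => hd, ?_⟩
    have e1 : (-((s : ℤˣ) : ℤ)) = -1 := by rw [hs1]; rfl
    rw [e1, zpow_neg_one, ← h1]
    field_simp
    rw [div_self]
    exact fun h2 => hZ (by rw [← h1, h2, zero_mul])
  · have h1 := hrel.2 hs1
    refine ⟨fun h2 => absurd (h2.symm.trans hs1) (by decide), ?_⟩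
    have e1 : (-((s : ℤˣ) : ℤ)) = 1 := by rw [hs1]; rfl
    rw [e1, zpow_one, h1, inv_mul_cancel_left₀ hZ]

end State
end
end QuasiFree

namespace QuasiFree
open scoped TensorProduct InnerProductSpace ENNReal
open Filter Topology MeasureTheory
attribute [local instance 2000] InnerProductSpace.toInner
noncomputable section

/-! ### ### Positive semidefinite kernels as Gram matrices -/

section Gram

-- A positive semidefinite matrix is `B* B`, and the columns of `B` are the vectors.
open scoped ComplexOrder MatrixOrder in
theorem exists_gram {J : Type*} [Fintype J] (A : J → J → ℂ)
    (h : ∀ c : J → ℂ, 0 ≤ ∑ i, ∑ j, (starRingEnd ℂ) (c i) * c j * A i j) :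
    ∃ w : J → EuclideanSpace ℂ J, ∀ i j, A i j = ⟪w i, w j⟫_ℂ := by
  classical
  have hp : (Matrix.of A).PosSemidef := by
    rw [← Matrix.isPositive_toEuclideanLin_iff, LinearMap.isPositive_iff_complex]
    intro x
    have e : ⟪Matrix.toEuclideanLin (Matrix.of A) x, x⟫_ℂ =
        (starRingEnd ℂ) (∑ i, ∑ j, (starRingEnd ℂ) (x i) * x j * A i j) := by
      rw [← inner_conj_symm]
      congr 1
      simp only [PiLp.inner_apply, Matrix.toLpLin_apply, Matrix.mulVec, dotProduct,
        Matrix.of_apply, RCLike.inner_apply, Finset.sum_mul]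
      refine Finset.sum_congr rfl fun i _ => Finset.sum_congr rfl fun j _ => by ring
    have h0 := h x
    rw [Complex.le_def] at h0
    rw [e]
    generalize ∑ i, ∑ j, (starRingEnd ℂ) (x i) * x j * A i j = z at h0
    simp only [RCLike.re_to_complex, Complex.conj_re]
    refine ⟨Complex.ext (by simp) ?_, h0.1⟩
    rw [Complex.conj_im, ← h0.2]
    simp
  obtain ⟨B, hB⟩ := CStarAlgebra.nonneg_iff_eq_star_mul_self.mp hp.nonneg
  refine ⟨fun i => WithLp.toLp 2 fun k => B k i, fun i j => ?_⟩
  have := congrFun (congrFun hB i) j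
  rw [Matrix.of_apply, Matrix.mul_apply] at this
  rw [this]
  simp only [PiLp.inner_apply, RCLike.inner_apply, Matrix.star_apply, RCLike.star_def]
  exact Finset.sum_congr rfl fun k _ => mul_comm _ _

end Gram

/-! ### ### Integrals against an observable, and the no-click outcome -/

section Observables
universe w
variable {Y : Type*} [MeasurableSpace Y] {H : Type w} [NormedAddCommGroup H]
  [InnerProductSpace ℂ H]

theorem eq_of_inner_self {S T : H →L[ℂ] H} (h : ∀ ψ, ⟪ψ, S ψ⟫_ℂ = ⟪ψ, T ψ⟫_ℂ) : S = T := by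
  have := (ext_inner_map (S : H →ₗ[ℂ] H) (T : H →ₗ[ℂ] H)).1 fun x => by
    rw [← inner_conj_symm, ← inner_conj_symm (_ : H) x]
    exact congrArg _ (h x)
  exact ContinuousLinearMap.coe_injective this

/-- Integrals against an observable are specified by quadratic forms only; this recovers the
off-diagonal matrix elements. -/
theorem polarization (T : H →L[ℂ] H) (φ ψ : H) :
    ⟪φ, T ψ⟫_ℂ = 4⁻¹ * ∑ k : Fin 4, (starRingEnd ℂ) (Complex.I ^ (k : ℕ)) *
      ⟪φ + Complex.I ^ (k : ℕ) • ψ, T (φ + Complex.I ^ (k : ℕ) • ψ)⟫_ℂ := by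
  simp only [Fin.sum_univ_four, map_add, inner_add_left, inner_add_right, map_smul,
    inner_smul_left, inner_smul_right, map_pow, Complex.conj_I]
  norm_num [Complex.I_sq, pow_succ, mul_assoc, Complex.I_mul_I]
  ring_nf
  norm_num [Complex.I_sq, Complex.I_pow_four, Complex.I_pow_three]
  ring

variable [CompleteSpace H]

theorem POVM.integral_indicator (E : POVM Y H) {B : Set Y} (hB : MeasurableSet B) :
    E.integral (B.indicator 1) = E B :=
  eq_of_inner_self fun ψ => by
    rw [E.inner_integral (measurable_one.indicator hB) (C := 1) (fun x => by
      by_cases h : x ∈ B <;> simp [h]), ← E.measure_real ψ hB, MeasureTheory.integral_indicator hB]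
    simp

theorem POVM.integral_one (E : POVM Y H) : E.integral (fun _ => 1) = E Set.univ := by
  have := E.integral_indicator MeasurableSet.univ
  rwa [Set.indicator_univ] at this

theorem POVM.integral_sub_one (E : POVM Y H) {g : Y → ℂ} (hg : Measurable g) {C : ℝ}
    (hC : ∀ y, ‖g y‖ ≤ C) : E.integral (fun y => g y - 1) = E.integral g - E Set.univ :=
  eq_of_inner_self fun ψ => by
    rw [E.inner_integral (g := fun y => g y - 1) (hg.sub measurable_const) (C := C + 1) (fun y =>
        (norm_sub_le _ _).trans (by simpa using hC y)), sub_apply, inner_sub_right,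
      E.inner_integral hg hC, ← E.measure_real ψ MeasurableSet.univ, integral_sub _ (integrable_const _)]
    · simp
    · exact (integrable_const C).mono' hg.aestronglyMeasurable (ae_of_all _ hC)

theorem POVM.effect_inl_inr (F : POVM Y H) (ψ : H) (B : Set (Y ⊕ Unit)) :
    F.effect B ψ = F (Sum.inl ⁻¹' B) ψ + B.indicator (fun _ => ψ - F Set.univ ψ) (Sum.inr ()) := by
  rw [POVM.effect, add_apply]
  by_cases h : Sum.inr () ∈ B <;> simp [h]

/-- The observable with the additional outcome `Sum.inr ()` for particles which are not
registered. -/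
def POVM.plus (F : POVM Y H) : POVM (Y ⊕ Unit) H where
  toFun := F.effect
  nonneg B hB := by
    refine add_nonneg (F.nonneg _ (measurable_inl hB)) ?_
    by_cases h : Sum.inr () ∈ B <;> simp [h, F.univ_le_one]
  univ_le_one := by simp [POVM.effect]
  hasSum B hB hd ψ := by
    simp only [F.effect_inl_inr, Set.preimage_iUnion]
    refine (F.hasSum _ (fun n => measurable_inl (hB n))
      (fun i j hij => (hd hij).preimage _) ψ).add ?_
    by_cases h : ∃ n, Sum.inr () ∈ B n
    · obtain ⟨n, hn⟩ := h
      rw [Set.indicator_of_mem (Set.mem_iUnion.2 ⟨n, hn⟩)]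
      convert hasSum_single n fun m hm => ?_
      · rw [Set.indicator_of_mem hn]
      · exact Set.indicator_of_notMem (fun h => (hd hm).le_bot ⟨h, hn⟩) _
    · rw [Set.indicator_of_notMem (by simpa using h)]
      push Not at h
      simp only [Set.indicator_of_notMem (h _)]
      exact hasSum_zero

theorem POVM.plus_apply (F : POVM Y H) (B : Set (Y ⊕ Unit)) : F.plus B = F.effect B := rfl

theorem POVM.plus_univ (F : POVM Y H) : F.plus Set.univ = 1 := by
  simp [F.plus_apply, POVM.effect]

theorem POVM.plus_measure (F : POVM Y H) (ψ : H) : F.plus.measure ψ =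
    (F.measure ψ).map Sum.inl +
      ENNReal.ofReal (⟪ψ, (1 - F Set.univ) ψ⟫_ℂ).re • Measure.dirac (Sum.inr ()) := by
  ext B hB
  have h0 : 0 ≤ (⟪ψ, (1 - F Set.univ) ψ⟫_ℂ).re :=
    ((ContinuousLinearMap.nonneg_iff_isPositive _).1 (sub_nonneg.2 F.univ_le_one)).re_inner_nonneg_right ψ
  rw [F.plus.measure_apply ψ hB, Measure.add_apply, Measure.map_apply measurable_inl hB,
    F.measure_apply ψ (measurable_inl hB), Measure.smul_apply, Measure.dirac_apply' _ hB,
    F.plus_apply, F.effect_inl_inr, inner_add_right, Complex.add_re]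
  by_cases h : Sum.inr () ∈ B
  · simp only [Set.indicator_of_mem h, Pi.one_apply, smul_eq_mul, mul_one]
    exact ENNReal.ofReal_add (F.inner_eq (measurable_inl hB) ψ).1 h0
  · simp [h]

open scoped ComplexOrder in
theorem POVM.plus_integral (F : POVM Y H) {g : Y → ℂ} (hg : Measurable g) {C : ℝ}
    (hC : ∀ y, ‖g y‖ ≤ C) :
    F.plus.integral (Sum.elim g fun _ => 1) = F.integral g + (1 - F Set.univ) :=
  eq_of_inner_self fun ψ => by
    have hm : Measurable (Sum.elim g fun _ : Unit => (1 : ℂ)) := hg.sumElim measurable_const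
    have hb : ∀ y, ‖(Sum.elim g fun _ : Unit => (1 : ℂ)) y‖ ≤ max C 1 := by
      rintro (y | y)
      · exact (hC y).trans (le_max_left _ _)
      · simp
    have hi : ∀ (μ : Measure (Y ⊕ Unit)) [IsFiniteMeasure μ],
        Integrable (Sum.elim g fun _ : Unit => (1 : ℂ)) μ := fun μ _ =>
      (integrable_const (max C 1)).mono' hm.aestronglyMeasurable (ae_of_all _ hb)
    have h0 : (0 : H →L[ℂ] H) ≤ 1 - F Set.univ := sub_nonneg.2 F.univ_le_one
    have h1 : (0 : ℂ) ≤ ⟪ψ, (1 - F Set.univ) ψ⟫_ℂ :=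
      ((ContinuousLinearMap.nonneg_iff_isPositive _).1 h0).inner_nonneg_right ψ
    have h2 : 0 ≤ (⟪ψ, (1 - F Set.univ) ψ⟫_ℂ).re :=
      ((ContinuousLinearMap.nonneg_iff_isPositive _).1 h0).re_inner_nonneg_right ψ
    have h3 : IsFiniteMeasure (ENNReal.ofReal (⟪ψ, (1 - F Set.univ) ψ⟫_ℂ).re •
        Measure.dirac (Sum.inr () : Y ⊕ Unit)) := Measure.smul_finite _ ENNReal.ofReal_ne_top
    rw [F.plus.inner_integral hm hb, F.plus_measure, integral_add_measure (hi _) (hi _),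
      integral_map measurable_inl.aemeasurable hm.aestronglyMeasurable, integral_smul_measure,
      integral_dirac' _ _ hm.stronglyMeasurable, add_apply, inner_add_right, F.inner_integral hg hC]
    simp only [Sum.elim_inl, Sum.elim_inr, ENNReal.toReal_ofReal h2, Complex.real_smul, mul_one]
    congr 1
    rw [Complex.le_def] at h1
    exact Complex.ext (by simp) (by simpa using h1.2)

end Observables
end
end QuasiFree

namespace QuasiFree
open scoped TensorProduct InnerProductSpace ENNReal
open Filter Topology MeasureTheory
attribute [local instance 2000] InnerProductSpace.toInner
noncomputable section

/-! ### ### Joint densities of the matrix elements of an observable -/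

section Density
universe w
variable {Y : Type*} [MeasurableSpace Y] {H : Type w} [NormedAddCommGroup H]
  [InnerProductSpace ℂ H]

open scoped ComplexOrder in
theorem ae_nonneg_of_forall_setIntegral {ν : Measure Y} {h : Y → ℂ} (hi : Integrable h ν)
    (h0 : ∀ B, MeasurableSet B → 0 ≤ ∫ y in B, h y ∂ν) : ∀ᵐ y ∂ν, 0 ≤ h y := by
  have hre : ∀ B, ∫ y in B, (h y).re ∂ν = (∫ y in B, h y ∂ν).re := fun B =>
    integral_re hi.integrableOn
  have him : ∀ B, ∫ y in B, (h y).im ∂ν = (∫ y in B, h y ∂ν).im := fun B =>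
    integral_im hi.integrableOn
  have h1 := ae_nonneg_of_forall_setIntegral_nonneg hi.re fun B hB _ =>
    (Complex.le_def.1 (h0 B hB)).1.trans_eq (hre B).symm
  have h2 := ae_nonneg_of_forall_setIntegral_nonneg hi.im fun B hB _ =>
    ((Complex.le_def.1 (h0 B hB)).2.trans (him B).symm).le
  have h3 := ae_nonneg_of_forall_setIntegral_nonneg hi.im.neg fun B hB _ => by
    have := (Complex.le_def.1 (h0 B hB)).2.trans (him B).symm
    simp only [Pi.neg_apply]
    rw [integral_neg]
    exact (neg_eq_zero.2 this.symm).ge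
  filter_upwards [h1, h2, h3] with y hy1 hy2 hy3
  refine Complex.le_def.2 ⟨hy1, le_antisymm hy2 ?_⟩
  simpa using hy3

variable [CompleteSpace H]

open scoped ComplexOrder in
/-- The matrix elements of an observable in finitely many vectors have a joint density, which is a
Gram matrix at every point. -/
theorem POVM.exists_density (E : POVM Y H) {J : Type*} [Fintype J] (x : J → H) :
    ∃ (ν : Measure Y) (m : J → J → Y → ℂ) (w : Y → J → EuclideanSpace ℂ J), IsFiniteMeasure ν ∧
      (∀ i j, Measurable (m i j)) ∧ (∀ i j, Integrable (m i j) ν) ∧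
      (∀ i j y, m i j y = ⟪w y i, w y j⟫_ℂ) ∧
      ∀ i j (g : Y → ℂ), Measurable g → ∀ C : ℝ, (∀ y, ‖g y‖ ≤ C) →
        ⟪x i, E.integral g (x j)⟫_ℂ = ∫ y, g y * m i j y ∂ν := by
  -- These are the vectors that occur when all pairs are polarized. The sum `ν` of their measures
  -- dominates each of them, so Radon–Nikodym densities exist and `m` is their polarization.
  let v : J × J × Fin 4 → H := fun p => x p.1 + Complex.I ^ (p.2.2 : ℕ) • x p.2.1
  let ν : Measure Y := Measure.sum fun p => E.measure (v p)
  let d : J × J × Fin 4 → Y → ℝ := fun p y => ((E.measure (v p)).rnDeriv ν y).toReal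
  let m : J → J → Y → ℂ := fun i j y =>
    4⁻¹ * ∑ k : Fin 4, (starRingEnd ℂ) (Complex.I ^ (k : ℕ)) * d (i, j, k) y
  have hd : ∀ p, Measurable (d p) := fun p => (Measure.measurable_rnDeriv _ _).ennreal_toReal
  have hdi : ∀ p, Integrable (d p) ν := fun p => Measure.integrable_toReal_rnDeriv
  have hac : ∀ p, E.measure (v p) ≪ ν := fun p =>
    (Measure.le_sum (fun p => E.measure (v p)) p).absolutelyContinuous
  have hm : ∀ i j, Measurable (m i j) := fun i j =>
    (Finset.measurable_sum _ fun k _ => (Complex.measurable_ofReal.comp (hd _)).const_mul _).const_mul _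
  have hmi : ∀ i j, Integrable (m i j) ν := fun i j =>
    (integrable_finsetSum _ fun k _ => ((hdi _).ofReal).const_mul _).const_mul _
  have hint : ∀ i j (g : Y → ℂ), Measurable g → ∀ C : ℝ, (∀ y, ‖g y‖ ≤ C) →
      ⟪x i, E.integral g (x j)⟫_ℂ = ∫ y, g y * m i j y ∂ν := by
    intro i j g hg C hC
    have e : ∀ y, g y * m i j y =
        4⁻¹ * ∑ k : Fin 4, (starRingEnd ℂ) (Complex.I ^ (k : ℕ)) * (d (i, j, k) y • g y) := by
      intro y
      simp only [m, Complex.real_smul, Finset.mul_sum]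
      exact Finset.sum_congr rfl fun k _ => by ring
    simp only [e]
    rw [integral_const_mul, integral_finsetSum, polarization]
    · congr 1
      refine Finset.sum_congr rfl fun k _ => ?_
      rw [integral_const_mul, integral_rnDeriv_smul (hac _)]
      exact congrArg _ (E.inner_integral hg hC _)
    · intro k _
      refine Integrable.const_mul ?_ _
      refine ((hdi (i, j, k)).mul_const C).mono' ((hd _).smul hg).aestronglyMeasurable (ae_of_all _ fun y => ?_)
      rw [norm_smul, Real.norm_of_nonneg ENNReal.toReal_nonneg]
      exact mul_le_mul_of_nonneg_left (hC y) ENNReal.toReal_nonneg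
  -- Over a measurable `B` this form integrates to `⟪z, E(B) z⟫ ≥ 0` with `z = ∑ c_i x_i`.
  have hpos : ∀ c : J → ℂ, ∀ᵐ y ∂ν, 0 ≤ ∑ i, ∑ j, (starRingEnd ℂ) (c i) * c j * m i j y := by
    intro c
    refine ae_nonneg_of_forall_setIntegral (integrable_finsetSum _ fun i _ =>
      integrable_finsetSum _ fun j _ => (hmi i j).const_mul _) fun B hB => ?_
    have e : ∫ y in B, ∑ i, ∑ j, (starRingEnd ℂ) (c i) * c j * m i j y ∂ν =
        ⟪∑ i, c i • x i, E B (∑ j, c j • x j)⟫_ℂ := by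
      rw [integral_finsetSum _ fun i _ =>
        integrable_finsetSum _ fun j _ => ((hmi i j).const_mul _).integrableOn]
      rw [map_sum, sum_inner]
      refine Finset.sum_congr rfl fun i _ => ?_
      rw [inner_sum, integral_finsetSum _ fun j _ => ((hmi i j).const_mul _).integrableOn]
      refine Finset.sum_congr rfl fun j _ => ?_
      rw [integral_const_mul, map_smul, inner_smul_left, inner_smul_right, mul_assoc,
        ← E.integral_indicator hB,
        hint i j _ (measurable_one.indicator hB) 1 (fun y => by by_cases h : y ∈ B <;> simp [h]),
        ← MeasureTheory.integral_indicator hB]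
      congr 3
      ext y
      by_cases h : y ∈ B <;> simp [h]
    rw [e]
    exact ((ContinuousLinearMap.nonneg_iff_isPositive _).1 (E.nonneg B hB)).inner_nonneg_right _
  -- The null set depends on `c`; a countable dense set of `c` needs only one, and continuity in `c`
  -- does the rest. Off `S` the densities are set to `0`, so that the Gram property holds at every
  -- point.
  obtain ⟨S, hS, hSm, hSp⟩ := (ae_all_iff.2 fun n => hpos (TopologicalSpace.denseSeq (J → ℂ) n)).exists_measurable_mem
  have hG : ∀ y, ∃ w : J → EuclideanSpace ℂ J, ∀ i j, S.indicator (m i j) y = ⟪w i, w j⟫_ℂ := by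
    intro y
    by_cases hy : y ∈ S
    · simp only [Set.indicator_of_mem hy]
      refine exists_gram (fun i j => m i j y) fun c => ?_
      refine (TopologicalSpace.denseRange_denseSeq (J → ℂ)).induction_on c
        (isClosed_le continuous_const ?_) (hSp y hy)
      fun_prop
    · exact ⟨0, fun i j => by simp [hy]⟩
  choose w hw using hG
  have hae : ∀ i j, S.indicator (m i j) =ᵐ[ν] m i j := fun i j => by
    filter_upwards [hS] with y hy using Set.indicator_of_mem hy _
  refine ⟨ν, fun i j => S.indicator (m i j), w, inferInstance, fun i j => (hm i j).indicator hSm,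
    fun i j => (hmi i j).indicator hSm, fun i j y => hw y i j, fun i j g hg C hC => ?_⟩
  rw [hint i j g hg C hC]
  refine integral_congr_ae ?_
  filter_upwards [hae i j] with y hy
  rw [hy]

/-- By the Gram property `|m₀₁| ≤ (m₀₀ + m₁₁) / 2` pointwise, and for unit vectors the diagonal
densities integrate to at most `1`. The constant `1` is essential, since only contractions have
tensor powers bounded uniformly in `N` by `norm_tensorOp_le_one`. -/
theorem POVM.norm_integral_le_one (E : POVM Y H) {g : Y → ℂ} (hg : Measurable g)
    (hC : ∀ y, ‖g y‖ ≤ 1) : ‖E.integral g‖ ≤ 1 := by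
  refine ContinuousLinearMap.opNorm_le_of_unit_norm zero_le_one fun ψ hψ => ?_
  by_cases h0 : ‖E.integral g ψ‖ = 0
  · rw [h0]; exact zero_le_one
  -- The normalized image vector, against which the matrix element is exactly the norm to be
  -- estimated.
  let x : Fin 2 → H := ![((‖E.integral g ψ‖⁻¹ : ℝ) : ℂ) • E.integral g ψ, ψ]
  have hx : ∀ i, ‖x i‖ = 1 := by
    intro i
    fin_cases i
    · simp [x, norm_smul, h0]
    · exact hψ
  obtain ⟨ν, m, w, hν, hm, hmi, hw, hint⟩ := E.exists_density x
  have h1 : ⟪x 0, E.integral g (x 1)⟫_ℂ = ‖E.integral g ψ‖ := by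
    simp only [x, Matrix.cons_val_zero, Matrix.cons_val_one, inner_smul_left, Complex.conj_ofReal,
      inner_self_eq_norm_sq_to_K]
    push_cast
    have : (‖E.integral g ψ‖ : ℂ) ≠ 0 := by exact_mod_cast h0
    field_simp
    rfl
  have h2 : ∀ i, ∫ y, (m i i y).re ∂ν ≤ 1 := by
    intro i
    have h3 := hint i i (fun _ => 1) measurable_const 1 (fun _ => by simp)
    have h4 : ∫ y, (m i i y).re ∂ν = (∫ y, m i i y ∂ν).re := integral_re (hmi i i)
    simp only [one_mul] at h3
    rw [h4, ← h3, E.integral_one]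
    have h5 := ((ContinuousLinearMap.nonneg_iff_isPositive _).1
      (sub_nonneg.2 E.univ_le_one)).re_inner_nonneg_right (x i)
    simp only [sub_apply, inner_sub_right, one_apply_eq_self, inner_self_eq_norm_sq_to_K, hx] at h5
    simpa using h5
  have hmr : ∀ i, Integrable (fun y => (m i i y).re) ν := fun i => (hmi i i).re
  have h6 : ‖(‖E.integral g ψ‖ : ℂ)‖ ≤ ∫ y, ((m 0 0 y).re + (m 1 1 y).re) / 2 ∂ν := by
    rw [← h1, hint 0 1 g hg 1 hC]
    refine norm_integral_le_of_norm_le (((hmr 0).add (hmr 1)).div_const 2)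
      (ae_of_all _ fun y => ?_)
    rw [norm_mul, hw, hw, hw]
    have h7 : ∀ i, (⟪w y i, w y i⟫_ℂ).re = ‖w y i‖ ^ 2 := fun i => inner_self_eq_norm_sq (𝕜 := ℂ) (w y i)
    rw [h7, h7]
    calc ‖g y‖ * ‖⟪w y 0, w y 1⟫_ℂ‖ ≤ 1 * (‖w y 0‖ * ‖w y 1‖) :=
          mul_le_mul (hC y) (norm_inner_le_norm _ _) (norm_nonneg _) zero_le_one
      _ ≤ _ := by nlinarith [sq_nonneg (‖w y 0‖ - ‖w y 1‖)]
  rw [integral_div, integral_add (hmr 0) (hmr 1)] at h6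
  rw [Complex.norm_real, norm_norm] at h6
  linarith [h2 0, h2 1]

end Density
end
end QuasiFree

namespace QuasiFree
open scoped TensorProduct InnerProductSpace ENNReal
open Filter Topology MeasureTheory
attribute [local instance 2000] InnerProductSpace.toInner
noncomputable section

/-! ### ### Joint measurement on finite combinations of product vectors -/

section TensorMeasure
universe w
variable {Y : Type*} [MeasurableSpace Y] {H : Type w} [NormedAddCommGroup H]
  [InnerProductSpace ℂ H] [CompleteSpace H]

/-- A finite combination of product vectors determines a finite measure
`⟪a, E(dy₁) ⊗ ⋯ ⊗ E(dy_N) a⟫`. -/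
theorem POVM.exists_tensor_measure (E : POVM Y H) {J A : Type*} [Fintype J] [Fintype A] {N : ℕ}
    (x : J → H) (φ : A → Fin N → J) (c : A → ℂ) :
    ∃ μ : Measure (Fin N → Y), IsFiniteMeasure μ ∧ ∀ g : Fin N → Y → ℂ,
      (∀ k, Measurable (g k)) → ∀ C : ℝ, (∀ k y, ‖g k y‖ ≤ C) →
      ∫ y, ∏ k, g k (y k) ∂μ = ⟪∑ α, c α • prodVec fun k => x (φ α k),
        tensorOp (fun k => E.integral (g k)) (∑ α, c α • prodVec fun k => x (φ α k))⟫_ℂ := by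
  obtain ⟨ν, m, w, hν, hm, hmi, hw, hint⟩ := E.exists_density x
  let q : (Fin N → Y) → ℂ := fun y =>
    ∑ α, ∑ β, (starRingEnd ℂ) (c α) * (c β * ∏ k, m (φ α k) (φ β k) (y k))
  -- The source of positivity: inner products of product vectors multiply, so the joint density is
  -- the squared norm of the same combination formed with the Gram vectors.
  have hq : ∀ y, q y = ((‖∑ α, c α • prodVec fun k => w (y k) (φ α k)‖ ^ 2 : ℝ) : ℂ) := by
    intro y
    have h1 := inner_self_eq_norm_sq_to_K (𝕜 := ℂ) (∑ α, c α • prodVec fun k => w (y k) (φ α k))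
    push_cast
    refine Eq.trans ?_ h1
    simp only [q, sum_inner, inner_smul_left]
    refine Finset.sum_congr rfl fun α _ => ?_
    rw [inner_sum, Finset.mul_sum]
    refine Finset.sum_congr rfl fun β _ => ?_
    rw [inner_smul_right, inner_prodVec]
    simp only [hw]
  have hqm : Measurable q := Finset.measurable_sum _ fun α _ => Finset.measurable_sum _ fun β _ =>
    ((Finset.measurable_prod _ fun k _ => (hm _ _).comp (measurable_pi_apply k)).const_mul _).const_mul _
  have hqi : Integrable q (Measure.pi fun _ => ν) := integrable_finsetSum _ fun α _ =>
    integrable_finsetSum _ fun β _ =>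
      ((Integrable.fintype_prod fun k => hmi (φ α k) (φ β k)).const_mul _).const_mul _
  refine ⟨(Measure.pi fun _ => ν).withDensity fun y => ENNReal.ofReal (q y).re,
    isFiniteMeasure_withDensity_ofReal hqi.re.2, fun g hg C hC => ?_⟩
  rw [integral_withDensity_eq_integral_toReal_smul (f := fun y => ENNReal.ofReal (q y).re)
    (Complex.measurable_re.comp hqm).ennreal_ofReal (ae_of_all _ fun _ => ENNReal.ofReal_lt_top)]
  have hgm : ∀ k i j, Integrable (fun y => g k y * m i j y) ν := fun k i j =>
    (hmi i j).bdd_mul (hg k).aestronglyMeasurable (ae_of_all _ (hC k))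
  have e : ∀ y : Fin N → Y, (ENNReal.ofReal (q y).re).toReal • ∏ k, g k (y k) =
      ∑ α, ∑ β, (starRingEnd ℂ) (c α) * (c β *
        ∏ k, (g k (y k) * m (φ α k) (φ β k) (y k))) := by
    intro y
    have h1 : (((ENNReal.ofReal (q y).re).toReal : ℝ) : ℂ) = q y := by
      rw [hq, Complex.ofReal_re, ENNReal.toReal_ofReal (sq_nonneg _)]
    rw [Complex.real_smul, h1]
    simp only [q, Finset.sum_mul, Finset.prod_mul_distrib]
    exact Finset.sum_congr rfl fun α _ => Finset.sum_congr rfl fun β _ => by ring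
  have hi : ∀ α β, Integrable (fun y : Fin N → Y => (starRingEnd ℂ) (c α) * (c β *
      ∏ k, (g k (y k) * m (φ α k) (φ β k) (y k)))) (Measure.pi fun _ => ν) := fun α β =>
    ((Integrable.fintype_prod fun k => hgm k (φ α k) (φ β k)).const_mul _).const_mul _
  simp only [e]
  rw [integral_finsetSum _ fun α _ => integrable_finsetSum _ fun β _ => hi α β, sum_inner]
  refine Finset.sum_congr rfl fun α _ => ?_
  rw [integral_finsetSum _ fun β _ => hi α β, map_sum, inner_sum]
  refine Finset.sum_congr rfl fun β _ => ?_
  rw [integral_const_mul, integral_const_mul, map_smul, inner_smul_left, inner_smul_right,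
    tensorOp_prodVec, inner_prodVec,
    integral_fintype_prod_eq_prod (μ := fun _ => ν) fun k y => g k y * m (φ α k) (φ β k) y]
  congr 2
  exact Finset.prod_congr rfl fun k _ => (hint _ _ (g k) (hg k) C (hC k)).symm

theorem POVM.exists_symVec_measure (E : POVM Y H) (s : ℤˣ) {N : ℕ} (x : Fin N → H) :
    ∃ μ : Measure (Fin N → Y), IsFiniteMeasure μ ∧ ∀ g : Fin N → Y → ℂ,
      (∀ k, Measurable (g k)) → ∀ C : ℝ, (∀ k y, ‖g k y‖ ≤ C) →
      ∫ y, ∏ k, g k (y k) ∂μ = ⟪(symVec s x : Tensor H N),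
        tensorOp (fun k => E.integral (g k)) (symVec s x : Tensor H N)⟫_ℂ := by
  -- The symmetrized vector is a combination, indexed by permutations, of product vectors built from
  -- the same `N` vectors.
  have h := E.exists_tensor_measure x (fun (π : Equiv.Perm (Fin N)) k => π k)
    fun π => ((N.factorial : ℂ))⁻¹ * statC s π
  simpa only [mul_smul, ← Finset.smul_sum, ← coe_symVec] using h

/-- The distribution `⟪ψ, E(dy₁) ⊗ ⋯ ⊗ E(dy_N) ψ⟫` of the outcomes of measuring `E` on every
particle in the (anti)symmetrized product vector `ψ`. -/
def POVM.symVecMeasure (E : POVM Y H) (s : ℤˣ) {N : ℕ} (x : Fin N → H) : Measure (Fin N → Y) :=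
  (E.exists_symVec_measure s x).choose

instance (E : POVM Y H) (s : ℤˣ) {N : ℕ} (x : Fin N → H) : IsFiniteMeasure (E.symVecMeasure s x) :=
  (E.exists_symVec_measure s x).choose_spec.1

theorem POVM.integral_symVecMeasure (E : POVM Y H) (s : ℤˣ) {N : ℕ} (x : Fin N → H)
    {g : Fin N → Y → ℂ} (hg : ∀ k, Measurable (g k)) {C : ℝ} (hC : ∀ k y, ‖g k y‖ ≤ C) :
    ∫ y, ∏ k, g k (y k) ∂E.symVecMeasure s x = ⟪(symVec s x : Tensor H N),
        tensorOp (fun k => E.integral (g k)) (symVec s x : Tensor H N)⟫_ℂ :=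
  (E.exists_symVec_measure s x).choose_spec.2 g hg C hC

theorem POVM.symVecMeasure_real_pi (E : POVM Y H) (s : ℤˣ) {N : ℕ} (x : Fin N → H)
    {B : Fin N → Set Y} (hB : ∀ k, MeasurableSet (B k)) :
    (((E.symVecMeasure s x).real (Set.univ.pi B) : ℝ) : ℂ) = ⟪(symVec s x : Tensor H N),
        tensorOp (fun k => E (B k)) (symVec s x : Tensor H N)⟫_ℂ := by
  have h := E.integral_symVecMeasure s x (g := fun k => (B k).indicator 1)
    (fun k => measurable_one.indicator (hB k)) (C := 1)
    (fun k y => by by_cases h : y ∈ B k <;> simp [h])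
  simp only [E.integral_indicator (hB _)] at h
  rw [← h]
  have e : (fun y : Fin N → Y => ∏ k, (B k).indicator (1 : Y → ℂ) (y k)) =
      (Set.univ.pi B).indicator 1 := by
    ext y
    by_cases hy : y ∈ Set.univ.pi B
    · rw [Set.indicator_of_mem hy]
      exact Finset.prod_eq_one fun k _ => Set.indicator_of_mem (hy k trivial) _
    · rw [Set.indicator_of_notMem hy]
      simp only [Set.mem_univ_pi, not_forall] at hy
      obtain ⟨k, hk⟩ := hy
      exact Finset.prod_eq_zero (Finset.mem_univ k) (Set.indicator_of_notMem hk _)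
  rw [e, MeasureTheory.integral_indicator (MeasurableSet.univ_pi hB)]
  simp

theorem POVM.symVecMeasure_real_univ (E : POVM Y H) (hE : E Set.univ = 1) (s : ℤˣ) {N : ℕ}
    (x : Fin N → H) : (E.symVecMeasure s x).real Set.univ = ‖symVec s x‖ ^ 2 := by
  have h := E.symVecMeasure_real_pi s x (B := fun _ => Set.univ) fun _ => MeasurableSet.univ
  rw [Set.pi_univ, hE, tensorOp_one, one_apply_eq_self, inner_self_eq_norm_sq_to_K] at h
  exact Complex.ofReal_injective (h.trans (Complex.ofReal_pow _ 2).symm)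

end TensorMeasure
end
end QuasiFree

namespace QuasiFree
open scoped TensorProduct InnerProductSpace ENNReal
open Filter Topology MeasureTheory
attribute [local instance 2000] InnerProductSpace.toInner
noncomputable section

/-! ### ### Records and the empirical measure of the clicks -/

section SigmaMeasure
variable {Y : Type*}

/-- A tuple of outcomes, as a record. -/
abbrev recordMk (N : ℕ) (y : Fin N → Y) : Σ N : ℕ, Fin N → Y := ⟨N, y⟩

theorem recordMk_injective (N : ℕ) : Function.Injective (recordMk (Y := Y) N) :=
  fun _ _ h => eq_of_heq (Sigma.mk.inj h).2

theorem recordMk_preimage_image_of_ne {M N : ℕ} (h : M ≠ N) (T : Set (Fin N → Y)) :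
    recordMk M ⁻¹' (recordMk N '' T) = ∅ := by
  ext y
  simp only [Set.mem_preimage, Set.mem_image, Set.mem_empty_iff_false, iff_false]
  rintro ⟨z, _, hz⟩
  exact h (congrArg Sigma.fst hz).symm

variable [MeasurableSpace Y]

theorem measurableSet_sigma_iff {S : Set (Σ N : ℕ, Fin N → Y)} :
    MeasurableSet S ↔ ∀ N, MeasurableSet (recordMk N ⁻¹' S) :=
  MeasurableSpace.measurableSet_iInf

theorem measurable_sigma_iff {Z : Type*} [MeasurableSpace Z] {f : (Σ N : ℕ, Fin N → Y) → Z} :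
    Measurable f ↔ ∀ N, Measurable fun y : Fin N → Y => f ⟨N, y⟩ :=
  ⟨fun h N _ hS => measurableSet_sigma_iff.1 (h hS) N,
    fun h _ hS => measurableSet_sigma_iff.2 fun N => h N hS⟩

theorem measurable_recordMk (N : ℕ) :
    Measurable (recordMk (Y := Y) N) :=
  measurable_sigma_iff.1 measurable_id N

theorem measurableSet_recordMk_image {N : ℕ} {T : Set (Fin N → Y)} (hT : MeasurableSet T) :
    MeasurableSet (recordMk N '' T) := by
  refine measurableSet_sigma_iff.2 fun M => ?_
  by_cases h : M = N
  · subst h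
    rwa [Set.preimage_image_eq _ (recordMk_injective M)]
  · rw [recordMk_preimage_image_of_ne h]
    exact MeasurableSet.empty

/-- For each length the boxes form a π-system that generates the product σ-algebra and contains the
whole space. A measure on records is the sum of its parts of fixed length. -/
theorem measure_eq_of_boxes {P P' : Measure (Σ N : ℕ, Fin N → Y)} [IsFiniteMeasure P]
    (h : ∀ (N : ℕ) (B : Fin N → Set Y), (∀ k, MeasurableSet (B k)) →
      P (recordMk N '' Set.univ.pi B) = P' (recordMk N '' Set.univ.pi B)) : P = P' := by
  have hN : ∀ N, P.comap (recordMk N) = P'.comap (recordMk N) := by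
    intro N
    have hc : ∀ (Q : Measure (Σ N : ℕ, Fin N → Y)) (T : Set (Fin N → Y)), MeasurableSet T →
        Q.comap (recordMk N) T = Q (recordMk N '' T) := fun Q T hT =>
      Measure.comap_apply _ (recordMk_injective N) (fun _ => measurableSet_recordMk_image) _ hT
    have hf : IsFiniteMeasure (P.comap (recordMk N)) :=
      ⟨by rw [hc _ _ MeasurableSet.univ]; exact measure_lt_top _ _⟩
    refine ext_of_generate_finite _ generateFrom_pi.symm isPiSystem_pi ?_ ?_
    · rintro _ ⟨B, hB, rfl⟩
      have hB' : ∀ k, MeasurableSet (B k) := fun k => hB k trivial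
      rw [hc _ _ (MeasurableSet.univ_pi hB'), hc _ _ (MeasurableSet.univ_pi hB'), h N B hB']
    · rw [hc _ _ MeasurableSet.univ, hc _ _ MeasurableSet.univ]
      simpa using h N (fun _ => Set.univ) fun _ => MeasurableSet.univ
  have hS : ∀ (Q : Measure (Σ N : ℕ, Fin N → Y)) (S : Set (Σ N : ℕ, Fin N → Y)), MeasurableSet S →
      Q S = ∑' N, Q.comap (recordMk N) (recordMk N ⁻¹' S) := by
    intro Q S hS
    have hm := measurableSet_sigma_iff.1 hS
    have e : S = ⋃ N, recordMk N '' (recordMk N ⁻¹' S) := by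
      ext ⟨N, y⟩
      simp only [Set.mem_iUnion]
      refine ⟨fun h => ⟨N, y, h, rfl⟩, ?_⟩
      rintro ⟨M, z, hz, h⟩
      exact h ▸ hz
    conv_lhs => rw [e]
    rw [measure_iUnion ?_ fun N => measurableSet_recordMk_image (hm N)]
    · exact tsum_congr fun N => (Measure.comap_apply _ (recordMk_injective N)
        (fun _ => measurableSet_recordMk_image) _ (hm N)).symm
    · rintro M N hMN
      refine Set.disjoint_left.2 ?_
      rintro _ ⟨y, _, rfl⟩ ⟨z, _, hz⟩
      exact hMN (congrArg Sigma.fst hz).symm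
  ext S hSm
  rw [hS P S hSm, hS P' S hSm]
  exact tsum_congr fun N => by rw [hN N]

variable {X : Type*} [MeasurableSpace X]

theorem measurable_clickMeasure :
    Measurable (clickMeasure : (Σ N : ℕ, Fin N → X ⊕ Unit) → Measure X) := by
  refine measurable_sigma_iff.2 fun N => ?_
  refine Measure.measurable_of_measurable_coe _ fun B hB => ?_
  simp only [clickMeasure, Measure.coe_finsetSum, Finset.sum_apply]
  have hd : Measurable (Sum.elim (fun x => Measure.dirac x) fun _ => 0 : X ⊕ Unit → Measure X) :=
    Measure.measurable_dirac.sumElim measurable_const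
  exact Finset.measurable_fun_sum Finset.univ fun k _ =>
    (Measure.measurable_coe hB).comp (hd.comp (measurable_pi_apply k))

/-- The Bochner integral is `0` when `f` is not integrable, so the integral is defined piecewise in
`ξ`, over a measurable condition. -/
theorem measurable_integral_measure {f : X → ℝ} (hf : Measurable f) :
    Measurable fun ξ : Measure X => ∫ x, f x ∂ξ := by
  classical
  have e : (fun ξ : Measure X => ∫ x, f x ∂ξ) = fun ξ => if ∫⁻ x, ‖f x‖ₑ ∂ξ < ∞ then
      (∫⁻ x, ENNReal.ofReal (f x) ∂ξ).toReal - (∫⁻ x, ENNReal.ofReal (-f x) ∂ξ).toReal else 0 := by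
    ext ξ
    split_ifs with h
    · exact integral_eq_lintegral_pos_part_sub_lintegral_neg_part ⟨hf.aestronglyMeasurable, h⟩
    · exact integral_undef fun hi => h hi.2
  rw [e]
  refine Measurable.ite (measurableSet_lt (Measure.measurable_lintegral hf.enorm) measurable_const)
    ?_ measurable_const
  exact (Measure.measurable_lintegral hf.ennreal_ofReal).ennreal_toReal.sub
    (Measure.measurable_lintegral hf.neg.ennreal_ofReal).ennreal_toReal

theorem exp_integral_clickMeasure {f : X → ℝ} (hf : Measurable f) {N : ℕ} (y : Fin N → X ⊕ Unit) :
    Complex.exp (Complex.I * ((∫ x, f x ∂(clickMeasure ⟨N, y⟩) : ℝ) : ℂ)) =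
      ∏ k, Sum.elim (fun x => Complex.exp (Complex.I * f x)) (fun _ => 1) (y k) := by
  have h1 : ∀ z : X ⊕ Unit, Integrable f (Sum.elim (fun x => Measure.dirac x) (fun _ => 0) z) := by
    rintro (x | u)
    · exact integrable_dirac' hf.stronglyMeasurable enorm_lt_top
    · exact integrable_zero_measure
  rw [clickMeasure, integral_finsetSum_measure fun k _ => h1 (y k)]
  push_cast
  rw [Finset.mul_sum, Complex.exp_sum]
  refine Finset.prod_congr rfl fun k _ => ?_
  rcases y k with x | u
  · simp only [Sum.elim_inl]
    rw [integral_dirac' _ _ hf.stronglyMeasurable]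
  · simp

end SigmaMeasure

/-! ### ### The record law of the quasi-free state -/

section RecordLaw
universe w
variable {X : Type*} [MeasurableSpace X] {H : Type w} [NormedAddCommGroup H]
  [InnerProductSpace ℂ H] {ι : Type*}
  {σ : H →L[ℂ] H} {e : HilbertBasis ι ℂ H} {l : ι → ℝ} {s : ℤˣ}

theorem coeff_nonneg (h : IsEigenbasis σ e l) (hs : s = 1 → ‖σ‖ < 1) (k : Σ N : ℕ, Fin N → ι) :
    0 ≤ (partFun s e l)⁻¹ * weight l k :=
  mul_nonneg (inv_nonneg.2 (partFun_pos h hs).le) (h.weight_nonneg k)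

variable [CompleteSpace H]

/-- The law of the record of a measurement of `F` on every particle, as a mixture over the
eigenvectors of the quasi-free state. -/
def recordLaw (F : POVM X H) (s : ℤˣ) (e : HilbertBasis ι ℂ H) (l : ι → ℝ) :
    Measure (Σ N : ℕ, Fin N → X ⊕ Unit) :=
  Measure.sum fun k : Σ N : ℕ, Fin N → ι => ENNReal.ofReal ((partFun s e l)⁻¹ * weight l k) •
    (F.plus.symVecMeasure s fun j => e (k.2 j)).map (recordMk k.1)

theorem recordLaw_apply (F : POVM X H) (s : ℤˣ) (e : HilbertBasis ι ℂ H) (l : ι → ℝ)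
    {S : Set (Σ N : ℕ, Fin N → X ⊕ Unit)} (hS : MeasurableSet S) :
    recordLaw F s e l S = ∑' k : Σ N : ℕ, Fin N → ι,
      ENNReal.ofReal ((partFun s e l)⁻¹ * weight l k) *
        F.plus.symVecMeasure s (fun j => e (k.2 j)) (recordMk k.1 ⁻¹' S) := by
  rw [recordLaw, Measure.sum_apply _ hS]
  exact tsum_congr fun k => by
    rw [Measure.smul_apply, Measure.map_apply (measurable_recordMk _) hS, smul_eq_mul]

/-- The total effect of `F.plus` is `1`, so each component of the mixture has mass `‖tupleVec‖²`,
and the weighted masses add up to `partFun`. -/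
theorem isProbabilityMeasure_recordLaw (F : POVM X H) (h : IsEigenbasis σ e l)
    (hs : s = 1 → ‖σ‖ < 1) : IsProbabilityMeasure (recordLaw F s e l) := by
  refine ⟨?_⟩
  rw [recordLaw_apply F s e l MeasurableSet.univ]
  have e1 : ∀ k : Σ N : ℕ, Fin N → ι, ENNReal.ofReal ((partFun s e l)⁻¹ * weight l k) *
      F.plus.symVecMeasure s (fun j => e (k.2 j)) (recordMk k.1 ⁻¹' Set.univ) =
        ENNReal.ofReal ((partFun s e l)⁻¹ * (weight l k * ‖tupleVec s e k‖ ^ 2)) := by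
    intro k
    have h1 := F.plus.symVecMeasure_real_univ F.plus_univ s fun j => e (k.2 j)
    rw [Set.preimage_univ, ← ENNReal.ofReal_toReal (measure_ne_top _ Set.univ),
      ← ENNReal.ofReal_mul (coeff_nonneg h hs k), mul_assoc]
    congr 3
  have hsum := (h.summable_weight hs).mul_left (partFun s e l)⁻¹
  rw [tsum_congr e1, ← ENNReal.ofReal_tsum_of_nonneg (fun k => ?_) hsum, tsum_mul_left]
  · change ENNReal.ofReal ((partFun s e l)⁻¹ * partFun s e l) = 1
    rw [inv_mul_cancel₀ (partFun_pos h hs).ne', ENNReal.ofReal_one]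
  · rw [← mul_assoc]
    exact mul_nonneg (coeff_nonneg h hs k) (sq_nonneg _)

theorem hasSum_integral_recordLaw (F : POVM X H) (h : IsEigenbasis σ e l)
    (hs : s = 1 → ‖σ‖ < 1) {G : (Σ N : ℕ, Fin N → X ⊕ Unit) → ℂ} (hG : Measurable G) {C : ℝ}
    (hC : ∀ r, ‖G r‖ ≤ C) :
    HasSum (fun k : Σ N : ℕ, Fin N → ι => (((partFun s e l)⁻¹ * weight l k : ℝ) : ℂ) *
      ∫ y, G ⟨k.1, y⟩ ∂F.plus.symVecMeasure s fun j => e (k.2 j)) (∫ r, G r ∂recordLaw F s e l) := by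
  have hP := isProbabilityMeasure_recordLaw F h hs
  have hi : Integrable G (recordLaw F s e l) :=
    (integrable_const C).mono' hG.aestronglyMeasurable (ae_of_all _ hC)
  have e1 : ∀ k : Σ N : ℕ, Fin N → ι, (((partFun s e l)⁻¹ * weight l k : ℝ) : ℂ) *
      ∫ y, G ⟨k.1, y⟩ ∂(F.plus.symVecMeasure s fun j => e (k.2 j)) =
        ∫ r, G r ∂(ENNReal.ofReal ((partFun s e l)⁻¹ * weight l k) •
          (F.plus.symVecMeasure s fun j => e (k.2 j)).map (recordMk k.1)) := fun k => by
    rw [integral_smul_measure, integral_map (measurable_recordMk _).aemeasurable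
      hG.aestronglyMeasurable, ENNReal.toReal_ofReal (coeff_nonneg h hs k), Complex.real_smul]
  simp only [e1]
  exact hasSum_integral_measure hi

theorem isRecordLaw_recordLaw (F : POVM X H) (h : IsEigenbasis σ e l) (hs : s = 1 → ‖σ‖ < 1) :
    IsRecordLaw F (quasiFree s σ) (recordLaw F s e l) := by
  refine ⟨isProbabilityMeasure_recordLaw F h hs, fun N B hB => ?_⟩
  have hm := measurableSet_recordMk_image (MeasurableSet.univ_pi hB)
  have h1 := hasSum_integral_recordLaw F h hs (measurable_one.indicator hm) (C := 1)
    (fun r => by by_cases hr : r ∈ recordMk N '' Set.univ.pi B <;> simp [hr])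
  rw [MeasureTheory.integral_indicator hm] at h1
  simp only [Pi.one_apply, integral_const, measureReal_restrict_apply_univ, Complex.real_smul,
    mul_one] at h1
  rw [← h1.tsum_eq, trace_quasiFree_fockTensorOp h hs, ← tsum_mul_left,
    ← Function.Injective.tsum_eq (recordMk_injective (Y := ι) N)]
  · refine tsum_congr fun i => ?_
    have e1 : (fun y : Fin N → X ⊕ Unit => (recordMk N '' Set.univ.pi B).indicator (1 : (Σ N : ℕ, Fin N → X ⊕ Unit) → ℂ)
        (⟨N, y⟩ : Σ N : ℕ, Fin N → X ⊕ Unit)) = (Set.univ.pi B).indicator 1 := by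
      conv_rhs => rw [← Set.preimage_image_eq (Set.univ.pi B)
        (recordMk_injective N)]
      rfl
    have h2 := F.plus.symVecMeasure_real_pi s (fun j => e (i j)) hB
    rw [e1, MeasureTheory.integral_indicator (MeasurableSet.univ_pi hB)]
    simp only [Pi.one_apply, integral_const, measureReal_restrict_apply_univ, Complex.real_smul,
      mul_one]
    rw [h2]
    push_cast
    exact mul_assoc _ _ _
  -- Tuples of length `K ≠ N` give measures on records of length `K`, which miss the box.
  · rintro ⟨K, i⟩ hk
    by_cases hKN : K = N
    · subst hKN; exact ⟨i, rfl⟩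
    · refine absurd ?_ hk
      have e1 : ∀ y : Fin K → X ⊕ Unit, (recordMk N '' Set.univ.pi B).indicator (1 : (Σ N : ℕ, Fin N → X ⊕ Unit) → ℂ)
          (⟨K, y⟩ : Σ N : ℕ, Fin N → X ⊕ Unit) = 0 := fun y =>
        Set.indicator_of_notMem (fun hy => by
          have : y ∈ recordMk K ⁻¹' (recordMk N '' Set.univ.pi B) := hy
          rwa [recordMk_preimage_image_of_ne hKN] at this) _
      simp only [e1, integral_zero, mul_zero]

/-- The trace formula prescribes the probability of every box, which leaves no freedom. -/
theorem isRecordLaw_iff (F : POVM X H) (h : IsEigenbasis σ e l) (hs : s = 1 → ‖σ‖ < 1)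
    (P : Measure (Σ N : ℕ, Fin N → X ⊕ Unit)) :
    IsRecordLaw F (quasiFree s σ) P ↔ P = recordLaw F s e l := by
  refine ⟨fun hP => ?_, fun hP => hP ▸ isRecordLaw_recordLaw F h hs⟩
  have h1 := hP.1
  have hQ := isRecordLaw_recordLaw F h hs
  have h2 := hQ.1
  refine measure_eq_of_boxes fun N B hB => ?_
  have h3 := Complex.ofReal_injective ((hP.2 N B hB).trans (hQ.2 N B hB).symm)
  exact (ENNReal.toReal_eq_toReal_iff' (measure_ne_top _ _) (measure_ne_top _ _)).1 h3

/-- The integrand is a product over the slots with the same factor in each, so every component of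
the mixture yields a diagonal matrix element of a tensor power of one operator: the integral of that
factor against `F.plus`. -/
theorem integral_exp_recordLaw (F : POVM X H) (h : IsEigenbasis σ e l) (hs : s = 1 → ‖σ‖ < 1)
    {f : X → ℝ} (hf : Measurable f) :
    ∫ ξ, Complex.exp (Complex.I * ((∫ x, f x ∂ξ : ℝ) : ℂ)) ∂(recordLaw F s e l).map clickMeasure =
      ((partFun s e l : ℝ) : ℂ)⁻¹ * partSum s e l
        (F.integral (fun x => Complex.exp (Complex.I * f x)) + (1 - F Set.univ)) := by
  have hg : Measurable fun x => Complex.exp (Complex.I * f x) :=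
    Complex.measurable_exp.comp ((Complex.measurable_ofReal.comp hf).const_mul _)
  have hgn : ∀ x, ‖Complex.exp (Complex.I * f x)‖ ≤ 1 := fun x => by
    rw [mul_comm, Complex.norm_exp_ofReal_mul_I]
  have hm : Measurable fun ξ : Measure X => Complex.exp (Complex.I * ((∫ x, f x ∂ξ : ℝ) : ℂ)) :=
    Complex.measurable_exp.comp
      ((Complex.measurable_ofReal.comp (measurable_integral_measure hf)).const_mul _)
  rw [integral_map measurable_clickMeasure.aemeasurable hm.aestronglyMeasurable]
  have h1 := hasSum_integral_recordLaw F h hs (hm.comp measurable_clickMeasure) (C := 1) fun r => by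
    simp only [Function.comp_apply]
    rw [mul_comm, Complex.norm_exp_ofReal_mul_I]
  refine h1.tsum_eq.symm.trans ?_
  rw [partSum, ← tsum_mul_left]
  refine tsum_congr fun k => ?_
  simp only [Function.comp_apply, exp_integral_clickMeasure hf]
  have h2 : Measurable (Sum.elim (fun x => Complex.exp (Complex.I * f x)) fun _ : Unit => 1) :=
    hg.sumElim measurable_const
  rw [F.plus.integral_symVecMeasure s (fun j => e (k.2 j)) (fun _ => h2) (C := 1) (fun _ y => by
    rcases y with y | y
    · exact hgn y
    · simp), F.plus_integral hg hgn]
  push_cast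
  exact mul_assoc _ _ _

theorem norm_integral_add_le_one (F : POVM X H) {g : X → ℂ} (hg : Measurable g)
    (hC : ∀ x, ‖g x‖ ≤ 1) : ‖F.integral g + (1 - F Set.univ)‖ ≤ 1 := by
  rw [← F.plus_integral hg hC]
  refine F.plus.norm_integral_le_one (hg.sumElim measurable_const) ?_
  rintro (x | u)
  · exact hC x
  · simp

end RecordLaw
end
end QuasiFree

theorem mainTheorem4 {X : Type*} [MeasurableSpace X] {H : Type*} [NormedAddCommGroup H]
    [InnerProductSpace ℂ H] [CompleteSpace H] (s : ℤˣ) (σ : H →L[ℂ] H) (hσ : 0 ≤ σ)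
    (hσ_trace : QuasiFree.IsTraceClass σ) (hσ_bose : s = 1 → ‖σ‖ < 1)
    (F : QuasiFree.POVM X H) :
    -- `Γ_s(σ)` is trace class, `ρ = Γ_s(σ) / tr Γ_s(σ)` is a density operator, `σ̂` makes sense
    QuasiFree.FockBounded s σ ∧
    QuasiFree.IsTraceClass (QuasiFree.Gamma s σ) ∧
    0 ≤ QuasiFree.quasiFree s σ ∧
    QuasiFree.trace (QuasiFree.quasiFree s σ) = 1 ∧
    IsUnit (1 - (((s : ℤ) : ℂ)) • σ) ∧
    -- the counting statistics `Q` of the second quantized observable exists and is unique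
    ∃ Q : MeasureTheory.Measure (MeasureTheory.Measure X),
      (∀ Q', QuasiFree.IsCountingStatistics F (QuasiFree.quasiFree s σ) Q' ↔ Q' = Q) ∧
      ∀ f : X → ℝ, Measurable f →
        let M : H →L[ℂ] H :=
          F.integral (fun x => Complex.exp (Complex.I * f x)) + (1 - F Set.univ)
        let D : H →L[ℂ] H := QuasiFree.hatOp s σ *
          F.integral (fun x => Complex.exp (Complex.I * f x) - 1)
        QuasiFree.FockBounded s M ∧
        QuasiFree.IsTraceClass (QuasiFree.quasiFree s σ * QuasiFree.Gamma s M) ∧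
        QuasiFree.IsTraceClass D ∧
        (s = 1 → QuasiFree.fredholmDet (1 - (((s : ℤ) : ℂ)) • D) ≠ 0) ∧
        -- `C(f) = ⟨exp(i ξ[f])⟩ = tr ρ Γ_s(F[e^{if}] + 1 - F(X)) = det(1 - s σ̂ F[e^{if} - 1])^{-s}`
        ∫ ξ, Complex.exp (Complex.I * ((∫ x, f x ∂ξ : ℝ) : ℂ)) ∂Q =
          QuasiFree.trace (QuasiFree.quasiFree s σ * QuasiFree.Gamma s M) ∧
        ∫ ξ, Complex.exp (Complex.I * ((∫ x, f x ∂ξ : ℝ) : ℂ)) ∂Q =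
          QuasiFree.fredholmDet (1 - (((s : ℤ) : ℂ)) • D) ^ (-(s : ℤ)) := by
  obtain ⟨ι, e, l, h⟩ := hσ_trace.exists_isEigenbasis hσ
  refine ⟨h.fockBounded hσ_bose, (h.gamma_rep hσ_bose).isTraceClass,
    QuasiFree.quasiFree_nonneg h hσ_bose, QuasiFree.trace_quasiFree h hσ_bose,
    QuasiFree.isUnit_one_sub hσ hσ_bose,
    (QuasiFree.recordLaw F s e l).map QuasiFree.clickMeasure, fun Q' => ?_, fun f hf => ?_⟩
  · simp only [QuasiFree.IsCountingStatistics, QuasiFree.isRecordLaw_iff F h hσ_bose,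
      exists_eq_left]
  intro M D
  have hg : Measurable fun x => Complex.exp (Complex.I * f x) :=
    Complex.measurable_exp.comp ((Complex.measurable_ofReal.comp hf).const_mul _)
  have hgn : ∀ x, ‖Complex.exp (Complex.I * f x)‖ ≤ 1 := fun x => by
    rw [mul_comm, Complex.norm_exp_ofReal_mul_I]
  have hM : ‖M‖ ≤ 1 := QuasiFree.norm_integral_add_le_one F hg hgn
  -- The total effect `F(X)` subtracted from `F[e^{if}]` is the same in both expressions: `F[e^{if}
  -- - 1] = F[e^{if}] - F(X) = M - 1`.
  have hD : D = QuasiFree.hatOp s σ * (M - 1) := by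
    have e1 : M - 1 = F.integral (fun x => Complex.exp (Complex.I * f x) - 1) := by
      rw [F.integral_sub_one hg hgn]
      simp only [M]
      abel
    rw [e1]
  have hdet := QuasiFree.trace_eq_fredholmDet h hσ hσ_bose hM
  rw [← hD] at hdet
  have hC := (QuasiFree.integral_exp_recordLaw F h hσ_bose hf).trans
    (QuasiFree.trace_quasiFree_mul_gamma h hσ_bose hM).symm
  exact ⟨QuasiFree.fockBounded_of_norm_le_one s hM,
    ((QuasiFree.quasiFree_rep h hσ_bose).mul_right _).isTraceClass,
    hD ▸ QuasiFree.isTraceClass_hatOp_mul h hσ hσ_bose (M - 1), hdet.1, hC, hC.trans hdet.2⟩
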